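/- Let $G=\mathrm{PGL}_2(\mathbb R)$, let $\Gamma\subset G$ be a discrete cocompact subgroup, $X=\Gamma\backslash G$, and let $\mu_X$ be the $G$-invariant measure of total mass one on $X$. For $\tau\in\mathbb C$ let $V_\tau$ be the space of smooth even homogeneous functions of degree $\tau-1$ on $\mathbb R^2\setminus 0$, with $(\pi_\tau(g)f)(s)=|\det g|^{(\tau-1)/2}f(g^{-1}s)$. For $\tau\in i\mathbb R$ (principal series) it carries the invariant scalar product $P(f,g)=\frac1{2\pi}\int_{S^1}f\bar g\,d\theta$. For $\tau\in(-1,0)$ (complementary series; $V_\tau\simeq V_{-\tau}$) it carries the invariant scalar product proportional to $\iint f(x)\overline{g(y)}\,|\sin(x-y)|^{-\tau-1}dx\,dy$, normalized so that the function equal to $1$ on the unit circle has norm one. Let $V=V_\tau$ and $V'=V_{\tau'}$ with $\tau,\tau'\in i\mathbb R\cup(-1,0)$, and let $\nu:V\to C^\infty(X)$, $\nu':V'\to C^\infty(X)$ be continuous $G$-morphisms that are isometric for $P$ and the $L^2(X,\mu_X)$ scalar product. Let $E$ be the space of smooth vectors of the completed tensor product of $V$ and $V'$ as a representation of $G\times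 G$, that is, the space of smooth functions on $(\mathbb R^2\setminus0)^2$ that are even and homogeneous of degrees $\tau-1$ and $\tau'-1$ in the two variables, with its scalar product $P=P_V\otimes P_{V'}$. Realize $E$ in $C^\infty(X\times X)$ by the extension of $\nu\otimes\nu'$, and let $H_\Delta(u)=\int_X|u(x,x)|^2d\mu_X$. For $\lambda\in i\mathbb R$ let $H^{mod}_\lambda(u)=\frac1{2\pi}\int_0^{2\pi}|(T_\lambda u)(z)|^2dz$, where, in angular coordinates on the unit circle, $$(T_\lambda u)(z)=\frac1{(2\pi)^2}\iint u(x,y)\,|\sin(y-z)|^{\frac{\tau-\tau'-\lambda-1}2}|\sin(x-z)|^{\frac{-\tau+\tau'-\lambda-1}2}|\sin(x-y)|^{\frac{-\tau-\tau'+\lambda-1}2}\,dx\,dy .$$ Fix a basis $X_1,\dots,X_6$ of the Lie algebra of $G\times G$. For a natural number $l$ and $T>0$ let $Q_{l,T}(u)=\sum_{|n|\le l}T^{2(l-|n|)}P(X^n u)$ on $E$, where $n=(n_1,\dots,n_6)$ runs over multi-indices, $|n|=\sum_j n_j$ and $X^n=X_1^{n_1}\cdots X_6^{n_6}$. For a nonnegative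 Hermitian form $H$ on $E$ let $\rho(H)=\mathrm{tr}(H\,|\,Q_{l,T})\in[0,\infty]$ be the square of the Hilbert–Schmidt norm of the identity $(E,Q_{l,T})\to(E,H)$. **Proposition.** Let $l\ge2$. There are constants $C,c>0$, depending only on $\Gamma$, $l$ and the basis $(X_j)$, such that for all $V,V',\nu,\nu'$ as above there is $T_0>0$ such that for every $T\ge T_0$: 1. $\rho(H_\Delta)\le C\,T^{2-2l}$; 2. $\rho(H^{mod}_\lambda)\ge c\,T^{-2l}$ for every $\lambda\in i\mathbb R$ with $|\lambda|\le 2T$. -/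

import Mathlib

open scoped ENNReal ContDiff ComplexConjugate

noncomputable section

namespace TripleProduct

open MeasureTheory

/-! ### The group `PGL(2, ℝ)` and the automorphic space `Γ \ G` -/

/-- The group `G = PGL(2, ℝ)`. -/
abbrev G : Type := Matrix.ProjGenLinGroup (Fin 2) ℝ

/-- The quotient map `GL(2, ℝ) → PGL(2, ℝ)`. -/
def toG : GL (Fin 2) ℝ →* G := Matrix.ProjGenLinGroup.mk

/-- `PGL(2, ℝ)` carries the quotient topology from `GL(2, ℝ)`. -/
instance : TopologicalSpace G := TopologicalSpace.coinduced toG inferInstance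

/-- The automorphic space `X = Γ \ G`, the space of right cosets `Γ g`. -/
def X (Γ : Subgroup G) : Type := Quotient (QuotientGroup.rightRel Γ)

variable {Γ : Subgroup G}

/-- The projection `G → Γ \ G`. -/
def X.mk (Γ : Subgroup G) (g : G) : X Γ := Quotient.mk (QuotientGroup.rightRel Γ) g

instance : TopologicalSpace (X Γ) := TopologicalSpace.coinduced (X.mk Γ) inferInstance

instance : MeasurableSpace (X Γ) := borel (X Γ)

instance : BorelSpace (X Γ) := ⟨rfl⟩

/-- The right action of `G` on `X`: `(Γ x) g = Γ (x g)`. -/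
def X.mulRight (g : G) : X Γ → X Γ :=
  Quotient.map (fun x : G => x * g) (by
    intro a b hab
    have h : b * a⁻¹ ∈ Γ := QuotientGroup.rightRel_apply.mp hab
    apply QuotientGroup.rightRel_apply.mpr
    simpa [mul_assoc] using h)

/-- `F ∈ C^∞(X)`: the pullback of `F` to `GL(2, ℝ)`, an open subset of the space of
`2 × 2` matrices, is smooth. -/
def IsSmooth (F : X Γ → ℂ) : Prop :=
  ContDiffOn ℝ ∞
    (fun A : Fin 2 → Fin 2 → ℝ =>
      if h : (Matrix.of A).det ≠ 0 then
        F (X.mk Γ (toG (Matrix.GeneralLinearGroup.mkOfDetNeZero (Matrix.of A) h)))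
      else 0)
    {A | (Matrix.of A).det ≠ 0}

/-- The `G`-invariant measure of total mass one on `X` (it is unique). -/
structure IsInvariantProbability (μ : Measure (X Γ)) : Prop where
  isProbabilityMeasure : IsProbabilityMeasure μ
  map_mulRight : ∀ g : G, μ.map (X.mulRight g) = μ

/-! ### The representations `V_τ` -/

/-- The plane `ℝ²`. -/
abbrev Plane : Type := Fin 2 → ℝ

/-- The point of the unit circle with angle `θ`. -/
def circ (θ : ℝ) : Plane := ![Real.cos θ, Real.sin θ]

/-- The rotation invariant probability measure on the circle, in the angle `θ ∈ (0, 2π]`. -/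
def circleMeasure : Measure ℝ :=
  (ENNReal.ofReal (2 * Real.pi))⁻¹ • volume.restrict (Set.Ioc 0 (2 * Real.pi))

/-- The space `V_τ` of smooth even homogeneous functions of degree `τ - 1` on `ℝ² ∖ 0`
(extended by zero to the origin). -/
def V (τ : ℂ) : Submodule ℂ (Plane → ℂ) where
  carrier := {f | ContDiffOn ℝ ∞ f {s | s ≠ 0} ∧ f 0 = 0 ∧
    ∀ (a : ℝ) (s : Plane), a ≠ 0 → s ≠ 0 → f (a • s) = ((|a| : ℝ) : ℂ) ^ (τ - 1) * f s}
  add_mem' := by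
    rintro f g ⟨hf, hf0, hfh⟩ ⟨hg, hg0, hgh⟩
    refine ⟨hf.add hg, by simp [hf0, hg0], fun a s ha hs => ?_⟩
    simp only [Pi.add_apply, hfh a s ha hs, hgh a s ha hs, mul_add]
  zero_mem' := ⟨contDiffOn_const, rfl, fun _ _ _ _ => by simp⟩
  smul_mem' := by
    rintro c f ⟨hf, hf0, hfh⟩
    refine ⟨hf.const_smul c, by simp [hf0], fun a s ha hs => ?_⟩
    simp only [Pi.smul_apply, smul_eq_mul, hfh a s ha hs]
    ring

theorem inv_mulVec_ne_zero (g : GL (Fin 2) ℝ) {s : Plane} (hs : s ≠ 0) :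
    ((g⁻¹ : GL (Fin 2) ℝ) : Matrix (Fin 2) (Fin 2) ℝ).mulVec s ≠ 0 := by
  intro h
  apply hs
  have h1 : (g : Matrix (Fin 2) (Fin 2) ℝ).mulVec
      (((g⁻¹ : GL (Fin 2) ℝ) : Matrix (Fin 2) (Fin 2) ℝ).mulVec s) = s := by
    rw [Matrix.mulVec_mulVec, Units.mul_inv, Matrix.one_mulVec]
  rw [← h1, h, Matrix.mulVec_zero]

/-- The representation `π_τ`: `(π_τ(g) f)(s) = |det g|^((τ - 1) / 2) f(g⁻¹ s)`. -/
def rep (τ : ℂ) (g : GL (Fin 2) ℝ) (f : V τ) : V τ :=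
  ⟨fun s => ((|(g : Matrix (Fin 2) (Fin 2) ℝ).det| : ℝ) : ℂ) ^ ((τ - 1) / 2) *
      (f : Plane → ℂ) (((g⁻¹ : GL (Fin 2) ℝ) : Matrix (Fin 2) (Fin 2) ℝ).mulVec s), by
    obtain ⟨f, hf, hf0, hfh⟩ := f
    refine ⟨?_, by simp [hf0], fun a s ha hs => ?_⟩
    · refine contDiffOn_const.mul (hf.comp ?_ fun s hs => inv_mulVec_ne_zero g hs)
      exact (LinearMap.toContinuousLinearMap
        (Matrix.mulVecLin ((g⁻¹ : GL (Fin 2) ℝ) : Matrix (Fin 2) (Fin 2) ℝ))).contDiff.contDiffOn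
    · simp only [Matrix.mulVec_smul]
      rw [hfh a _ ha (inv_mulVec_ne_zero g hs)]
      ring⟩

/-- The parameters of the principal series (`τ ∈ iℝ`) and of the complementary series.
Since `V_τ` and `V_{-τ}` are isomorphic for `-1 < τ < 1`, the latter are all obtained from
`τ ∈ (-1, 0)`, the range in which the invariant scalar product and the model trilinear functional
are given by absolutely convergent integrals. -/
def IsUnitaryParam (τ : ℂ) : Prop :=
  τ.re = 0 ∨ (τ.im = 0 ∧ -1 < τ.re ∧ τ.re < 0)

/-- The density `|ω(x, y)|^(-τ-1)` in the two angles, `τ` real. -/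
def compMeasure (τ : ℂ) : Measure (ℝ × ℝ) :=
  (circleMeasure.prod circleMeasure).withDensity fun p =>
    ENNReal.ofReal (|Real.sin (p.1 - p.2)| ^ (-τ.re - 1))

open Classical in
/-- The kernel of the invariant scalar product of `V_τ`, a probability measure on the torus.
For the principal series it is the diagonal measure, so that the scalar product is
`(2π)⁻¹ ∫ f \bar g dθ`; for the complementary series it has density proportional to
`|ω(x, y)|^(-τ-1)`, which is homogeneous of the degree making the pairing invariant.
The function which is one on the unit circle has norm one. -/
def pairMeasure (τ : ℂ) : Measure (ℝ × ℝ) :=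
  if τ.re = 0 then circleMeasure.map fun θ => (θ, θ)
  else (compMeasure τ Set.univ)⁻¹ • compMeasure τ

/-- The invariant scalar product `P` on `V_τ`. -/
def formV (τ : ℂ) (f g : Plane → ℂ) : ℂ :=
  ∫ p, f (circ p.1) * conj (g (circ p.2)) ∂(pairMeasure τ)

/-- An isometric morphism of representations `ν : V_τ → C^∞(X)`, that is, an `X`-enhanced
representation with normalized `ν`. The morphism is continuous; only continuity from the
`C^∞` topology of `V_τ` to the uniform topology is needed here. -/
structure IsEnhancement (μ : Measure (X Γ)) (τ : ℂ) (ν : V τ →ₗ[ℂ] (X Γ → ℂ)) : Prop where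
  smooth : ∀ f, IsSmooth (ν f)
  equivariant : ∀ (g : GL (Fin 2) ℝ) (f : V τ) (x : X Γ),
    ν (rep τ g f) x = ν f (X.mulRight (toG g) x)
  isometric : ∀ f g : V τ, ∫ x, ν f x * conj (ν g x) ∂μ = formV τ f g
  continuous : ∃ (k : ℕ) (C : ℝ), ∀ (f : V τ) (B : ℝ),
    (∀ j ≤ k, ∀ θ : ℝ, ‖iteratedDeriv j (fun t => (f : Plane → ℂ) (circ t)) θ‖ ≤ B) →
      ∀ x, ‖ν f x‖ ≤ C * B

/-! ### The space `E` and its Hermitian forms -/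

/-- The space `E` of smooth vectors in the completed tensor product of `V_τ` and `V_τ'`: the smooth
functions on `(ℝ² ∖ 0) × (ℝ² ∖ 0)` which are even and homogeneous of degrees `τ - 1` and `τ' - 1`
in the two variables (extended by zero). -/
def E (τ τ' : ℂ) : Submodule ℂ (Plane × Plane → ℂ) where
  carrier := {u | ContDiffOn ℝ ∞ u {p | p.1 ≠ 0 ∧ p.2 ≠ 0} ∧
    (∀ s s', s = 0 ∨ s' = 0 → u (s, s') = 0) ∧
    ∀ (a b : ℝ) (s s' : Plane), a ≠ 0 → b ≠ 0 → s ≠ 0 → s' ≠ 0 →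
      u (a • s, b • s') =
        ((|a| : ℝ) : ℂ) ^ (τ - 1) * ((|b| : ℝ) : ℂ) ^ (τ' - 1) * u (s, s')}
  add_mem' := by
    rintro f g ⟨hf, hf0, hfh⟩ ⟨hg, hg0, hgh⟩
    refine ⟨hf.add hg, fun s s' h => by simp [hf0 s s' h, hg0 s s' h],
      fun a b s s' ha hb hs hs' => ?_⟩
    simp only [Pi.add_apply, hfh a b s s' ha hb hs hs', hgh a b s s' ha hb hs hs', mul_add]
  zero_mem' := ⟨contDiffOn_const, fun _ _ _ => rfl, fun _ _ _ _ _ _ _ _ => by simp⟩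
  smul_mem' := by
    rintro c f ⟨hf, hf0, hfh⟩
    refine ⟨hf.const_smul c, fun s s' h => by simp [hf0 s s' h],
      fun a b s s' ha hb hs hs' => ?_⟩
    simp only [Pi.smul_apply, smul_eq_mul, hfh a b s s' ha hb hs hs']
    ring

variable {τ τ' : ℂ}

/-- For fixed second variable a vector of `E` is a vector of `V_τ` in the first variable. -/
def slice (u : E τ τ') (s' : Plane) : V τ :=
  ⟨fun s => (u : Plane × Plane → ℂ) (s, s'), by
    obtain ⟨u, hu, hu0, huh⟩ := u
    by_cases hs' : s' = 0
    · have h : (fun s => u (s, s')) = 0 := funext fun s => hu0 s s' (Or.inr hs')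
      simp only [h]
      exact Submodule.zero_mem _
    · refine ⟨?_, hu0 0 s' (Or.inl rfl), fun a s ha hs => ?_⟩
      · exact hu.comp (contDiff_id.prodMk contDiff_const).contDiffOn fun s hs => ⟨hs, hs'⟩
      · simpa using huh a 1 s s' ha one_ne_zero hs hs'⟩

open Classical in
/-- The realization `E → C^∞(X × X)`, which extends `ν ⊗ ν'` from `V_τ ⊗ V_τ'`: apply `ν` in the
first variable and then `ν'` in the second one. (For a morphism `ν` the function
`s' ↦ ν(u(·, s'))(x)` always lies in `V_τ'`.) -/
def realization (ν : V τ →ₗ[ℂ] (X Γ → ℂ)) (ν' : V τ' →ₗ[ℂ] (X Γ → ℂ)) (u : E τ τ')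
    (x x' : X Γ) : ℂ :=
  if h : (fun s' => ν (slice u s') x) ∈ V τ' then ν' ⟨fun s' => ν (slice u s') x, h⟩ x' else 0

/-- The diagonal form `H_Δ`: the `L²` form of the restriction to the diagonal of `X × X`. -/
def diagForm (μ : Measure (X Γ)) (ν : V τ →ₗ[ℂ] (X Γ → ℂ)) (ν' : V τ' →ₗ[ℂ] (X Γ → ℂ))
    (u v : E τ τ') : ℂ :=
  ∫ x, realization ν ν' u x x * conj (realization ν ν' v x x) ∂μ

/-- The symplectic form `ω` on the plane. -/
def omega (s t : Plane) : ℝ := s 0 * t 1 - s 1 * t 0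

/-- The kernel `K_{τ, τ', lam}` of the model trilinear functional. -/
def modelKernel (τ τ' lam : ℂ) (s₁ s₂ s₃ : Plane) : ℂ :=
  ((|omega s₂ s₃| : ℝ) : ℂ) ^ ((τ - τ' - lam - 1) / 2) *
  ((|omega s₁ s₃| : ℝ) : ℂ) ^ ((-τ + τ' - lam - 1) / 2) *
  ((|omega s₁ s₂| : ℝ) : ℂ) ^ ((-τ - τ' + lam - 1) / 2)

/-- The operator `T` from `E` to the complex conjugate of `V_lam` defined by the model trilinear
functional `l`, in the circle model: `l(u ⊗ w) = (2π)⁻¹ ∫ (T u)(z) w(z) dz` for `w` in `V_lam`,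
where `l` is the integral of `u(x, y) w(z) K(x, y, z)` against `(2π)⁻³ dx dy dz`. -/
def modelOp (lam : ℂ) (u : E τ τ') (z : ℝ) : ℂ :=
  ∫ p : ℝ × ℝ, (u : Plane × Plane → ℂ) (circ p.1, circ p.2) *
    modelKernel τ τ' lam (circ p.1) (circ p.2) (circ z) ∂(circleMeasure.prod circleMeasure)

/-- The form `H^mod_lam` on `E`, for `lam ∈ iℝ`: the pullback under `modelOp` of the scalar
product of the principal series. -/
def modelForm (lam : ℂ) (u v : E τ τ') : ℂ :=
  ∫ z, modelOp lam u z * conj (modelOp lam v z) ∂circleMeasure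

/-! ### Sobolev forms and relative traces -/

/-- The Lie algebra of `PGL(2, ℝ)`: real `2 × 2` matrices of trace zero. -/
abbrev lieG : Type := LieAlgebra.SpecialLinear.sl (Fin 2) ℝ

/-- The action of the Lie algebra of `G × G` on `E`, i.e. the derivative at `t = 0` of
`u(exp(-tA) s, exp(-tB) s')`. -/
def lieAct (Z : lieG × lieG) (u : Plane × Plane → ℂ) : Plane × Plane → ℂ := fun p =>
  -(fderiv ℝ u p ((Z.1 : Matrix (Fin 2) (Fin 2) ℝ).mulVec p.1,
    (Z.2 : Matrix (Fin 2) (Fin 2) ℝ).mulVec p.2))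

/-- `X^n u = X₁^{n₁} ⋯ X₆^{n₆} u`. -/
def monomialAct (b : Module.Basis (Fin 6) ℝ (lieG × lieG)) (n : Fin 6 → ℕ)
    (u : Plane × Plane → ℂ) : Plane × Plane → ℂ :=
  (List.finRange 6).foldr (fun j w => (lieAct (b j))^[n j] w) u

/-- The invariant scalar product `P` on `E`, the tensor product of those of `V_τ` and `V_τ'`. -/
def formE (τ τ' : ℂ) (u v : Plane × Plane → ℂ) : ℂ :=
  ∫ r : (ℝ × ℝ) × (ℝ × ℝ), u (circ r.1.1, circ r.2.1) * conj (v (circ r.1.2, circ r.2.2))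
    ∂((pairMeasure τ).prod (pairMeasure τ'))

/-- The Sobolev form `Q_{l,T}(u, v) = ∑_{|n| ≤ l} T^(2(l - |n|)) P(X^n u, X^n v)` on `E`. -/
def sobolevForm (b : Module.Basis (Fin 6) ℝ (lieG × lieG)) (l : ℕ) (T : ℝ) (u v : E τ τ') : ℂ :=
  ∑ k ∈ Finset.range (l + 1), ∑ n ∈ Finset.piAntidiag (Finset.univ : Finset (Fin 6)) k,
    (T : ℂ) ^ (2 * (l - k)) * formE τ τ' (monomialAct b n u) (monomialAct b n v)

/-- The relative trace `tr(H | Q)` of Hermitian forms: the square of the Hilbert-Schmidt norm of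
the identity `(W, Q) → (W, H)`, i.e. the supremum of `∑ᵢ H(eᵢ, eᵢ)` over finite `Q`-orthonormal
families. -/
def relTrace {W : Type*} (H Q : W → W → ℂ) : ℝ≥0∞ :=
  ⨆ (m : ℕ) (e : Fin m → W) (_ : ∀ i j, Q (e i) (e j) = if i = j then 1 else 0),
    ∑ i, ENNReal.ofReal (H (e i) (e i)).re

end TripleProduct

end

/-!
The traces are computed with explicit functionals; no spectral theory of `Γ \ G` enters.

*Upper bound.* The trace of `H_Δ` is the integral over `x` of the squared norm, relative to
`Q_{l,T}`, of the functional `u ↦ u(x, x)`, so it suffices to bound the squared norm of evaluation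
at every point `(x, x')` of `X × X` by a multiple of `T^(2 - 2l)`. Since `X` is compact, a bounded
element of `G × G` carries `(x, x')` to any other point, and translation by a bounded element
changes `Q_{l,T}` by a bounded factor only: words in the `X_j` are combinations of ordered monomials
with coefficients which do not depend on the representation (`exists_word_eq_sum`,
`exists_sobQ_repE_le`). It is therefore enough to bound the functional at one point
(`exists_good_point`), and the average over `X × X` provides it. In the expansion along the weight
vectors of the two rotation groups, which are orthogonal for `P` and on which the infinitesimal
rotations act by `2im` and `2in` with integers `m, n`, `Q_{l,T}` dominates up to a constant the sum
`∑ (T² + m² + n²)^l ‖u_{m,n}‖²` (`exists_sum_uhat_le_sobQ`). As `ν` and `ν'` are isometric, the averaged squared norm of the evaluation functional is at most a multiple of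
`∑ (T² + m² + n²)^(-l)`, of the order of `T^(2 - 2l)`.

*Lower bound.* Take a bump function supported in a cone on which the two points of the circle stay
away from each other and from the horizontal direction, and multiply it by the powers of the three
relevant forms which make it homogeneous and cancel the phase of the model kernel
(`exists_phase_mul_circKernel`). The model operator of this vector at the angle `0` is then bounded
below by a constant (`exists_le_norm_modelOp_bump`). The exponents are at most `3T`, so each
derivative costs a factor `T`, and `Q_{l,T}` is at most a multiple of `T^(2l)`
(`exists_sobQ_testVec_le`). Finitely many rotations of the vector serve all angles by continuity,
and the squared norm of a functional is bounded below by its value on a single vector, so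
integration over the circle gives the bound (`le_relTrace_modelForm`); the number of rotated vectors
does not matter.
-/

noncomputable section

namespace TripleProduct

open MeasureTheory

variable {τ τ' : ℂ}

/-! ### Fourier series of `π`-periodic functions -/

/-- The even character `θ ↦ exp(2imθ)` of the circle, the weight vectors of `V_τ`. -/
def wave (m : ℤ) (θ : ℝ) : ℂ := Complex.exp (2 * m * θ * Complex.I)

/-- The Fourier coefficient of a `π`-periodic function along `wave m`. -/
def fcoef (F : ℝ → ℂ) (m : ℤ) : ℂ := ∫ θ, F θ * wave (-m) θ ∂circleMeasure

theorem wave_zero (θ : ℝ) : wave 0 θ = 1 := by simp [wave]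

theorem norm_wave (m : ℤ) (θ : ℝ) : ‖wave m θ‖ = 1 := by
  have h : (2 * m * θ * Complex.I : ℂ) = ((2 * m * θ : ℝ) : ℂ) * Complex.I := by push_cast; ring
  rw [wave, h, Complex.norm_exp_ofReal_mul_I]

theorem wave_add (m k : ℤ) (θ : ℝ) : wave (m + k) θ = wave m θ * wave k θ := by
  rw [wave, wave, wave, ← Complex.exp_add]; congr 1; push_cast; ring

theorem wave_add_angle (m : ℤ) (θ t : ℝ) : wave m (θ + t) = wave m θ * wave m t := by
  rw [wave, wave, wave, ← Complex.exp_add]; congr 1; push_cast; ring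

theorem conj_wave (m : ℤ) (θ : ℝ) : conj (wave m θ) = wave (-m) θ := by
  rw [wave, wave, ← Complex.exp_conj]; congr 1; simp [Complex.conj_ofNat]

theorem wave_pi (m : ℤ) : wave m Real.pi = 1 := by
  rw [wave, ← Complex.exp_int_mul_two_pi_mul_I m]; congr 1; ring

theorem wave_periodic (m : ℤ) : Function.Periodic (wave m) Real.pi := fun θ => by
  rw [wave_add_angle, wave_pi, mul_one]

theorem hasDerivAt_wave (m : ℤ) (θ : ℝ) :
    HasDerivAt (wave m) (2 * m * Complex.I * wave m θ) θ := by
  have h : HasDerivAt (fun t : ℝ => (2 * m * t * Complex.I : ℂ)) (2 * m * Complex.I) θ := by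
    have := ((Complex.ofRealCLM.hasDerivAt (x := θ)).const_mul (2 * m : ℂ)).mul_const Complex.I
    simpa using this
  have := h.cexp
  rw [mul_comm (Complex.exp _)] at this
  exact this

theorem contDiff_wave (m : ℤ) : ContDiff ℝ ∞ (wave m) := by
  unfold wave
  have : ContDiff ℝ ∞ (fun t : ℝ => (2 * m * t * Complex.I : ℂ)) :=
    (contDiff_const.mul Complex.ofRealCLM.contDiff).mul contDiff_const
  exact this.cexp

theorem continuous_wave (m : ℤ) : Continuous (wave m) := (contDiff_wave m).continuous

instance : IsProbabilityMeasure circleMeasure := by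
  constructor
  have h : (0 : ℝ) < 2 * Real.pi := by positivity
  rw [circleMeasure, Measure.smul_apply, Measure.restrict_apply_univ, Real.volume_Ioc, sub_zero,
    smul_eq_mul]
  exact ENNReal.inv_mul_cancel (by simpa using h) ENNReal.ofReal_ne_top

theorem integral_circle {F : Type*} [NormedAddCommGroup F] [NormedSpace ℝ F] (f : ℝ → F) :
    ∫ θ, f θ ∂circleMeasure = (2 * Real.pi)⁻¹ • ∫ θ in (0 : ℝ)..(2 * Real.pi), f θ := by
  have h : (0 : ℝ) < 2 * Real.pi := by positivity
  rw [circleMeasure, integral_smul_measure, intervalIntegral.integral_of_le h.le,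
    ENNReal.toReal_inv, ENNReal.toReal_ofReal h.le]

/-- Rotation invariance of the circle measure; measurability of `f` plays no role. -/
theorem integral_circle_add {F : Type*} [NormedAddCommGroup F] [NormedSpace ℝ F] {f : ℝ → F}
    (hf : Function.Periodic f (2 * Real.pi)) (t : ℝ) :
    ∫ θ, f (θ + t) ∂circleMeasure = ∫ θ, f θ ∂circleMeasure := by
  rw [integral_circle, integral_circle, intervalIntegral.integral_comp_add_right,
    zero_add, add_comm, hf.intervalIntegral_add_eq t 0, zero_add]

theorem periodic_two_pi {α : Type*} {f : ℝ → α} (hf : Function.Periodic f Real.pi) :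
    Function.Periodic f (2 * Real.pi) := by
  simpa using hf.nat_mul 2

theorem integrable_circle {F : Type*} [NormedAddCommGroup F] {f : ℝ → F} (hf : Continuous f) :
    Integrable f circleMeasure := by
  have h : (0 : ℝ) < 2 * Real.pi := by positivity
  refine Integrable.smul_measure ?_ (by simpa using h)
  exact (hf.integrableOn_Icc (a := 0) (b := 2 * Real.pi)).mono_set Set.Ioc_subset_Icc_self

theorem integral_circle_deriv {F F' : ℝ → ℂ} (hF : ∀ θ, HasDerivAt F (F' θ) θ)
    (hF' : Continuous F') (hp : Function.Periodic F Real.pi) :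
    ∫ θ, F' θ ∂circleMeasure = 0 := by
  rw [integral_circle, intervalIntegral.integral_eq_sub_of_hasDerivAt (fun θ _ => hF θ)
    (hF'.intervalIntegrable _ _)]
  have := periodic_two_pi hp 0
  rw [zero_add] at this
  simp [this]

theorem integral_wave (m : ℤ) :
    ∫ θ, wave m θ ∂circleMeasure = if m = 0 then 1 else 0 := by
  split_ifs with h
  · subst h; simp [wave_zero]
  · have h1 := integral_circle_deriv (hasDerivAt_wave m)
      (continuous_const.mul (continuous_wave m)) (wave_periodic m)
    rw [integral_const_mul] at h1
    have : (2 * m * Complex.I : ℂ) ≠ 0 := by simp [h]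
    exact (mul_eq_zero.mp h1).resolve_left this

theorem norm_fcoef_le {F : ℝ → ℂ} {B : ℝ} (hB : ∀ θ, ‖F θ‖ ≤ B) (m : ℤ) : ‖fcoef F m‖ ≤ B := by
  have := norm_integral_le_of_norm_le_const (μ := circleMeasure)
    (f := fun θ => F θ * wave (-m) θ) (C := B)
    (Filter.Eventually.of_forall fun θ => by rw [norm_mul, norm_wave, mul_one]; exact hB θ)
  rw [fcoef]
  simpa using this

theorem fcoef_deriv {F F' : ℝ → ℂ} (hF : ∀ θ, HasDerivAt F (F' θ) θ)
    (hF' : Continuous F') (hp : Function.Periodic F Real.pi) (m : ℤ) :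
    fcoef F' m = 2 * m * Complex.I * fcoef F m := by
  have hFc : Continuous F := continuous_iff_continuousAt.mpr fun θ => (hF θ).continuousAt
  have h := integral_circle_deriv (fun θ => (hF θ).mul (hasDerivAt_wave (-m) θ))
    ((hF'.mul (continuous_wave _)).add (hFc.mul (continuous_const.mul (continuous_wave _))))
    (hp.mul (wave_periodic (-m)))
  have i1 : Integrable (fun θ => F' θ * wave (-m) θ) circleMeasure :=
    integrable_circle (hF'.mul (continuous_wave _))
  have i2 : Integrable (fun θ => F θ * (2 * ((-m : ℤ) : ℂ) * Complex.I * wave (-m) θ))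
      circleMeasure :=
    integrable_circle (hFc.mul (continuous_const.mul (continuous_wave _)))
  rw [integral_add i1 i2] at h
  have h2 : ∫ θ, F θ * (2 * ((-m : ℤ) : ℂ) * Complex.I * wave (-m) θ) ∂circleMeasure
      = -(2 * m * Complex.I) * fcoef F m := by
    rw [fcoef, ← integral_const_mul]
    congr 1; ext θ; push_cast; ring
  rw [h2] at h
  unfold fcoef at h ⊢
  linear_combination h

/-- Pointwise convergence of absolutely convergent Fourier series. -/
theorem hasSum_fcoef {F : ℝ → ℂ} (hF : Continuous F) (hp : Function.Periodic F Real.pi)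
    (hs : Summable (fcoef F)) (θ : ℝ) :
    HasSum (fun m => fcoef F m * wave m θ) (F θ) := by
  have : Fact (0 < Real.pi) := ⟨Real.pi_pos⟩
  let g : C(AddCircle Real.pi, ℂ) := ⟨hp.lift, by
    exact continuous_coinduced_dom.mpr hF⟩
  have hfour : ∀ (m : ℤ) (x : ℝ), fourier m (x : AddCircle Real.pi) = wave m x := by
    intro m x
    rw [fourier_coe_apply, wave]
    congr 1
    have : (Real.pi : ℂ) ≠ 0 := by exact_mod_cast Real.pi_ne_zero
    field_simp
  have hcoef : ∀ m, fourierCoeff g m = fcoef F m := by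
    intro m
    rw [fourierCoeff_eq_intervalIntegral g m 0, zero_add, fcoef, integral_circle]
    have e : ∀ x : ℝ, fourier (-m) (x : AddCircle Real.pi) • g x = F x * wave (-m) x := by
      intro x
      rw [hfour, smul_eq_mul, mul_comm]; rfl
    simp_rw [e]
    have hper : Function.Periodic (fun x => F x * wave (-m) x) Real.pi :=
      hp.mul (wave_periodic (-m))
    have h2 : ∫ x in (0:ℝ)..(2 * Real.pi), F x * wave (-m) x
        = (2 : ℝ) • ∫ x in (0:ℝ)..Real.pi, F x * wave (-m) x := by
      have hc : Continuous (fun x => F x * wave (-m) x) := hF.mul (continuous_wave _)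
      rw [← intervalIntegral.integral_add_adjacent_intervals (b := Real.pi)
        (hc.intervalIntegrable _ _) (hc.intervalIntegrable _ _)]
      have := hper.intervalIntegral_add_eq Real.pi 0
      rw [zero_add, ← two_mul] at this
      rw [this, two_smul]
    rw [h2, smul_smul]
    congr 1
    field_simp
  have hs' : Summable (fourierCoeff g) := by rw [funext hcoef]; exact hs
  have := has_pointwise_sum_fourier_series_of_summable hs' (θ : AddCircle Real.pi)
  simp_rw [hcoef, hfour, smul_eq_mul] at this
  exact this

theorem periodic_bounded {F : ℝ → ℂ} (hF : Continuous F) (hp : Function.Periodic F Real.pi) :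
    ∃ B, ∀ θ, ‖F θ‖ ≤ B := by
  obtain ⟨B, hB⟩ := hp.isBounded_of_continuous Real.pi_ne_zero hF |>.exists_norm_le
  exact ⟨B, fun θ => hB _ ⟨θ, rfl⟩⟩

theorem summable_int_inv_one_add_sq : Summable fun m : ℤ => (1 + (m : ℝ) ^ 2)⁻¹ := by
  have h : Summable fun m : ℤ => 1 / (m : ℝ) ^ 2 := Real.summable_one_div_int_pow.mpr one_lt_two
  refine Summable.of_norm_bounded_eventually h ?_
  rw [Filter.eventually_cofinite]
  refine (Set.finite_singleton (0 : ℤ)).subset fun m hm => ?_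
  by_contra hm0
  apply hm
  have hm1 : (0 : ℝ) < (m : ℝ) ^ 2 := by
    have : (m : ℝ) ≠ 0 := by exact_mod_cast hm0
    positivity
  rw [Real.norm_of_nonneg (by positivity), one_div]
  exact inv_anti₀ hm1 (by linarith)

theorem periodic_iteratedDeriv {F : ℝ → ℂ} {c : ℝ} (hp : Function.Periodic F c) (j : ℕ) :
    Function.Periodic (iteratedDeriv j F) c := by
  intro θ
  have := iteratedDeriv_comp_add_const j F c
  rw [show (fun z => F (z + c)) = F from funext hp] at this
  exact (congrFun this θ).symm

/-- Fourier coefficients of the iterated derivatives of a smooth periodic function. -/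
theorem fcoef_iteratedDeriv {F : ℝ → ℂ} (hF : ContDiff ℝ ∞ F) (hp : Function.Periodic F Real.pi)
    (j : ℕ) (m : ℤ) :
    fcoef (iteratedDeriv j F) m = (2 * m * Complex.I) ^ j * fcoef F m := by
  induction j with
  | zero => simp
  | succ j ih =>
    have hd : Differentiable ℝ (iteratedDeriv j F) :=
      hF.differentiable_iteratedDeriv j (by exact_mod_cast ENat.natCast_lt_top j)
    have hc : Continuous (iteratedDeriv (j + 1) F) :=
      hF.continuous_iteratedDeriv (j + 1) (by exact_mod_cast le_top)
    rw [fcoef_deriv (F := iteratedDeriv j F) (fun θ => ?_) hc (periodic_iteratedDeriv hp j), ih]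
    · ring
    · rw [iteratedDeriv_succ]; exact (hd θ).hasDerivAt

theorem summable_fcoef_of_contDiff {F : ℝ → ℂ} (hF : ContDiff ℝ ∞ F)
    (hp : Function.Periodic F Real.pi) : Summable (fcoef F) := by
  obtain ⟨B₀, hB₀⟩ := periodic_bounded hF.continuous hp
  obtain ⟨B₂, hB₂⟩ := periodic_bounded
    (hF.continuous_iteratedDeriv 2 (WithTop.coe_le_coe.mpr le_top)) (periodic_iteratedDeriv hp 2)
  refine Summable.of_norm_bounded (summable_int_inv_one_add_sq.mul_left (B₀ + B₂)) fun m => ?_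
  have h0 := norm_fcoef_le hB₀ m
  have h2 := norm_fcoef_le hB₂ m
  rw [fcoef_iteratedDeriv hF hp, norm_mul, norm_pow, norm_mul, Complex.norm_I, mul_one, norm_mul,
    Complex.norm_ofNat, Complex.norm_intCast, mul_pow, sq_abs] at h2
  rw [← div_eq_mul_inv, le_div_iff₀ (by positivity)]
  nlinarith [norm_nonneg (fcoef F m), sq_nonneg (m : ℝ),
    mul_nonneg (sq_nonneg (m : ℝ)) (norm_nonneg (fcoef F m))]

/-! ### Double Fourier series -/

/-- The Fourier coefficients of a function on the torus. -/
def fcoef2 (F : ℝ → ℝ → ℂ) (p : ℤ × ℤ) : ℂ := fcoef (fun y => fcoef (fun x => F x y) p.1) p.2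

theorem continuous_fcoef_slice {F : ℝ → ℝ → ℂ} (hF : Continuous (Function.uncurry F)) (m : ℤ) :
    Continuous fun y => fcoef (fun x => F x y) m := by
  simp_rw [fcoef, integral_circle]
  refine Continuous.const_smul ?_ _
  refine intervalIntegral.continuous_parametric_intervalIntegral_of_continuous'
    (f := fun y x => F x y * wave (-m) x) ?_ _ _
  exact (hF.comp continuous_swap).mul ((continuous_wave _).comp continuous_snd)

theorem hasSum_fcoef2 {F : ℝ → ℝ → ℂ} (hF : Continuous (Function.uncurry F))
    (hp₁ : ∀ y, Function.Periodic (fun x => F x y) Real.pi)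
    (hp₂ : ∀ x, Function.Periodic (F x) Real.pi)
    (hs : Summable (fcoef2 F)) (x y : ℝ) :
    HasSum (fun p : ℤ × ℤ => fcoef2 F p * (wave p.1 x * wave p.2 y)) (F x y) := by
  have hsn : Summable fun p => ‖fcoef2 F p‖ := hs.norm
  have h1 : ∀ (m : ℤ) (y : ℝ), HasSum (fun n => fcoef2 F (m, n) * wave n y)
      (fcoef (fun x => F x y) m) := by
    intro m y
    refine hasSum_fcoef (continuous_fcoef_slice hF m) (fun y => ?_) (hs.prod_factor m) y
    simp only [fcoef]
    congr 1; ext x; rw [hp₂ x y]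
  have h2 : Summable (fcoef fun x => F x y) := by
    refine Summable.of_norm_bounded (hsn.prod) fun m => ?_
    rw [← (h1 m y).tsum_eq]
    refine tsum_of_norm_bounded (hsn.prod_factor m).hasSum fun n => ?_
    rw [norm_mul, norm_wave, mul_one]
  have h3 := hasSum_fcoef (hF.comp (continuous_id.prodMk continuous_const)) (hp₁ y) h2 x
  have hsum : Summable fun p : ℤ × ℤ => fcoef2 F p * (wave p.1 x * wave p.2 y) := by
    refine Summable.of_norm_bounded hsn fun p => ?_
    simp [norm_wave]
  have h4 := hsum.hasSum.prod_fiberwise fun m => by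
    have := (h1 m y).mul_right (wave m x)
    simpa only [mul_assoc, mul_comm (wave _ y)] using this
  have h5 := h4.unique h3
  simp only [Function.comp_apply, Function.uncurry, id] at h5
  rw [← h5]
  exact hsum.hasSum

/-! ### The weights of the invariant scalar product -/

theorem abs_sin_rpow_periodic (r : ℝ) : Function.Periodic (fun x => |Real.sin x| ^ r) Real.pi :=
  fun x => by simp [Real.sin_add_pi]

theorem measurable_abs_sin_rpow (r : ℝ) : Measurable fun x => |Real.sin x| ^ r := by
  fun_prop

theorem intervalIntegrable_abs_sin_rpow {r : ℝ} (hr : -1 < r) (a b : ℝ) :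
    IntervalIntegrable (fun x => |Real.sin x| ^ r) volume a b := by
  have hpi := Real.pi_pos
  have h1 : IntervalIntegrable (fun x => |Real.sin x| ^ r) volume 0 (Real.pi / 2) := by
    rcases le_or_gt 0 r with h | h
    · exact Continuous.intervalIntegrable
        (Real.continuous_sin.abs.rpow_const fun _ => Or.inr h) _ _
    have h2 := (intervalIntegral.intervalIntegrable_rpow' (a := 0) (b := Real.pi / 2) hr).const_mul
      ((2 / Real.pi) ^ r)
    refine h2.mono_fun (measurable_abs_sin_rpow r).aestronglyMeasurable ?_
    rw [Filter.EventuallyLE, ae_restrict_iff' measurableSet_uIoc]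
    refine Filter.Eventually.of_forall fun x hx => ?_
    rw [Set.uIoc_of_le (by positivity)] at hx
    have h3 := Real.mul_le_sin hx.1.le hx.2
    have h4 : 0 < 2 / Real.pi * x := mul_pos (by positivity) hx.1
    rw [Real.norm_of_nonneg (by positivity), ← Real.mul_rpow (by positivity) hx.1.le,
      Real.norm_of_nonneg (by positivity), abs_of_nonneg (h4.le.trans h3)]
    exact Real.rpow_le_rpow_of_nonpos h4 h3 h.le
  have h2 : IntervalIntegrable (fun x => |Real.sin x| ^ r) volume (-(Real.pi / 2)) 0 := by
    rw [IntervalIntegrable.iff_comp_neg] at h1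
    simpa using h1.symm
  refine (abs_sin_rpow_periodic r).intervalIntegrable hpi.ne' (t := -(Real.pi / 2)) ?_ a b
  convert h2.trans h1 using 1
  ring

theorem integrable_abs_sin_rpow {r : ℝ} (hr : -1 < r) (t : ℝ) :
    Integrable (fun x => |Real.sin (x - t)| ^ r) circleMeasure := by
  have h : (0 : ℝ) < 2 * Real.pi := by positivity
  refine Integrable.smul_measure ?_ (by simpa using h)
  have := (intervalIntegrable_abs_sin_rpow hr (0 - t) (2 * Real.pi - t)).comp_sub_right t
  simp only [sub_add_cancel] at this
  exact (intervalIntegrable_iff_integrableOn_Ioc_of_le h.le).mp this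

theorem integral_abs_sin_rpow_sub (r t : ℝ) :
    ∫ x, |Real.sin (x - t)| ^ r ∂circleMeasure = ∫ x, |Real.sin x| ^ r ∂circleMeasure := by
  simpa [sub_eq_add_neg] using
    integral_circle_add (periodic_two_pi (abs_sin_rpow_periodic r)) (-t)

/-- The recursion for the Fourier coefficients of `|sin|^(s-1)`, obtained by integrating the
derivative of `exp(i(2m+1)θ) sin(θ)^s` over `(0, π)`. -/
theorem integral_wave_mul_abs_sin_rpow_succ {s : ℝ} (hs : 0 < s) (m : ℤ) :
    (2 * m + 1 + s) * ∫ x, wave (m + 1) x * (|Real.sin x| ^ (s - 1) : ℝ) ∂circleMeasure =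
      (2 * m + 1 - s) * ∫ x, wave m x * (|Real.sin x| ^ (s - 1) : ℝ) ∂circleMeasure := by
  have hpi := Real.pi_pos
  have hii : ∀ k (a b : ℝ), IntervalIntegrable (fun x => wave k x * (|Real.sin x| ^ (s - 1) : ℝ))
      volume a b := fun k a b => by
    have h := intervalIntegrable_abs_sin_rpow (r := s - 1) (by linarith) a b
    have h' : IntervalIntegrable (fun x => ((|Real.sin x| ^ (s - 1) : ℝ) : ℂ)) volume a b :=
      ⟨h.1.ofReal, h.2.ofReal⟩
    exact h'.continuousOn_mul (continuous_wave k).continuousOn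
  have hhalf : ∀ k, ∫ x, wave k x * (|Real.sin x| ^ (s - 1) : ℝ) ∂circleMeasure =
      (Real.pi⁻¹ : ℝ) • ∫ x in (0 : ℝ)..Real.pi, wave k x * (|Real.sin x| ^ (s - 1) : ℝ) := by
    intro k
    have hper : Function.Periodic (fun x => wave k x * ((|Real.sin x| ^ (s - 1) : ℝ) : ℂ))
        Real.pi := (wave_periodic k).mul fun x => by
      have := abs_sin_rpow_periodic (s - 1) x
      simp only at this ⊢
      rw [this]
    rw [integral_circle, ← intervalIntegral.integral_add_adjacent_intervals (b := Real.pi)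
      (hii k _ _) (hii k _ _)]
    have := hper.intervalIntegral_add_eq Real.pi 0
    rw [zero_add, ← two_mul] at this
    rw [this, ← two_smul ℝ, smul_smul]
    congr 1; field_simp
  -- `wave (m + 1)` and `wave m` are `exp(cθ)` times `exp(± iθ)`, hence combinations of
  -- `exp(cθ) cos θ` and `exp(cθ) sin θ`
  set c : ℂ := (2 * m + 1) * Complex.I with hc
  have hsin : Continuous fun x : ℝ => ((Real.sin x ^ s : ℝ) : ℂ) :=
    Complex.continuous_ofReal.comp (Real.continuous_sin.rpow_const fun _ => Or.inr hs.le)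
  have hexp : ∀ x : ℝ, HasDerivAt (fun x : ℝ => Complex.exp (c * x)) (c * Complex.exp (c * x)) x :=
    fun x => by
      have h0 : HasDerivAt (fun t : ℝ => c * (t : ℂ)) c x := by
        simpa using (Complex.ofRealCLM.hasDerivAt (x := x)).const_mul c
      have := h0.cexp
      rwa [mul_comm (Complex.exp _)] at this
  have hcoef : ∀ x : ℝ, c * Complex.exp (c * x) * ((Real.sin x : ℝ) : ℂ) +
      Complex.exp (c * x) * (s * (Real.cos x : ℝ)) =
      ((2 * m + 1 + s) * wave (m + 1) x - (2 * m + 1 - s) * wave m x) / 2 := by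
    intro x
    rw [Complex.ofReal_sin, Complex.ofReal_cos, Complex.sin, Complex.cos]
    have e1 : wave (m + 1) x = Complex.exp (c * x) * Complex.exp (x * Complex.I) := by
      rw [wave, ← Complex.exp_add]; congr 1; rw [hc]; push_cast; ring
    have e2 : wave m x = Complex.exp (c * x) * Complex.exp (-x * Complex.I) := by
      rw [wave, ← Complex.exp_add]; congr 1; rw [hc]; ring
    rw [e1, e2, hc]
    linear_combination ((2 * m + 1) * Complex.exp ((2 * m + 1) * Complex.I * x) *
      (Complex.exp (-x * Complex.I) - Complex.exp (x * Complex.I)) / 2) * Complex.I_sq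
  have key := intervalIntegral.integral_eq_sub_of_hasDerivAt_of_le hpi.le
    (f := fun x : ℝ => Complex.exp (c * x) * ((Real.sin x ^ s : ℝ) : ℂ))
    (f' := fun x => (((2 * m + 1 + s) * (wave (m + 1) x * (|Real.sin x| ^ (s - 1) : ℝ))) -
      (2 * m + 1 - s) * (wave m x * (|Real.sin x| ^ (s - 1) : ℝ))) / 2) ?_ ?_ ?_
  · rw [intervalIntegral.integral_div, intervalIntegral.integral_sub
      ((hii _ _ _).const_mul _) ((hii _ _ _).const_mul _), intervalIntegral.integral_const_mul,
      intervalIntegral.integral_const_mul] at key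
    simp only [Real.sin_pi, Real.sin_zero, Real.zero_rpow hs.ne', Complex.ofReal_zero, mul_zero,
      sub_zero] at key
    rw [hhalf, hhalf, mul_smul_comm, mul_smul_comm]
    congr 1
    linear_combination 2 * key
  · exact (Continuous.mul (by fun_prop) hsin).continuousOn
  · intro x hx
    have hpos : 0 < Real.sin x := Real.sin_pos_of_pos_of_lt_pi hx.1 hx.2
    have hd : HasDerivAt (fun x : ℝ => ((Real.sin x ^ s : ℝ) : ℂ))
        ((Real.cos x * s * Real.sin x ^ (s - 1) : ℝ) : ℂ) x :=
      ((Real.hasDerivAt_sin x).rpow_const (Or.inl hpos.ne')).ofReal_comp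
    refine ((hexp x).mul hd).congr_deriv ?_
    have hsplit : (Real.sin x ^ s : ℝ) = Real.sin x * Real.sin x ^ (s - 1) := by
      rw [← Real.rpow_one_add' hpos.le (by linarith)]; congr 1; ring
    rw [abs_of_pos hpos, hsplit]
    have := hcoef x
    push_cast at this ⊢
    linear_combination ((Real.sin x ^ (s - 1) : ℝ) : ℂ) * this
  · exact (((hii _ _ _).const_mul _).sub ((hii _ _ _).const_mul _)).div_const _

/-- The Fourier coefficients of `|sin|^(s-1)`, `0 < s < 1`, are positive: this is the positivity of
the scalar product of the complementary series. -/
theorem integral_wave_mul_abs_sin_rpow_pos {s : ℝ} (hs : 0 < s) (hs1 : s < 1) (m : ℤ) :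
    ∃ c : ℝ, 0 < c ∧
      ∫ x, wave m x * (|Real.sin x| ^ (s - 1) : ℝ) ∂circleMeasure = (c : ℂ) := by
  induction m using Int.induction_on with
  | zero =>
    refine ⟨∫ x, |Real.sin x| ^ (s - 1) ∂circleMeasure, ?_, ?_⟩
    · rw [integral_circle, smul_eq_mul]
      refine mul_pos (by positivity) ?_
      refine intervalIntegral.intervalIntegral_pos_of_pos_on
        (intervalIntegrable_abs_sin_rpow (r := s - 1) (by linarith) 0 Real.pi) ?_ Real.pi_pos |>.trans_le
        ?_
      · intro x hx
        exact Real.rpow_pos_of_pos (abs_pos.mpr (Real.sin_pos_of_pos_of_lt_pi hx.1 hx.2).ne') _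
      · refine intervalIntegral.integral_mono_interval le_rfl Real.pi_pos.le
          (by linarith [Real.pi_pos]) ?_ (intervalIntegrable_abs_sin_rpow (by linarith) _ _)
        exact Filter.Eventually.of_forall fun x => by positivity
    · simp_rw [wave_zero, one_mul]
      exact integral_ofReal
  | succ k ih =>
    obtain ⟨c, hc, h⟩ := ih
    have hk : (0 : ℝ) ≤ k := Nat.cast_nonneg k
    have h1 := integral_wave_mul_abs_sin_rpow_succ hs k
    rw [h] at h1
    refine ⟨(2 * k + 1 - s) / (2 * k + 1 + s) * c,
      mul_pos (div_pos (by linarith) (by linarith)) hc, ?_⟩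
    have h0 : ((2 * k + 1 + s : ℝ) : ℂ) ≠ 0 := by
      exact_mod_cast (by linarith : (2 * k + 1 + s : ℝ) ≠ 0)
    push_cast at h0 h1 ⊢
    rw [div_mul_eq_mul_div, eq_div_iff h0, mul_comm, h1]
  | pred k ih =>
    obtain ⟨c, hc, h⟩ := ih
    have hk : (0 : ℝ) ≤ k := Nat.cast_nonneg k
    have h1 := integral_wave_mul_abs_sin_rpow_succ hs (-k - 1)
    rw [sub_add_cancel, h] at h1
    refine ⟨(2 * k + 1 - s) / (2 * k + 1 + s) * c,
      mul_pos (div_pos (by linarith) (by linarith)) hc, ?_⟩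
    have h0 : ((2 * k + 1 + s : ℝ) : ℂ) ≠ 0 := by
      exact_mod_cast (by linarith : (2 * k + 1 + s : ℝ) ≠ 0)
    push_cast at h0 h1 ⊢
    rw [div_mul_eq_mul_div, eq_div_iff h0]
    linear_combination h1

/-- The squared norm of the weight vector `wave m` in `V_τ`. -/
def weight (τ : ℂ) (m : ℤ) : ℝ := (∫ p, wave m p.1 * conj (wave m p.2) ∂(pairMeasure τ)).re

theorem integrable_density {r : ℝ} (hr : -1 < r) :
    Integrable (fun p : ℝ × ℝ => |Real.sin (p.1 - p.2)| ^ r)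
      (circleMeasure.prod circleMeasure) := by
  have hm : Measurable (fun p : ℝ × ℝ => |Real.sin (p.1 - p.2)| ^ r) := by fun_prop
  rw [integrable_prod_iff' hm.aestronglyMeasurable]
  refine ⟨Filter.Eventually.of_forall fun y => integrable_abs_sin_rpow hr y, ?_⟩
  have : ∀ y, ∫ x, ‖|Real.sin (x - y)| ^ r‖ ∂circleMeasure =
      ∫ x, |Real.sin x| ^ r ∂circleMeasure := fun y => by
    rw [← integral_abs_sin_rpow_sub r y]
    exact integral_congr_ae (Filter.Eventually.of_forall fun x =>
      Real.norm_of_nonneg (by positivity))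
  simp_rw [this]
  exact integrable_const _

theorem integral_wave_mul_density {r : ℝ} (hr : -1 < r) (m k : ℤ) :
    ∫ p : ℝ × ℝ, ((|Real.sin (p.1 - p.2)| ^ r : ℝ) : ℂ) * (wave m p.1 * conj (wave k p.2))
      ∂(circleMeasure.prod circleMeasure) =
      if m = k then ∫ x, wave m x * (|Real.sin x| ^ r : ℝ) ∂circleMeasure else 0 := by
  have hint : Integrable (fun p : ℝ × ℝ => ((|Real.sin (p.1 - p.2)| ^ r : ℝ) : ℂ) *
      (wave m p.1 * conj (wave k p.2))) (circleMeasure.prod circleMeasure) := by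
    refine (integrable_density hr).ofReal.mul_bdd (c := 1) ?_ ?_
    · refine Continuous.aestronglyMeasurable ?_
      exact ((continuous_wave m).comp continuous_fst).mul
        (Complex.continuous_conj.comp ((continuous_wave k).comp continuous_snd))
    · refine Filter.Eventually.of_forall fun p => ?_
      simp [norm_wave]
  rw [integral_prod_symm _ hint]
  -- in the difference of the angles the double integral becomes a product
  have inner : ∀ y, ∫ x, ((|Real.sin (x - y)| ^ r : ℝ) : ℂ) * (wave m x * conj (wave k y))
      ∂circleMeasure = wave (m - k) y * ∫ x, wave m x * (|Real.sin x| ^ r : ℝ) ∂circleMeasure := by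
    intro y
    have hper : Function.Periodic (fun x => ((|Real.sin (x - y)| ^ r : ℝ) : ℂ) *
        (wave m x * conj (wave k y))) (2 * Real.pi) := by
      refine periodic_two_pi fun x => ?_
      rw [wave_periodic m x, add_sub_right_comm, Real.sin_add_pi, abs_neg]
    rw [← integral_circle_add hper y, ← integral_const_mul]
    congr 1; ext x
    rw [add_sub_cancel_right, wave_add_angle, conj_wave, sub_eq_add_neg, wave_add]
    ring
  simp only [inner]
  rw [integral_mul_const, integral_wave]
  split_ifs with h1 h2 h2
  · rw [one_mul]
  · omega
  · omega
  · rw [zero_mul]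

/-- The pairing measure is a probability measure, and the characters are orthogonal for it with
positive norms. -/
theorem pairMeasure_spec {τ : ℂ} (hτ : IsUnitaryParam τ) :
    IsProbabilityMeasure (pairMeasure τ) ∧ (∀ m, 0 < weight τ m) ∧
    ∀ m k : ℤ, ∫ p, wave m p.1 * conj (wave k p.2) ∂(pairMeasure τ) =
      if m = k then (weight τ m : ℂ) else 0 := by
  rcases hτ with h | ⟨-, h1, h2⟩
  · have hpm : pairMeasure τ = circleMeasure.map fun θ => (θ, θ) := if_pos h
    have hmeas : Measurable fun θ : ℝ => (θ, θ) := measurable_id.prodMk measurable_id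
    have hI : ∀ m k : ℤ, ∫ p, wave m p.1 * conj (wave k p.2) ∂(pairMeasure τ) =
        if m = k then 1 else 0 := by
      intro m k
      rw [hpm, integral_map hmeas.aemeasurable]
      · simp_rw [conj_wave, ← wave_add, integral_wave]
        congr 1; rw [eq_iff_iff]; omega
      · exact Continuous.aestronglyMeasurable (((continuous_wave m).comp continuous_fst).mul
          (Complex.continuous_conj.comp ((continuous_wave k).comp continuous_snd)))
    have hw : ∀ m, weight τ m = 1 := fun m => by rw [weight, hI]; simp
    refine ⟨?_, fun m => by rw [hw]; exact one_pos, fun m k => by rw [hI, hw]; simp⟩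
    rw [hpm]; exact Measure.isProbabilityMeasure_map hmeas.aemeasurable
  · have hpm : pairMeasure τ = (compMeasure τ Set.univ)⁻¹ • compMeasure τ :=
      if_neg h2.ne
    have hr : -1 < -τ.re - 1 := by linarith
    set r := -τ.re - 1 with hr_def
    have hrs : ∀ m, ∃ c : ℝ, 0 < c ∧
        ∫ x, wave m x * (|Real.sin x| ^ r : ℝ) ∂circleMeasure = (c : ℂ) :=
      integral_wave_mul_abs_sin_rpow_pos (s := -τ.re) (by linarith) (by linarith)
    choose c hc hcI using hrs
    have hmd : Measurable fun p : ℝ × ℝ => ENNReal.ofReal (|Real.sin (p.1 - p.2)| ^ r) := by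
      fun_prop
    have hcomp : ∀ g : ℝ × ℝ → ℂ, ∫ p, g p ∂(compMeasure τ) =
        ∫ p : ℝ × ℝ, ((|Real.sin (p.1 - p.2)| ^ r : ℝ) : ℂ) * g p
          ∂(circleMeasure.prod circleMeasure) := by
      intro g
      rw [compMeasure, integral_withDensity_eq_integral_toReal_smul hmd
        (Filter.Eventually.of_forall fun _ => ENNReal.ofReal_lt_top)]
      refine integral_congr_ae (Filter.Eventually.of_forall fun p => ?_)
      simp only
      rw [ENNReal.toReal_ofReal (by positivity), Complex.real_smul]
    have hC : ∀ m k : ℤ, ∫ p, wave m p.1 * conj (wave k p.2) ∂(compMeasure τ) =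
        if m = k then (c m : ℂ) else 0 := by
      intro m k
      rw [hcomp, integral_wave_mul_density hr, hcI]
    have huniv : compMeasure τ Set.univ = ENNReal.ofReal (c 0) := by
      rw [compMeasure, withDensity_apply _ MeasurableSet.univ, setLIntegral_univ,
        ← ofReal_integral_eq_lintegral_ofReal (integrable_density hr)
          (Filter.Eventually.of_forall fun p => by positivity)]
      congr 1
      have h0 := integral_wave_mul_density hr 0 0
      simp only [wave_zero, map_one, mul_one, if_true, one_mul] at h0
      have h00 := hcI 0
      simp only [wave_zero, one_mul] at h00
      rw [h00, integral_complex_ofReal] at h0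
      exact_mod_cast h0
    have hI : ∀ m k : ℤ, ∫ p, wave m p.1 * conj (wave k p.2) ∂(pairMeasure τ) =
        if m = k then ((c m / c 0 : ℝ) : ℂ) else 0 := by
      intro m k
      rw [hpm, integral_smul_measure, hC, huniv, ENNReal.toReal_inv,
        ENNReal.toReal_ofReal (hc 0).le]
      split_ifs
      · rw [Complex.real_smul]; push_cast; ring
      · simp
    have hw : ∀ m, weight τ m = c m / c 0 := fun m => by rw [weight, hI]; simp
    refine ⟨⟨?_⟩, fun m => by rw [hw]; exact div_pos (hc m) (hc 0), fun m k => by rw [hI, hw]⟩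
    rw [hpm, Measure.smul_apply, huniv, smul_eq_mul]
    exact ENNReal.inv_mul_cancel (by simpa using hc 0) ENNReal.ofReal_ne_top

/-! ### The action of the Lie algebra on `E` -/

/-- The open set of the pairs of nonzero vectors, on which the vectors of `E` are smooth. -/
def dom : Set (Plane × Plane) := {p | p.1 ≠ 0 ∧ p.2 ≠ 0}

theorem isOpen_dom : IsOpen dom :=
  (isOpen_compl_singleton.preimage continuous_fst).inter
    (isOpen_compl_singleton.preimage continuous_snd)

/-- The linear vector field on `ℝ² × ℝ²` defined by an element of the Lie algebra of `G × G`. -/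
def mv (Z : lieG × lieG) : Plane × Plane →L[ℝ] Plane × Plane :=
  (LinearMap.toContinuousLinearMap (Matrix.mulVecLin (Z.1 : Matrix (Fin 2) (Fin 2) ℝ))).prodMap
    (LinearMap.toContinuousLinearMap (Matrix.mulVecLin (Z.2 : Matrix (Fin 2) (Fin 2) ℝ)))

theorem mv_apply (Z : lieG × lieG) (p : Plane × Plane) :
    mv Z p = ((Z.1 : Matrix (Fin 2) (Fin 2) ℝ).mulVec p.1,
      (Z.2 : Matrix (Fin 2) (Fin 2) ℝ).mulVec p.2) := rfl

theorem lieAct_apply (Z : lieG × lieG) (u : Plane × Plane → ℂ) (p : Plane × Plane) :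
    lieAct Z u p = -(fderiv ℝ u p (mv Z p)) := rfl

namespace E

theorem contDiffOn (u : E τ τ') : ContDiffOn ℝ ∞ (u : Plane × Plane → ℂ) dom := u.2.1

theorem eq_zero (u : E τ τ') {p : Plane × Plane} (hp : p ∉ dom) :
    (u : Plane × Plane → ℂ) p = 0 := by
  refine u.2.2.1 p.1 p.2 ?_
  by_contra h
  push Not at h
  exact hp h

theorem homogeneous (u : E τ τ') {a b : ℝ} {s s' : Plane} (ha : a ≠ 0) (hb : b ≠ 0) (hs : s ≠ 0)
    (hs' : s' ≠ 0) : (u : Plane × Plane → ℂ) (a • s, b • s') =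
      ((|a| : ℝ) : ℂ) ^ (τ - 1) * ((|b| : ℝ) : ℂ) ^ (τ' - 1) * (u : Plane × Plane → ℂ) (s, s') :=
  u.2.2.2 a b s s' ha hb hs hs'

theorem contDiffAt (u : E τ τ') {p : Plane × Plane} (hp : p ∈ dom) :
    ContDiffAt ℝ ∞ (u : Plane × Plane → ℂ) p :=
  (E.contDiffOn u).contDiffAt (isOpen_dom.mem_nhds hp)

theorem differentiableAt (u : E τ τ') {p : Plane × Plane} (hp : p ∈ dom) :
    DifferentiableAt ℝ (u : Plane × Plane → ℂ) p :=
  (E.contDiffAt u hp).differentiableAt (by simp)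

end E

/-- A vector field tangent to the coordinate subspaces kills the extension by zero there, whether
or not the function is differentiable at such points. -/
theorem lieAct_eq_zero (Z : lieG × lieG) (u : E τ τ') {p : Plane × Plane} (hp : p ∉ dom) :
    lieAct Z u p = 0 := by
  rw [lieAct_apply, neg_eq_zero]
  by_cases hd : DifferentiableAt ℝ (u : Plane × Plane → ℂ) p
  · have h1 := hd.hasFDerivAt.hasLineDerivAt (mv Z p)
    have h2 : HasLineDerivAt ℝ (u : Plane × Plane → ℂ) 0 p (mv Z p) := by
      have : ∀ t : ℝ, (u : Plane × Plane → ℂ) (p + t • mv Z p) = 0 := by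
        intro t
        apply E.eq_zero u
        rintro ⟨h1, h2⟩
        apply hp
        refine ⟨fun h => h1 ?_, fun h => h2 ?_⟩ <;> simp [mv_apply, h]
      unfold HasLineDerivAt
      simp_rw [this]
      exact hasDerivAt_const _ _
    exact HasDerivAt.unique h1 h2
  · rw [fderiv_zero_of_not_differentiableAt hd]; rfl

theorem lieAct_mem (Z : lieG × lieG) (u : E τ τ') : lieAct Z u ∈ E τ τ' := by
  refine ⟨?_, fun s s' h => lieAct_eq_zero Z u fun hp => h.elim hp.1 hp.2, ?_⟩
  · refine ContDiffOn.neg ?_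
    exact ((E.contDiffOn u).fderiv_of_isOpen isOpen_dom (m := ∞) (by simp)).clm_apply
      (mv Z).contDiff.contDiffOn
  · intro a b s s' ha hb hs hs'
    let L : (Plane × Plane) →L[ℝ] (Plane × Plane) :=
      (a • ContinuousLinearMap.id ℝ Plane).prodMap (b • ContinuousLinearMap.id ℝ Plane)
    have hL : ∀ p, L p = (a • p.1, b • p.2) := fun p => rfl
    set c : ℂ := ((|a| : ℝ) : ℂ) ^ (τ - 1) * ((|b| : ℝ) : ℂ) ^ (τ' - 1) with hc
    have hp : (s, s') ∈ dom := ⟨hs, hs'⟩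
    have hLp : L (s, s') ∈ dom := ⟨smul_ne_zero ha hs, smul_ne_zero hb hs'⟩
    have heq : (fun q => (u : Plane × Plane → ℂ) (L q)) =ᶠ[nhds (s, s')]
        fun q => c * (u : Plane × Plane → ℂ) q := by
      filter_upwards [isOpen_dom.mem_nhds hp] with q hq
      exact E.homogeneous u ha hb hq.1 hq.2
    have h1 : fderiv ℝ (fun q => (u : Plane × Plane → ℂ) (L q)) (s, s') =
        (fderiv ℝ (u : Plane × Plane → ℂ) (L (s, s'))).comp L := by
      exact ((E.differentiableAt u hLp).hasFDerivAt.comp (s, s') L.hasFDerivAt).fderiv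
    rw [heq.fderiv_eq, fderiv_const_mul (E.differentiableAt u hp)] at h1
    have h2 := congrArg (fun M => M (mv Z (s, s'))) h1
    simp only [ContinuousLinearMap.comp_apply, _root_.smul_apply, smul_eq_mul] at h2
    have h3 : mv Z (L (s, s')) = L (mv Z (s, s')) := by
      simp [hL, mv_apply, Matrix.mulVec_smul]
    rw [show (a • s, b • s') = L (s, s') from rfl, lieAct_apply, lieAct_apply, h3, ← h2]
    ring

theorem E.ext_dom {u v : E τ τ'} (h : ∀ p ∈ dom, (u : Plane × Plane → ℂ) p = (v : _ → ℂ) p) :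
    u = v := by
  ext p
  by_cases hp : p ∈ dom
  · exact h p hp
  · rw [E.eq_zero u hp, E.eq_zero v hp]

/-- The action of the Lie algebra of `G × G` on `E` by linear endomorphisms. -/
def actE (Z : lieG × lieG) : Module.End ℂ (E τ τ') where
  toFun u := ⟨lieAct Z u, lieAct_mem Z u⟩
  map_add' u v := by
    refine E.ext_dom fun p hp => ?_
    change lieAct Z ((u : Plane × Plane → ℂ) + v) p = lieAct Z u p + lieAct Z v p
    rw [lieAct_apply, fderiv_add (E.differentiableAt u hp) (E.differentiableAt v hp), lieAct_apply,
      lieAct_apply, _root_.add_apply]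
    ring
  map_smul' c u := by
    refine E.ext_dom fun p hp => ?_
    change lieAct Z (c • (u : Plane × Plane → ℂ)) p = c • lieAct Z u p
    rw [lieAct_apply, fderiv_const_smul (E.differentiableAt u hp), lieAct_apply]
    simp

theorem actE_coe (Z : lieG × lieG) (u : E τ τ') :
    (actE Z u : Plane × Plane → ℂ) = lieAct Z u := rfl

theorem actE_apply (Z : lieG × lieG) (u : E τ τ') (p : Plane × Plane) :
    (actE Z u : Plane × Plane → ℂ) p = -(fderiv ℝ (u : Plane × Plane → ℂ) p (mv Z p)) := rfl

theorem actE_lie (Z W : lieG × lieG) :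
    (actE ⁅Z, W⁆ : Module.End ℂ (E τ τ')) = actE Z * actE W - actE W * actE Z := by
  refine LinearMap.ext fun u => E.ext_dom fun p hp => ?_
  change _ = (actE Z (actE W u) : Plane × Plane → ℂ) p - (actE W (actE Z u) : _ → ℂ) p
  have hdd : DifferentiableAt ℝ (fderiv ℝ (u : Plane × Plane → ℂ)) p :=
    ((E.contDiffAt u hp).fderiv_right (m := 1) (WithTop.coe_le_coe.mpr le_top)).differentiableAt (by simp)
  have hsymm : IsSymmSndFDerivAt ℝ (u : Plane × Plane → ℂ) p :=
    (E.contDiffAt u hp).isSymmSndFDerivAt (by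
      simpa using (WithTop.coe_le_coe.mpr le_top : ((2 : ℕ∞) : WithTop ℕ∞) ≤ (⊤ : ℕ∞)))
  have key : ∀ A B : lieG × lieG, (actE A (actE B u) : Plane × Plane → ℂ) p =
      fderiv ℝ (fderiv ℝ (u : Plane × Plane → ℂ)) p (mv A p) (mv B p) +
        fderiv ℝ (u : Plane × Plane → ℂ) p (mv B (mv A p)) := by
    intro A B
    rw [actE_apply, actE_coe]
    have h : HasFDerivAt (lieAct B (u : Plane × Plane → ℂ)) _ p :=
      (hdd.hasFDerivAt.clm_apply (mv B).hasFDerivAt).neg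
    rw [h.fderiv]
    simp
    ring
  rw [key, key, actE_apply, hsymm (mv Z p) (mv W p)]
  have hb : mv ⁅Z, W⁆ p = mv Z (mv W p) - mv W (mv Z p) := by
    simp only [mv_apply, LieAlgebra.Prod.bracket_apply, LieSubalgebra.coe_bracket, Ring.lie_def,
      Matrix.sub_mulVec, Matrix.mulVec_mulVec, Prod.mk_sub_mk]
  rw [hb, map_sub]
  ring

/-- The action of the Lie algebra on `E`, as a linear map. -/
def actLin (τ τ' : ℂ) : (lieG × lieG) →ₗ[ℝ] Module.End ℂ (E τ τ') where
  toFun := actE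
  map_add' Z W := by
    refine LinearMap.ext fun u => E.ext_dom fun p _ => ?_
    change (actE (Z + W) u : Plane × Plane → ℂ) p = (actE Z u : _ → ℂ) p + (actE W u : _ → ℂ) p
    have : mv (Z + W) p = mv Z p + mv W p := by
      simp [mv_apply, Matrix.add_mulVec]
    rw [actE_apply, actE_apply, actE_apply, this, map_add]
    ring
  map_smul' c Z := by
    refine LinearMap.ext fun u => E.ext_dom fun p _ => ?_
    change (actE (c • Z) u : Plane × Plane → ℂ) p = c • (actE Z u : _ → ℂ) p
    have : mv (c • Z) p = c • mv Z p := by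
      simp [mv_apply, Matrix.smul_mulVec]
    rw [actE_apply, actE_apply, this, map_smul, smul_neg]

/-! ### The action of the group on `E` -/

/-- The linear map `(s, s') ↦ (g⁻¹ s, g'⁻¹ s')`. -/
def invMap (g g' : GL (Fin 2) ℝ) : Plane × Plane →L[ℝ] Plane × Plane :=
  (LinearMap.toContinuousLinearMap (Matrix.mulVecLin
    ((g⁻¹ : GL (Fin 2) ℝ) : Matrix (Fin 2) (Fin 2) ℝ))).prodMap
    (LinearMap.toContinuousLinearMap (Matrix.mulVecLin
    ((g'⁻¹ : GL (Fin 2) ℝ) : Matrix (Fin 2) (Fin 2) ℝ)))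

theorem invMap_apply (g g' : GL (Fin 2) ℝ) (p : Plane × Plane) : invMap g g' p =
    (((g⁻¹ : GL (Fin 2) ℝ) : Matrix (Fin 2) (Fin 2) ℝ).mulVec p.1,
      ((g'⁻¹ : GL (Fin 2) ℝ) : Matrix (Fin 2) (Fin 2) ℝ).mulVec p.2) := rfl

theorem invMap_mem_dom (g g' : GL (Fin 2) ℝ) {p : Plane × Plane} (hp : p ∈ dom) :
    invMap g g' p ∈ dom := ⟨inv_mulVec_ne_zero g hp.1, inv_mulVec_ne_zero g' hp.2⟩

/-- The scalar factor `|det g|^((τ - 1) / 2)` of the representation `π_τ`. -/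
def detFactor (τ : ℂ) (g : GL (Fin 2) ℝ) : ℂ :=
  ((|(g : Matrix (Fin 2) (Fin 2) ℝ).det| : ℝ) : ℂ) ^ ((τ - 1) / 2)

/-- The representation of `G × G` on `E`. -/
def repE (g g' : GL (Fin 2) ℝ) : Module.End ℂ (E τ τ') where
  toFun u := ⟨fun p => detFactor τ g * detFactor τ' g' * (u : Plane × Plane → ℂ) (invMap g g' p), by
    refine ⟨?_, fun s s' h => ?_, fun a b s s' ha hb hs hs' => ?_⟩
    · exact contDiffOn_const.mul ((E.contDiffOn u).comp (invMap g g').contDiff.contDiffOn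
        fun p hp => invMap_mem_dom g g' hp)
    · refine mul_eq_zero_of_right _ (E.eq_zero u ?_)
      rcases h with rfl | rfl
      · exact fun h => h.1 (by simp [invMap_apply])
      · exact fun h => h.2 (by simp [invMap_apply])
    · have := E.homogeneous u ha hb (inv_mulVec_ne_zero g hs) (inv_mulVec_ne_zero g' hs')
      simp only [invMap_apply, Matrix.mulVec_smul, this]
      ring⟩
  map_add' u v := by
    ext p
    simp [mul_add]
  map_smul' c u := by
    ext p
    simp only [Submodule.coe_smul, Pi.smul_apply, smul_eq_mul, RingHom.id_apply]
    ring

theorem repE_apply (g g' : GL (Fin 2) ℝ) (u : E τ τ') (p : Plane × Plane) :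
    (repE g g' u : Plane × Plane → ℂ) p =
      detFactor τ g * detFactor τ' g' * (u : Plane × Plane → ℂ) (invMap g g' p) := rfl

/-- The adjoint action of `g⁻¹` on trace zero matrices. -/
def adInv (g : GL (Fin 2) ℝ) (Z : lieG) : lieG :=
  ⟨((g⁻¹ : GL (Fin 2) ℝ) : Matrix (Fin 2) (Fin 2) ℝ) * (Z : Matrix (Fin 2) (Fin 2) ℝ) *
    (g : Matrix (Fin 2) (Fin 2) ℝ), by
    have h := Z.2
    have h' : Matrix.trace (Z : Matrix (Fin 2) (Fin 2) ℝ) = 0 := h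
    change Matrix.trace (((g⁻¹ : GL (Fin 2) ℝ) : Matrix (Fin 2) (Fin 2) ℝ) *
      (Z : Matrix (Fin 2) (Fin 2) ℝ) * (g : Matrix (Fin 2) (Fin 2) ℝ)) = 0
    rw [Matrix.trace_mul_cycle, Units.mul_inv, one_mul, h']⟩

theorem actE_repE (Z : lieG × lieG) (g g' : GL (Fin 2) ℝ) (u : E τ τ') :
    actE Z (repE g g' u) = repE g g' (actE (adInv g Z.1, adInv g' Z.2) u) := by
  refine E.ext_dom fun p hp => ?_
  rw [repE_apply, actE_apply, actE_apply]
  have hd : HasFDerivAt (repE g g' u : Plane × Plane → ℂ) _ p :=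
    ((E.differentiableAt u (invMap_mem_dom g g' hp)).hasFDerivAt.comp p
      (invMap g g').hasFDerivAt).const_mul (detFactor τ g * detFactor τ' g')
  rw [hd.fderiv]
  have : mv (adInv g Z.1, adInv g' Z.2) (invMap g g' p) = invMap g g' (mv Z p) := by
    simp only [mv_apply, invMap_apply, adInv, Matrix.mulVec_mulVec]
    simp [mul_assoc]
  rw [this]
  simp

/-! ### Fourier expansion on `E` and the Parseval formula -/

/-- The restriction of a function to the torus of pairs of unit vectors. -/
def torus (u : Plane × Plane → ℂ) (x y : ℝ) : ℂ := u (circ x, circ y)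

theorem circ_ne_zero (θ : ℝ) : circ θ ≠ 0 := by
  intro h
  have h0 : Real.cos θ = 0 := congrFun h 0
  have h1 : Real.sin θ = 0 := congrFun h 1
  have := Real.sin_sq_add_cos_sq θ
  rw [h0, h1] at this
  norm_num at this

theorem circ_add_pi (θ : ℝ) : circ (θ + Real.pi) = (-1 : ℝ) • circ θ := by
  ext i; fin_cases i <;> simp [circ]

theorem contDiff_circ : ContDiff ℝ ∞ circ := by
  rw [contDiff_pi]
  intro i
  fin_cases i
  · exact Real.contDiff_cos
  · exact Real.contDiff_sin

theorem hasDerivAt_circ (θ : ℝ) : HasDerivAt circ ![-Real.sin θ, Real.cos θ] θ := by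
  rw [hasDerivAt_pi]
  intro i
  fin_cases i
  · exact Real.hasDerivAt_cos θ
  · exact Real.hasDerivAt_sin θ

theorem circ_mem_dom (x y : ℝ) : (circ x, circ y) ∈ dom := ⟨circ_ne_zero x, circ_ne_zero y⟩

theorem exists_polar {s : Plane} (hs : s ≠ 0) : ∃ r θ : ℝ, 0 < r ∧ s = r • circ θ := by
  let z : ℂ := ⟨s 0, s 1⟩
  have hz : z ≠ 0 := by
    intro h
    apply hs
    ext i
    fin_cases i
    · exact congrArg Complex.re h
    · exact congrArg Complex.im h
  refine ⟨‖z‖, Complex.arg z, norm_pos_iff.mpr hz, ?_⟩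
  ext i
  fin_cases i
  · change s 0 = ‖z‖ * Real.cos (Complex.arg z)
    rw [Complex.norm_mul_cos_arg]
  · change s 1 = ‖z‖ * Real.sin (Complex.arg z)
    rw [Complex.norm_mul_sin_arg]

theorem E.ext_torus {u v : E τ τ'} (h : ∀ x y, torus u x y = torus v x y) : u = v := by
  refine E.ext_dom fun p hp => ?_
  obtain ⟨r, x, hr, hx⟩ := exists_polar hp.1
  obtain ⟨r', y, hr', hy⟩ := exists_polar hp.2
  have hpe : p = (r • circ x, r' • circ y) := Prod.ext hx hy
  rw [hpe, E.homogeneous u hr.ne' hr'.ne' (circ_ne_zero x) (circ_ne_zero y),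
    E.homogeneous v hr.ne' hr'.ne' (circ_ne_zero x) (circ_ne_zero y)]
  exact congrArg _ (h x y)

theorem continuous_torus (u : E τ τ') : Continuous (Function.uncurry (torus u)) := by
  refine (E.contDiffOn u).continuousOn.comp_continuous (f := fun p : ℝ × ℝ => (circ p.1, circ p.2))
    ?_ fun p => circ_mem_dom _ _
  exact (contDiff_circ.continuous.comp continuous_fst).prodMk
    (contDiff_circ.continuous.comp continuous_snd)

theorem torus_periodic_left (u : E τ τ') (y : ℝ) :
    Function.Periodic (fun x => torus u x y) Real.pi := by
  intro x
  have := E.homogeneous u (a := -1) (b := 1) (by norm_num) one_ne_zero (circ_ne_zero x)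
    (circ_ne_zero y)
  rw [← circ_add_pi] at this
  simpa [torus] using this

theorem torus_periodic_right (u : E τ τ') (x : ℝ) :
    Function.Periodic (torus u x) Real.pi := by
  intro y
  have := E.homogeneous u (a := 1) (b := -1) one_ne_zero (by norm_num) (circ_ne_zero x)
    (circ_ne_zero y)
  rw [← circ_add_pi] at this
  simpa [torus] using this

theorem torus_bounded (u : E τ τ') : ∃ B, ∀ x y, ‖torus u x y‖ ≤ B := by
  have hc := (isCompact_Icc (a := (0 : ℝ)) (b := Real.pi)).prod
    (isCompact_Icc (a := (0 : ℝ)) (b := Real.pi))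
  obtain ⟨B, hB⟩ := hc.exists_bound_of_continuousOn (continuous_torus u).continuousOn
  refine ⟨B, fun x y => ?_⟩
  obtain ⟨x', hx', hxx⟩ := (torus_periodic_left u y).exists_mem_Ico₀ Real.pi_pos x
  obtain ⟨y', hy', hyy⟩ := (torus_periodic_right u x').exists_mem_Ico₀ Real.pi_pos y
  rw [show torus u x y = torus u x' y from hxx, hyy]
  exact hB (x', y') ⟨Set.Ico_subset_Icc_self hx', Set.Ico_subset_Icc_self hy'⟩

/-- The infinitesimal rotation, normalized so that it acts as `d/dθ` on functions of the angle. -/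
def rotJ : lieG := ⟨!![0, 1; -1, 0], by
  change Matrix.trace !![(0 : ℝ), 1; -1, 0] = 0
  simp [Matrix.trace_fin_two]⟩

theorem hasDerivAt_torus_left (u : E τ τ') (x y : ℝ) :
    HasDerivAt (fun x => torus u x y) (torus (actE (rotJ, 0) u) x y) x := by
  have h := (E.differentiableAt u (circ_mem_dom x y)).hasFDerivAt.comp_hasDerivAt x
    ((hasDerivAt_circ x).prodMk (hasDerivAt_const x (circ y)))
  refine h.congr_deriv ?_
  rw [torus, actE_apply, ← map_neg]
  congr 1
  rw [mv_apply]
  refine Prod.ext ?_ (by simp)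
  ext i; fin_cases i <;> simp [rotJ, circ]

theorem hasDerivAt_torus_right (u : E τ τ') (x y : ℝ) :
    HasDerivAt (torus u x) (torus (actE (0, rotJ) u) x y) y := by
  have h := (E.differentiableAt u (circ_mem_dom x y)).hasFDerivAt.comp_hasDerivAt y
    ((hasDerivAt_const y (circ x)).prodMk (hasDerivAt_circ y))
  refine h.congr_deriv ?_
  rw [torus, actE_apply, ← map_neg]
  congr 1
  rw [mv_apply]
  refine Prod.ext (by simp) ?_
  ext i; fin_cases i <;> simp [rotJ, circ]

/-- The Fourier coefficients of a vector of `E` along the weight vectors. -/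
def uhat (u : E τ τ') : ℤ × ℤ → ℂ := fcoef2 (torus u)

theorem fcoef2_swap {F : ℝ → ℝ → ℂ} (hF : Continuous (Function.uncurry F)) {B : ℝ}
    (hB : ∀ x y, ‖F x y‖ ≤ B) (p : ℤ × ℤ) :
    fcoef2 F p = fcoef (fun x => fcoef (F x) p.2) p.1 := by
  unfold fcoef2 fcoef
  simp_rw [← integral_mul_const]
  rw [integral_integral_swap (f := fun y x => F x y * wave (-p.1) x * wave (-p.2) y)]
  · congr 1; ext x; congr 1; ext y; ring
  · refine Integrable.of_bound (C := B) (Continuous.aestronglyMeasurable ?_)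
      (Filter.Eventually.of_forall fun q => ?_)
    · exact ((hF.comp continuous_swap).mul ((continuous_wave _).comp continuous_snd)).mul
        ((continuous_wave _).comp continuous_fst)
    · change ‖F q.2 q.1 * wave (-p.1) q.2 * wave (-p.2) q.1‖ ≤ B
      simpa [norm_wave] using hB q.2 q.1

theorem continuous_torus_left (u : E τ τ') (y : ℝ) : Continuous fun x => torus u x y :=
  (continuous_torus u).comp (continuous_id.prodMk continuous_const)

theorem continuous_torus_right (u : E τ τ') (x : ℝ) : Continuous (torus u x) :=
  (continuous_torus u).comp (continuous_const.prodMk continuous_id)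

theorem fcoef_torus_rot (u : E τ τ') (y : ℝ) (m : ℤ) :
    fcoef (fun x => torus (actE (rotJ, 0) u) x y) m =
      2 * m * Complex.I * fcoef (fun x => torus u x y) m :=
  fcoef_deriv (fun x => hasDerivAt_torus_left u x y) (continuous_torus_left _ y)
    (torus_periodic_left u y) m

theorem fcoef_const_mul (c : ℂ) (F : ℝ → ℂ) (m : ℤ) :
    fcoef (fun x => c * F x) m = c * fcoef F m := by
  simp_rw [fcoef, mul_assoc, integral_const_mul]

theorem uhat_rot_left (u : E τ τ') (p : ℤ × ℤ) :
    uhat (actE (rotJ, 0) u) p = 2 * p.1 * Complex.I * uhat u p := by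
  unfold uhat fcoef2
  simp_rw [fcoef_torus_rot, fcoef_const_mul]

theorem uhat_rot_right (u : E τ τ') (p : ℤ × ℤ) :
    uhat (actE (0, rotJ) u) p = 2 * p.2 * Complex.I * uhat u p := by
  obtain ⟨B, hB⟩ := torus_bounded u
  obtain ⟨B', hB'⟩ := torus_bounded (actE (0, rotJ) u)
  unfold uhat
  rw [fcoef2_swap (continuous_torus _) hB, fcoef2_swap (continuous_torus _) hB']
  have : ∀ x, fcoef (torus (actE (0, rotJ) u) x) p.2 =
      2 * p.2 * Complex.I * fcoef (torus u x) p.2 := fun x =>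
    fcoef_deriv (fun y => hasDerivAt_torus_right u x y) (continuous_torus_right _ x)
      (torus_periodic_right u x) p.2
  simp_rw [this, fcoef_const_mul]

theorem fcoef_add {F G : ℝ → ℂ} (hF : Continuous F) (hG : Continuous G) (m : ℤ) :
    fcoef (fun θ => F θ + G θ) m = fcoef F m + fcoef G m := by
  unfold fcoef
  simp_rw [add_mul]
  exact integral_add (integrable_circle (hF.mul (continuous_wave _)))
    (integrable_circle (hG.mul (continuous_wave _)))

theorem uhat_add (u v : E τ τ') (p : ℤ × ℤ) : uhat (u + v) p = uhat u p + uhat v p := by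
  have h : ∀ y, fcoef (fun x => torus (u + v : E τ τ') x y) p.1 =
      fcoef (fun x => torus u x y) p.1 + fcoef (fun x => torus v x y) p.1 := fun y =>
    fcoef_add (continuous_torus_left u y) (continuous_torus_left v y) p.1
  unfold uhat fcoef2
  simp_rw [h]
  exact fcoef_add (continuous_fcoef_slice (continuous_torus u) _)
    (continuous_fcoef_slice (continuous_torus v) _) p.2

theorem uhat_smul (c : ℂ) (u : E τ τ') (p : ℤ × ℤ) : uhat (c • u) p = c * uhat u p := by
  have h : ∀ y, fcoef (fun x => torus (c • u : E τ τ') x y) p.1 =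
      c * fcoef (fun x => torus u x y) p.1 := fun y => fcoef_const_mul c _ p.1
  unfold uhat fcoef2
  simp_rw [h, fcoef_const_mul]

theorem norm_uhat_le {u : E τ τ'} {B : ℝ} (hB : ∀ x y, ‖torus u x y‖ ≤ B) (p : ℤ × ℤ) :
    ‖uhat u p‖ ≤ B :=
  norm_fcoef_le (fun y => norm_fcoef_le (fun x => hB x y) p.1) p.2

theorem exists_bound_uhat (u : E τ τ') :
    ∃ B, ∀ p, ‖uhat u p‖ ≤ B * ((1 + (p.1 : ℝ) ^ 2)⁻¹ * (1 + (p.2 : ℝ) ^ 2)⁻¹) := by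
  let w : E τ τ' := u + (-1 : ℂ) • actE (rotJ, 0) (actE (rotJ, 0) u)
  let v : E τ τ' := w + (-1 : ℂ) • actE (0, rotJ) (actE (0, rotJ) w)
  obtain ⟨B, hB⟩ := torus_bounded v
  refine ⟨B, fun p => ?_⟩
  have h := norm_uhat_le hB p
  have ew : uhat w p = (1 + 4 * (p.1 : ℂ) ^ 2) * uhat u p := by
    simp only [w, uhat_add, uhat_smul, uhat_rot_left]
    linear_combination (-4 * (p.1 : ℂ) ^ 2 * uhat u p) * Complex.I_sq
  have e : uhat v p = (((1 + 4 * (p.1 : ℝ) ^ 2) * (1 + 4 * (p.2 : ℝ) ^ 2) : ℝ) : ℂ) * uhat u p := by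
    simp only [v, uhat_add, uhat_smul, uhat_rot_right, ew]
    push_cast
    linear_combination
      (-4 * (p.2 : ℂ) ^ 2 * (1 + 4 * (p.1 : ℂ) ^ 2) * uhat u p) * Complex.I_sq
  rw [e, norm_mul, Complex.norm_real, Real.norm_of_nonneg (by positivity)] at h
  rw [← mul_inv, ← div_eq_mul_inv, le_div_iff₀ (by positivity), mul_comm]
  refine le_trans ?_ h
  gcongr <;> nlinarith [sq_nonneg (p.1 : ℝ), sq_nonneg (p.2 : ℝ)]

theorem summable_norm_uhat (u : E τ τ') : Summable fun p => ‖uhat u p‖ := by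
  obtain ⟨B, hB⟩ := exists_bound_uhat u
  refine Summable.of_nonneg_of_le (fun p => norm_nonneg _) hB (Summable.mul_left B ?_)
  exact summable_int_inv_one_add_sq.mul_of_nonneg summable_int_inv_one_add_sq
    (fun _ => by positivity) (fun _ => by positivity)

theorem hasSum_uhat (u : E τ τ') (x y : ℝ) :
    HasSum (fun p : ℤ × ℤ => uhat u p * (wave p.1 x * wave p.2 y)) (torus u x y) :=
  hasSum_fcoef2 (continuous_torus u) (torus_periodic_left u) (torus_periodic_right u)
    (summable_norm_uhat u).of_norm x y

/-- The squared norms of the weight vectors of `E`. -/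
def weight2 (τ τ' : ℂ) (p : ℤ × ℤ) : ℝ := weight τ p.1 * weight τ' p.2

theorem weight2_pos (hτ : IsUnitaryParam τ) (hτ' : IsUnitaryParam τ') (p : ℤ × ℤ) :
    0 < weight2 τ τ' p :=
  mul_pos ((pairMeasure_spec hτ).2.1 _) ((pairMeasure_spec hτ').2.1 _)

/-- The Parseval formula for the invariant scalar product of `E`. -/
theorem hasSum_formE (hτ : IsUnitaryParam τ) (hτ' : IsUnitaryParam τ') (u v : E τ τ') :
    HasSum (fun p => (weight2 τ τ' p : ℂ) * (uhat u p * conj (uhat v p))) (formE τ τ' u v) := by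
  obtain ⟨hP, -, hI⟩ := pairMeasure_spec hτ
  obtain ⟨hP', -, hI'⟩ := pairMeasure_spec hτ'
  -- multiply the two absolutely convergent Fourier series and integrate term by term; orthogonality
  -- leaves the diagonal terms
  let f : (ℤ × ℤ) × (ℤ × ℤ) → (ℝ × ℝ) × (ℝ × ℝ) → ℂ := fun i r =>
    (uhat u i.1 * conj (uhat v i.2)) * ((wave i.1.1 r.1.1 * conj (wave i.2.1 r.1.2)) *
      (wave i.1.2 r.2.1 * conj (wave i.2.2 r.2.2)))
  have hfn : ∀ i r, ‖f i r‖ = ‖uhat u i.1‖ * ‖uhat v i.2‖ := fun i r => by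
    simp [f, norm_wave]
  have hsum : Summable fun i : (ℤ × ℤ) × (ℤ × ℤ) => ‖uhat u i.1‖ * ‖uhat v i.2‖ :=
    (summable_norm_uhat u).mul_of_nonneg (summable_norm_uhat v)
      (fun _ => norm_nonneg _) (fun _ => norm_nonneg _)
  have hcont : ∀ i, Continuous (f i) := by
    intro i
    have hw : ∀ k : ℤ, Continuous (wave k) := continuous_wave
    have hcw : ∀ k : ℤ, Continuous fun x => conj (wave k x) := fun k =>
      Complex.continuous_conj.comp (hw k)
    exact continuous_const.mul ((((hw _).comp (by fun_prop)).mul ((hcw _).comp (by fun_prop))).mul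
      (((hw _).comp (by fun_prop)).mul ((hcw _).comp (by fun_prop))))
  have hint : ∀ i, Integrable (f i) ((pairMeasure τ).prod (pairMeasure τ')) := fun i =>
    Integrable.of_bound (hcont i).aestronglyMeasurable _
      (Filter.Eventually.of_forall fun r => (hfn i r).le)
  have hmain := hasSum_integral_of_summable_integral_norm hint (by
    simp_rw [hfn]
    simpa using hsum)
  have htsum : ∀ r : (ℝ × ℝ) × (ℝ × ℝ), ∑' i, f i r =
      (u : Plane × Plane → ℂ) (circ r.1.1, circ r.2.1) *
        conj ((v : Plane × Plane → ℂ) (circ r.1.2, circ r.2.2)) := by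
    intro r
    have h1 := hasSum_uhat u r.1.1 r.2.1
    have h2 : HasSum (fun p : ℤ × ℤ => conj (uhat v p * (wave p.1 r.1.2 * wave p.2 r.2.2)))
      (conj (torus v r.1.2 r.2.2)) := Complex.conjCLE.toContinuousLinearMap.hasSum
        (hasSum_uhat v r.1.2 r.2.2)
    have h3 := h1.mul h2 (by
      refine Summable.of_norm (hsum.congr fun i => ?_)
      simp [norm_wave])
    have h4 := h3.tsum_eq
    simp only [torus] at h4
    rw [← h4]
    congr 1; ext i
    simp only [f, map_mul]
    ring
  simp_rw [htsum] at hmain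
  have hterm : ∀ i : (ℤ × ℤ) × (ℤ × ℤ), ∫ r, f i r ∂((pairMeasure τ).prod (pairMeasure τ')) =
      if i.1 = i.2 then (weight2 τ τ' i.1 : ℂ) * (uhat u i.1 * conj (uhat v i.2)) else 0 := by
    intro i
    simp only [f]
    rw [integral_const_mul, integral_prod_mul (fun r : ℝ × ℝ => wave i.1.1 r.1 *
      conj (wave i.2.1 r.2)) (fun r : ℝ × ℝ => wave i.1.2 r.1 * conj (wave i.2.2 r.2)), hI, hI']
    by_cases h1 : i.1.1 = i.2.1
    · by_cases h2 : i.1.2 = i.2.2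
      · rw [if_pos h1, if_pos h2, if_pos (Prod.ext h1 h2), weight2]
        push_cast; ring
      · rw [if_neg h2, if_neg fun h => h2 (congrArg Prod.snd h)]; ring
    · rw [if_neg h1, if_neg fun h => h1 (congrArg Prod.fst h)]; ring
  simp_rw [hterm] at hmain
  have hinj : Function.Injective fun p : ℤ × ℤ => (p, p) := fun p q h => congrArg Prod.fst h
  rw [← hinj.hasSum_iff] at hmain
  · simpa [Function.comp_def, formE] using hmain
  · intro i hi
    rw [if_neg]
    intro h
    exact hi ⟨i.1, Prod.ext rfl h⟩

/-! ### Ordered monomials span the enveloping algebra -/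

section Ordering

variable {A ι : Type*} [Ring A] [Algebra ℝ A]

/-- The span of the words of length at most `k` in the elements `x i`. -/
def wordSpan (x : ι → A) (k : ℕ) : Submodule ℝ A :=
  Submodule.span ℝ {a | ∃ w : List ι, w.length ≤ k ∧ (w.map x).prod = a}

theorem word_mem (x : ι → A) {k : ℕ} {w : List ι} (hw : w.length ≤ k) :
    (w.map x).prod ∈ wordSpan x k := Submodule.subset_span ⟨w, hw, rfl⟩

theorem mul_mem_wordSpan (x : ι → A) {k : ℕ} {a : A} (ha : a ∈ wordSpan x k) (i : ι) :
    x i * a ∈ wordSpan x (k + 1) := by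
  induction ha using Submodule.span_induction with
  | mem a h =>
    obtain ⟨w, hw, rfl⟩ := h
    rw [← List.prod_cons, ← List.map_cons]
    exact word_mem x (by simpa using hw)
  | zero => simp
  | add a b _ _ h1 h2 => rw [mul_add]; exact Submodule.add_mem _ h1 h2
  | smul c a _ h => rw [mul_smul_comm]; exact Submodule.smul_mem _ c h

/-- Permuting a word changes it by shorter words only. -/
theorem word_sub_word_mem {x : ι → A}
    (hx : ∀ i j, x i * x j - x j * x i ∈ Submodule.span ℝ (Set.range x)) {w w' : List ι}
    (h : w.Perm w') : ∀ k, w.length ≤ k + 1 →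
      (w.map x).prod - (w'.map x).prod ∈ wordSpan x k := by
  induction h with
  | nil => intro k _; simp
  | @cons i l₁ l₂ h ih =>
    intro k hk
    rw [List.length_cons, Nat.add_le_add_iff_right] at hk
    rcases k with _ | k
    · obtain rfl := List.eq_nil_of_length_eq_zero (Nat.le_zero.mp hk)
      obtain rfl := h.nil_eq
      simp
    · simp only [List.map_cons, List.prod_cons, ← mul_sub]
      exact mul_mem_wordSpan x (ih k hk) i
  | swap i j l =>
    intro k hk
    simp only [List.length_cons] at hk
    simp only [List.map_cons, List.prod_cons, ← mul_assoc, ← sub_mul]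
    have : ∀ a ∈ Submodule.span ℝ (Set.range x), a * (l.map x).prod ∈ wordSpan x k := by
      intro a ha
      induction ha using Submodule.span_induction with
      | mem a h =>
        obtain ⟨m, rfl⟩ := h
        rw [← List.prod_cons, ← List.map_cons]
        exact word_mem x (by simp only [List.length_cons]; omega)
      | zero => simp
      | add a b _ _ h1 h2 => rw [add_mul]; exact Submodule.add_mem _ h1 h2
      | smul c a _ h => rw [smul_mul_assoc]; exact Submodule.smul_mem _ c h
    exact this _ (hx j i)
  | @trans l₁ l₂ l₃ h12 h23 ih1 ih2 =>
    intro k hk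
    have := Submodule.add_mem _ (ih1 k hk) (ih2 k (h12.length_eq ▸ hk))
    simpa using this

end Ordering

/-- The multi-indices of degree at most `k`. -/
def multiIndices (k : ℕ) : Finset (Fin 6 → ℕ) :=
  (Finset.range (k + 1)).biUnion fun d => Finset.piAntidiag (Finset.univ : Finset (Fin 6)) d

theorem mem_multiIndices {k : ℕ} {n : Fin 6 → ℕ} : n ∈ multiIndices k ↔ ∑ i, n i ≤ k := by
  simp [multiIndices]

/-- The ordered word `0 ⋯ 0 1 ⋯ 1 ⋯ 5 ⋯ 5` with multiplicities `n`. -/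
def sortedWord (n : Fin 6 → ℕ) : List (Fin 6) :=
  (List.finRange 6).flatMap fun j => List.replicate (n j) j

theorem length_sortedWord (n : Fin 6 → ℕ) : (sortedWord n).length = ∑ i, n i := by
  simp [sortedWord, List.finRange, Fin.sum_univ_succ]

theorem sortedWord_count_perm (w : List (Fin 6)) : w.Perm (sortedWord fun j => w.count j) := by
  rw [List.perm_iff_count]
  intro i
  rw [sortedWord, List.count_flatMap]
  have : (List.count i ∘ fun j => List.replicate (w.count j) j) =
      fun j => if j = i then w.count i else 0 := by
    ext j
    simp only [Function.comp_apply, List.count_replicate]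
    by_cases h : j = i
    · subst h; simp
    · simp [h]
  rw [this, ← Fin.sum_univ_def]
  simp

theorem prod_sortedWord {A : Type*} [Monoid A] (x : Fin 6 → A) (n : Fin 6 → ℕ) :
    ((sortedWord n).map x).prod = ((List.finRange 6).map fun j => x j ^ n j).prod := by
  rw [sortedWord, List.map_flatMap, List.flatMap, List.prod_flatten, List.map_map]
  congr 1
  apply List.map_congr_left
  intro j _
  simp

theorem wordSpan_le {A : Type*} [Ring A] [Algebra ℝ A] {x : Fin 6 → A}
    (hx : ∀ i j, x i * x j - x j * x i ∈ Submodule.span ℝ (Set.range x)) (k : ℕ) :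
    wordSpan x k ≤ Submodule.span ℝ
      ((fun n => ((sortedWord n).map x).prod) '' (multiIndices k : Set (Fin 6 → ℕ))) := by
  induction k with
  | zero =>
    refine Submodule.span_mono ?_
    rintro a ⟨w, hw, rfl⟩
    obtain rfl := List.eq_nil_of_length_eq_zero (Nat.le_zero.mp hw)
    exact ⟨0, by simp [mem_multiIndices], by simp [prod_sortedWord]⟩
  | succ k ih =>
    refine Submodule.span_le.mpr ?_
    rintro a ⟨w, hw, rfl⟩
    have hp := sortedWord_count_perm w
    have h1 := ih (word_sub_word_mem hx hp k hw)
    have h2 : ((sortedWord fun j => w.count j).map x).prod ∈ Submodule.span ℝ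
        ((fun n => ((sortedWord n).map x).prod) '' (multiIndices (k + 1) : Set (Fin 6 → ℕ))) := by
      refine Submodule.subset_span ⟨fun j => w.count j, ?_, rfl⟩
      rw [Finset.mem_coe, mem_multiIndices, ← length_sortedWord, ← hp.length_eq]
      exact hw
    have h3 : Submodule.span ℝ
        ((fun n => ((sortedWord n).map x).prod) '' (multiIndices k : Set (Fin 6 → ℕ))) ≤
        Submodule.span ℝ
        ((fun n => ((sortedWord n).map x).prod) '' (multiIndices (k + 1) : Set (Fin 6 → ℕ))) := by
      refine Submodule.span_mono (Set.image_mono fun n hn => ?_)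
      rw [Finset.mem_coe, mem_multiIndices] at hn ⊢
      omega
    simpa using Submodule.add_mem _ (h3 h1) h2

/-! ### Monomials in the Lie algebra acting on `E` -/

/-- The operator on `E` of a word in the Lie algebra. -/
def wordAct (L : List (lieG × lieG)) : Module.End ℂ (E τ τ') := (L.map actE).prod

theorem wordAct_cons (Z : lieG × lieG) (L : List (lieG × lieG)) (u : E τ τ') :
    wordAct (Z :: L) u = actE Z (wordAct L u) := by
  simp [wordAct]

theorem wordAct_append (L L' : List (lieG × lieG)) (u : E τ τ') :
    wordAct (L ++ L') u = wordAct L (wordAct L' u) := by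
  simp [wordAct]

theorem monomialAct_eq (b : Module.Basis (Fin 6) ℝ (lieG × lieG)) (n : Fin 6 → ℕ) (u : E τ τ') :
    monomialAct b n u = (wordAct ((sortedWord n).map b) u : Plane × Plane → ℂ) := by
  have h1 : ∀ (Z : lieG × lieG) (k : ℕ) (v : E τ τ'),
      (lieAct Z)^[k] (v : Plane × Plane → ℂ) = ((actE Z ^ k) v : E τ τ') := by
    intro Z k
    induction k with
    | zero => intro v; simp
    | succ k ih =>
      intro v
      rw [Function.iterate_succ_apply, ← actE_coe, ih, pow_succ, Module.End.mul_apply]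
  have h2 : ∀ L : List (Fin 6), L.foldr (fun j w => (lieAct (b j))^[n j] w) u =
      (((L.map fun j => actE (b j) ^ n j).prod : Module.End ℂ (E τ τ')) u : E τ τ') := by
    intro L
    induction L with
    | nil => simp
    | cons j L ih => rw [List.foldr_cons, ih, h1, List.map_cons, List.prod_cons,
        Module.End.mul_apply]
  rw [monomialAct, h2, wordAct, List.map_map, prod_sortedWord]
  rfl

/-- The operator `X^n` on `E`. -/
def mono (b : Module.Basis (Fin 6) ℝ (lieG × lieG)) (n : Fin 6 → ℕ) : Module.End ℂ (E τ τ') :=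
  wordAct ((sortedWord n).map b)

/-- Words in the basis are combinations of ordered monomials, with coefficients which do not depend
on the representation. For uniformity the relation is established in the product of all the
endomorphism algebras. -/
theorem exists_word_eq_sum (b : Module.Basis (Fin 6) ℝ (lieG × lieG)) {k : ℕ} {w : List (Fin 6)}
    (hw : w.length ≤ k) : ∃ c : (Fin 6 → ℕ) → ℝ, ∀ (τ τ' : ℂ) (u : E τ τ'),
      wordAct (w.map b) u = ∑ n ∈ multiIndices k, (c n : ℂ) • mono b n u := by
  let act : (lieG × lieG) →ₗ[ℝ] ((p : ℂ × ℂ) → Module.End ℂ (E p.1 p.2)) :=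
    LinearMap.pi fun p => actLin p.1 p.2
  let x : Fin 6 → (p : ℂ × ℂ) → Module.End ℂ (E p.1 p.2) := fun j => act (b j)
  have hx : ∀ i j, x i * x j - x j * x i ∈ Submodule.span ℝ (Set.range x) := by
    intro i j
    have h : x i * x j - x j * x i = act ⁅b i, b j⁆ := by
      funext p
      exact (actE_lie (b i) (b j)).symm
    rw [h, ← b.sum_repr ⁅b i, b j⁆, map_sum]
    refine Submodule.sum_mem _ fun l _ => ?_
    rw [map_smul]
    exact Submodule.smul_mem _ _ (Submodule.subset_span ⟨l, rfl⟩)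
  have h := wordSpan_le hx k (word_mem x hw)
  rw [Submodule.mem_span_image_finset_iff_exists_fun'] at h
  obtain ⟨c, hc⟩ := h
  refine ⟨c, fun τ τ' u => ?_⟩
  have hev : ∀ v : List (Fin 6), (v.map x).prod (τ, τ') = wordAct (v.map b) := by
    intro v
    rw [wordAct, List.map_map]
    have := map_list_prod (Pi.evalRingHom (fun p : ℂ × ℂ => Module.End ℂ (E p.1 p.2)) (τ, τ'))
      (v.map x)
    rw [List.map_map] at this
    exact this
  have h2 := congrArg (fun a : Module.End ℂ (E τ τ') => a u)
    (congrFun hc (τ, τ'))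
  simp only [hev] at h2
  rw [← h2]
  simp only [Finset.sum_apply, LinearMap.sum_apply, Pi.smul_apply, hev, LinearMap.smul_apply]
  rfl

/-! ### The invariant norm and the Sobolev norms -/

/-- The square of the invariant norm on `E`. -/
def nsq (u : E τ τ') : ℝ := (formE τ τ' u u).re

theorem hasSum_nsq (hτ : IsUnitaryParam τ) (hτ' : IsUnitaryParam τ') (u : E τ τ') :
    HasSum (fun p => weight2 τ τ' p * ‖uhat u p‖ ^ 2) (nsq u) := by
  have h : HasSum (fun p => Complex.reCLM ((weight2 τ τ' p : ℂ) * (uhat u p * conj (uhat u p))))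
    (nsq u) := Complex.reCLM.hasSum (hasSum_formE hτ hτ' u u)
  have e : (fun p => weight2 τ τ' p * ‖uhat u p‖ ^ 2) = fun p =>
      Complex.reCLM ((weight2 τ τ' p : ℂ) * (uhat u p * conj (uhat u p))) := by
    ext p
    rw [Complex.mul_conj, Complex.normSq_eq_norm_sq, ← Complex.ofReal_mul]
    rfl
  rwa [e]

theorem formE_conj (hτ : IsUnitaryParam τ) (hτ' : IsUnitaryParam τ') (u v : E τ τ') :
    conj (formE τ τ' u v) = formE τ τ' v u := by
  have h : HasSum (fun p => conj ((weight2 τ τ' p : ℂ) * (uhat u p * conj (uhat v p))))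
    (conj (formE τ τ' u v)) := Complex.conjCLE.toContinuousLinearMap.hasSum (hasSum_formE hτ hτ' u v)
  refine h.unique ?_
  convert hasSum_formE hτ hτ' v u using 1
  ext p
  simp only [map_mul, Complex.conj_ofReal, Complex.conj_conj]
  ring

theorem formE_self (hτ : IsUnitaryParam τ) (hτ' : IsUnitaryParam τ') (u : E τ τ') :
    formE τ τ' u u = (nsq u : ℂ) :=
  (Complex.conj_eq_iff_re.mp (formE_conj hτ hτ' u u)).symm

theorem formE_add_left (hτ : IsUnitaryParam τ) (hτ' : IsUnitaryParam τ') (u v w : E τ τ') :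
    formE τ τ' (u + v : E τ τ') w = formE τ τ' u w + formE τ τ' v w := by
  refine (hasSum_formE hτ hτ' (u + v) w).unique ?_
  convert (hasSum_formE hτ hτ' u w).add (hasSum_formE hτ hτ' v w) using 1
  ext p
  rw [uhat_add]; ring

theorem formE_smul_left (hτ : IsUnitaryParam τ) (hτ' : IsUnitaryParam τ') (c : ℂ)
    (u w : E τ τ') : formE τ τ' (c • u : E τ τ') w = c * formE τ τ' u w := by
  refine (hasSum_formE hτ hτ' (c • u) w).unique ?_
  have h := (hasSum_formE hτ hτ' u w).mul_left c
  have e : (fun p => (weight2 τ τ' p : ℂ) * (uhat (c • u) p * conj (uhat w p))) = fun p =>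
      c * ((weight2 τ τ' p : ℂ) * (uhat u p * conj (uhat w p))) := by
    ext p
    rw [uhat_smul]; ring
  rwa [e]

theorem nsq_nonneg (hτ : IsUnitaryParam τ) (hτ' : IsUnitaryParam τ') (u : E τ τ') : 0 ≤ nsq u :=
  (hasSum_nsq hτ hτ' u).nonneg fun p => mul_nonneg (weight2_pos hτ hτ' p).le (by positivity)

theorem nsq_pos (hτ : IsUnitaryParam τ) (hτ' : IsUnitaryParam τ') {u : E τ τ'} (hu : u ≠ 0) :
    0 < nsq u := by
  refine lt_of_le_of_ne (nsq_nonneg hτ hτ' u) fun h => hu ?_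
  have h0 := hasSum_nsq hτ hτ' u
  rw [← h, hasSum_zero_iff_of_nonneg
    fun p => mul_nonneg (weight2_pos hτ hτ' p).le (by positivity)] at h0
  have hz : ∀ p, uhat u p = 0 := fun p => by
    have := congrFun h0 p
    simpa [(weight2_pos hτ hτ' p).ne'] using this
  refine E.ext_torus fun x y => ?_
  have h1 := hasSum_uhat u x y
  simp only [hz, zero_mul] at h1
  rw [h1.unique hasSum_zero]
  rfl

theorem uhat_sum {ι : Type*} (s : Finset ι) (c : ι → ℂ) (f : ι → E τ τ') (p : ℤ × ℤ) :
    uhat (∑ i ∈ s, c i • f i) p = ∑ i ∈ s, c i * uhat (f i) p := by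
  classical
  induction s using Finset.induction_on with
  | empty =>
    have := uhat_smul 0 (0 : E τ τ') p
    simpa using this
  | insert i s hi ih => rw [Finset.sum_insert hi, uhat_add, uhat_smul, ih, Finset.sum_insert hi]

theorem nsq_sum_le (hτ : IsUnitaryParam τ) (hτ' : IsUnitaryParam τ') {ι : Type*} (s : Finset ι)
    (c : ι → ℂ) (f : ι → E τ τ') :
    nsq (∑ i ∈ s, c i • f i) ≤ (∑ i ∈ s, ‖c i‖ ^ 2) * ∑ i ∈ s, nsq (f i) := by
  have h1 := hasSum_nsq hτ hτ' (∑ i ∈ s, c i • f i)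
  have h2 := (hasSum_sum fun i (_ : i ∈ s) => hasSum_nsq hτ hτ' (f i)).mul_left
    (∑ i ∈ s, ‖c i‖ ^ 2)
  refine hasSum_le (fun p => ?_) h1 h2
  rw [← Finset.mul_sum, mul_left_comm]
  refine mul_le_mul_of_nonneg_left ?_ (weight2_pos hτ hτ' p).le
  rw [uhat_sum]
  calc ‖∑ i ∈ s, c i * uhat (f i) p‖ ^ 2 ≤ (∑ i ∈ s, ‖c i‖ * ‖uhat (f i) p‖) ^ 2 := by
        gcongr
        refine (norm_sum_le _ _).trans (Finset.sum_le_sum fun i _ => (norm_mul _ _).le)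
    _ ≤ _ := Finset.sum_mul_sq_le_sq_mul_sq s _ _

theorem nsq_le_of_bound (hτ : IsUnitaryParam τ) (hτ' : IsUnitaryParam τ') {u : E τ τ'} {B : ℝ}
    (hB : ∀ x y, ‖torus u x y‖ ≤ B) : nsq u ≤ B ^ 2 := by
  obtain ⟨hP, -, -⟩ := pairMeasure_spec hτ
  obtain ⟨hP', -, -⟩ := pairMeasure_spec hτ'
  have hB0 : 0 ≤ B := (norm_nonneg _).trans (hB 0 0)
  have h := norm_integral_le_of_norm_le_const (μ := (pairMeasure τ).prod (pairMeasure τ'))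
    (f := fun r => (u : Plane × Plane → ℂ) (circ r.1.1, circ r.2.1) *
      conj ((u : Plane × Plane → ℂ) (circ r.1.2, circ r.2.2))) (C := B * B)
    (Filter.Eventually.of_forall fun r => by
      rw [norm_mul, RCLike.norm_conj]
      exact mul_le_mul (hB _ _) (hB _ _) (norm_nonneg _) hB0)
  rw [probReal_univ, mul_one] at h
  rw [sq]
  exact (Complex.re_le_norm _).trans h

/-- The value `Q_{l,T}(u, u)` of the Sobolev form. -/
def sobQ (b : Module.Basis (Fin 6) ℝ (lieG × lieG)) (l : ℕ) (T : ℝ) (u : E τ τ') : ℝ :=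
  ∑ k ∈ Finset.range (l + 1), ∑ n ∈ Finset.piAntidiag (Finset.univ : Finset (Fin 6)) k,
    T ^ (2 * (l - k)) * nsq (mono b n u)

section

variable (b : Module.Basis (Fin 6) ℝ (lieG × lieG)) (l : ℕ) (T : ℝ)

theorem sobolevForm_eq (u v : E τ τ') : sobolevForm b l T u v =
    ∑ k ∈ Finset.range (l + 1), ∑ n ∈ Finset.piAntidiag (Finset.univ : Finset (Fin 6)) k,
      (T : ℂ) ^ (2 * (l - k)) * formE τ τ' (mono b n u) (mono b n v) := by
  simp only [sobolevForm, monomialAct_eq, mono]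

theorem sobolevForm_self (hτ : IsUnitaryParam τ) (hτ' : IsUnitaryParam τ') (u : E τ τ') :
    sobolevForm b l T u u = (sobQ b l T u : ℂ) := by
  rw [sobolevForm_eq, sobQ]
  push_cast
  simp_rw [formE_self hτ hτ']

theorem sobolevForm_conj (hτ : IsUnitaryParam τ) (hτ' : IsUnitaryParam τ') (u v : E τ τ') :
    conj (sobolevForm b l T u v) = sobolevForm b l T v u := by
  simp only [sobolevForm_eq, map_sum, map_mul, map_pow, Complex.conj_ofReal, formE_conj hτ hτ']

theorem sobolevForm_add_left (hτ : IsUnitaryParam τ) (hτ' : IsUnitaryParam τ')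
    (u v w : E τ τ') :
    sobolevForm b l T (u + v) w = sobolevForm b l T u w + sobolevForm b l T v w := by
  simp only [sobolevForm_eq, map_add, formE_add_left hτ hτ', mul_add, Finset.sum_add_distrib]

theorem sobolevForm_smul_left (hτ : IsUnitaryParam τ) (hτ' : IsUnitaryParam τ') (c : ℂ)
    (u w : E τ τ') : sobolevForm b l T (c • u) w = c * sobolevForm b l T u w := by
  simp only [sobolevForm_eq, map_smul, formE_smul_left hτ hτ', Finset.mul_sum]
  refine Finset.sum_congr rfl fun k _ => Finset.sum_congr rfl fun n _ => ?_
  ring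

theorem sobolevForm_sum_left (hτ : IsUnitaryParam τ) (hτ' : IsUnitaryParam τ') {ι : Type*}
    (s : Finset ι) (c : ι → ℂ) (f : ι → E τ τ') (w : E τ τ') :
    sobolevForm b l T (∑ i ∈ s, c i • f i) w = ∑ i ∈ s, c i * sobolevForm b l T (f i) w := by
  classical
  induction s using Finset.induction_on with
  | empty =>
    have := sobolevForm_smul_left b l T hτ hτ' 0 (0 : E τ τ') w
    simpa using this
  | insert i s hi ih =>
    rw [Finset.sum_insert hi, sobolevForm_add_left b l T hτ hτ',
      sobolevForm_smul_left b l T hτ hτ', ih, Finset.sum_insert hi]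

/-- For an orthonormal family the Sobolev norm of a combination is that of the coefficients. -/
theorem sobQ_sum_of_orthonormal (hτ : IsUnitaryParam τ) (hτ' : IsUnitaryParam τ') {m : ℕ}
    {e : Fin m → E τ τ'} (he : ∀ i j, sobolevForm b l T (e i) (e j) = if i = j then 1 else 0)
    (c : Fin m → ℂ) : sobQ b l T (∑ i, c i • e i) = ∑ i, ‖c i‖ ^ 2 := by
  have h : sobolevForm b l T (∑ i, c i • e i) (∑ i, c i • e i) = ((∑ i, ‖c i‖ ^ 2 : ℝ) : ℂ) := by
    rw [sobolevForm_sum_left b l T hτ hτ']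
    push_cast
    refine Finset.sum_congr rfl fun i _ => ?_
    rw [← sobolevForm_conj b l T hτ hτ', sobolevForm_sum_left b l T hτ hτ']
    simp only [he, mul_ite, mul_one, mul_zero, Finset.sum_ite_eq', Finset.mem_univ, if_true]
    rw [Complex.mul_conj, Complex.normSq_eq_norm_sq, Complex.ofReal_pow]
  rw [sobolevForm_self b l T hτ hτ'] at h
  exact_mod_cast h

end

variable (b : Module.Basis (Fin 6) ℝ (lieG × lieG))

theorem mono_zero (u : E τ τ') : mono b 0 u = u := by
  have : sortedWord 0 = [] := List.eq_nil_of_length_eq_zero (by simp [length_sortedWord])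
  simp [mono, this, wordAct]

theorem sum_multiIndices {k : ℕ} (f : (Fin 6 → ℕ) → ℝ) : ∑ n ∈ multiIndices k, f n =
    ∑ d ∈ Finset.range (k + 1), ∑ n ∈ Finset.piAntidiag (Finset.univ : Finset (Fin 6)) d, f n := by
  refine Finset.sum_biUnion fun d _ d' _ h => ?_
  rw [Function.onFun, Finset.disjoint_left]
  intro n hn hn'
  rw [Finset.mem_piAntidiag] at hn hn'
  exact h (hn.1.symm.trans hn'.1)

theorem sum_nsq_mono_le_sobQ (hτ : IsUnitaryParam τ) (hτ' : IsUnitaryParam τ') {l k : ℕ}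
    (hk : k ≤ l) {T : ℝ} (hT : 1 ≤ T) (u : E τ τ') :
    T ^ (2 * (l - k)) * ∑ n ∈ multiIndices k, nsq (mono b n u) ≤ sobQ b l T u := by
  have h0 : ∀ (d : ℕ), 0 ≤ ∑ n ∈ Finset.piAntidiag (Finset.univ : Finset (Fin 6)) d,
      nsq (mono b n u) := fun d => Finset.sum_nonneg fun n _ => nsq_nonneg hτ hτ' _
  rw [sum_multiIndices, sobQ]
  simp_rw [← Finset.mul_sum]
  rw [Finset.mul_sum]
  refine le_trans (b := ∑ d ∈ Finset.range (k + 1), T ^ (2 * (l - d)) *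
    ∑ n ∈ Finset.piAntidiag (Finset.univ : Finset (Fin 6)) d, nsq (mono b n u))
    (Finset.sum_le_sum fun d hd => ?_)
    (Finset.sum_le_sum_of_subset_of_nonneg (Finset.range_mono (Nat.succ_le_succ hk))
      fun d _ _ => mul_nonneg (by positivity) (h0 d))
  refine mul_le_mul_of_nonneg_right (pow_le_pow_right₀ hT ?_) (h0 d)
  have := Finset.mem_range.mp hd
  omega

/-- A bound for words in the basis by ordered monomials, uniform in the representations. -/
theorem exists_nsq_word_le (k : ℕ) : ∃ C : ℝ, 0 ≤ C ∧ ∀ (τ τ' : ℂ), IsUnitaryParam τ →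
    IsUnitaryParam τ' → ∀ (w : List (Fin 6)), w.length ≤ k → ∀ u : E τ τ',
      nsq (wordAct (w.map b) u) ≤ C * ∑ n ∈ multiIndices k, nsq (mono b n u) := by
  have h1 : ∀ w : List (Fin 6), ∃ C : ℝ, 0 ≤ C ∧ (w.length ≤ k → ∀ (τ τ' : ℂ), IsUnitaryParam τ →
      IsUnitaryParam τ' → ∀ u : E τ τ',
      nsq (wordAct (w.map b) u) ≤ C * ∑ n ∈ multiIndices k, nsq (mono b n u)) := by
    intro w
    by_cases hw : w.length ≤ k
    · obtain ⟨c, hc⟩ := exists_word_eq_sum b hw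
      refine ⟨∑ n ∈ multiIndices k, ‖(c n : ℂ)‖ ^ 2, by positivity, fun _ τ τ' hτ hτ' u => ?_⟩
      rw [hc τ τ' u]
      exact nsq_sum_le hτ hτ' _ _ _
    · exact ⟨0, le_rfl, fun h => absurd h hw⟩
  choose C hC0 hC using h1
  have hfin : {w : List (Fin 6) | w.length ≤ k}.Finite := List.finite_length_le _ k
  refine ⟨∑ w ∈ hfin.toFinset, C w, Finset.sum_nonneg fun w _ => hC0 w,
    fun τ τ' hτ hτ' w hw u => (hC w hw τ τ' hτ hτ' u).trans ?_⟩
  refine mul_le_mul_of_nonneg_right ?_ (Finset.sum_nonneg fun n _ => nsq_nonneg hτ hτ' _)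
  exact Finset.single_le_sum (fun w _ => hC0 w) (hfin.mem_toFinset.mpr hw)

/-- The same bound for words in arbitrary elements of the Lie algebra with bounded coordinates. -/
theorem exists_nsq_wordAct_le (k : ℕ) (A : ℝ) : ∃ C : ℝ, 0 ≤ C ∧ ∀ (τ τ' : ℂ),
    IsUnitaryParam τ → IsUnitaryParam τ' → ∀ L : List (lieG × lieG), L.length ≤ k →
      (∀ Z ∈ L, ∀ j, |b.repr Z j| ≤ A) → ∀ u : E τ τ',
      nsq (wordAct L u) ≤ C * ∑ n ∈ multiIndices k, nsq (mono b n u) := by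
  obtain ⟨C, hC0, hC⟩ := exists_nsq_word_le b k
  let D : ℝ := max 1 (36 * A ^ 2)
  have hD1 : 1 ≤ D := le_max_left _ _
  refine ⟨D ^ k * C, by positivity, fun τ τ' hτ hτ' L hL hA u => ?_⟩
  have hS : 0 ≤ C * ∑ n ∈ multiIndices k, nsq (mono b n u) :=
    mul_nonneg hC0 (Finset.sum_nonneg fun n _ => nsq_nonneg hτ hτ' _)
  -- the letters are expanded in the basis one at a time, `w` collecting those already expanded; each
  -- step costs a factor `36 A²` by the Cauchy-Schwarz inequality
  have key : ∀ (L : List (lieG × lieG)), (∀ Z ∈ L, ∀ j, |b.repr Z j| ≤ A) →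
      ∀ w : List (Fin 6), w.length + L.length ≤ k →
      nsq (wordAct (w.map b) (wordAct L u)) ≤
        D ^ L.length * (C * ∑ n ∈ multiIndices k, nsq (mono b n u)) := by
    intro L
    induction L with
    | nil =>
      intro _ w hw
      simpa [wordAct] using hC τ τ' hτ hτ' w (by simpa using hw) u
    | cons Z L ih =>
      intro hZ w hw
      have hexp : wordAct (w.map b) (wordAct (Z :: L) u) = ∑ j : Fin 6,
          ((b.repr Z j : ℝ) : ℂ) • wordAct ((w ++ [j]).map b) (wordAct L u) := by
        have h1 : actE Z (wordAct L u) =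
            ∑ j : Fin 6, ((b.repr Z j : ℝ) : ℂ) • actE (b j) (wordAct L u) := by
          have h2 : actLin τ τ' Z = ∑ j, b.repr Z j • actLin τ τ' (b j) := by
            conv_lhs => rw [← b.sum_repr Z, map_sum]
            simp_rw [map_smul]
          have h3 := congrArg (fun a : Module.End ℂ (E τ τ') => a (wordAct L u)) h2
          simp only [LinearMap.sum_apply, LinearMap.smul_apply] at h3
          exact h3
        rw [wordAct_cons, h1, map_sum]
        refine Finset.sum_congr rfl fun j _ => ?_
        rw [map_smul, List.map_append, wordAct_append]
        simp [wordAct]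
      rw [hexp]
      refine (nsq_sum_le hτ hτ' _ _ _).trans ?_
      have hc : ∑ j : Fin 6, ‖((b.repr Z j : ℝ) : ℂ)‖ ^ 2 ≤ 6 * A ^ 2 := by
        refine (Finset.sum_le_card_nsmul _ _ (A ^ 2) fun j _ => ?_).trans (by simp)
        rw [Complex.norm_real, Real.norm_eq_abs]
        exact pow_le_pow_left₀ (abs_nonneg _) (hZ Z List.mem_cons_self j) 2
      have hn : ∑ j : Fin 6, nsq (wordAct ((w ++ [j]).map b) (wordAct L u)) ≤
          6 * (D ^ L.length * (C * ∑ n ∈ multiIndices k, nsq (mono b n u))) := by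
        refine (Finset.sum_le_card_nsmul _ _ _ fun j _ => ih
          (fun Z' h' => hZ Z' (List.mem_cons_of_mem _ h')) (w ++ [j]) ?_).trans (by simp)
        simp only [List.length_append, List.length_cons, List.length_nil] at hw ⊢
        omega
      refine (mul_le_mul hc hn (Finset.sum_nonneg fun j _ => nsq_nonneg hτ hτ' _)
        (by positivity)).trans ?_
      rw [List.length_cons, pow_succ D]
      have h36 : 36 * A ^ 2 ≤ D := le_max_right _ _
      have hP : 0 ≤ D ^ L.length * (C * ∑ n ∈ multiIndices k, nsq (mono b n u)) := by positivity
      linarith [mul_le_mul_of_nonneg_right h36 hP]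
  have h := key L hA [] (by simpa using hL)
  simp only [List.map_nil, wordAct, List.prod_nil, Module.End.one_apply] at h
  refine h.trans ?_
  rw [mul_assoc]
  exact mul_le_mul_of_nonneg_right (pow_le_pow_right₀ hD1 hL) hS

theorem nsq_replicate_rot_left (hτ : IsUnitaryParam τ) (hτ' : IsUnitaryParam τ') (u : E τ τ')
    (k : ℕ) : HasSum (fun p : ℤ × ℤ => (4 * (p.1 : ℝ) ^ 2) ^ k *
      (weight2 τ τ' p * ‖uhat u p‖ ^ 2)) (nsq (wordAct (List.replicate k (rotJ, 0)) u)) := by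
  convert hasSum_nsq hτ hτ' (wordAct (List.replicate k (rotJ, 0)) u) using 1
  ext p
  have h : uhat (wordAct (List.replicate k (rotJ, 0)) u) p =
      (2 * p.1 * Complex.I) ^ k * uhat u p := by
    induction k with
    | zero => simp [wordAct]
    | succ k ih => rw [List.replicate_succ, wordAct_cons, uhat_rot_left, ih]; ring
  rw [h, norm_mul, norm_pow, norm_mul, norm_mul, Complex.norm_I, Complex.norm_ofNat,
    Complex.norm_intCast, mul_one, ← sq_abs (p.1 : ℝ)]
  rw [show 4 * |(p.1 : ℝ)| ^ 2 = (2 * |(p.1 : ℝ)|) ^ 2 by ring]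
  generalize 2 * |(p.1 : ℝ)| = a
  ring

theorem nsq_replicate_rot_right (hτ : IsUnitaryParam τ) (hτ' : IsUnitaryParam τ') (u : E τ τ')
    (k : ℕ) : HasSum (fun p : ℤ × ℤ => (4 * (p.2 : ℝ) ^ 2) ^ k *
      (weight2 τ τ' p * ‖uhat u p‖ ^ 2)) (nsq (wordAct (List.replicate k (0, rotJ)) u)) := by
  convert hasSum_nsq hτ hτ' (wordAct (List.replicate k (0, rotJ)) u) using 1
  ext p
  have h : uhat (wordAct (List.replicate k (0, rotJ)) u) p =
      (2 * p.2 * Complex.I) ^ k * uhat u p := by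
    induction k with
    | zero => simp [wordAct]
    | succ k ih => rw [List.replicate_succ, wordAct_cons, uhat_rot_right, ih]; ring
  rw [h, norm_mul, norm_pow, norm_mul, norm_mul, Complex.norm_I, Complex.norm_ofNat,
    Complex.norm_intCast, mul_one, ← sq_abs (p.2 : ℝ)]
  rw [show 4 * |(p.2 : ℝ)| ^ 2 = (2 * |(p.2 : ℝ)|) ^ 2 by ring]
  generalize 2 * |(p.2 : ℝ)| = a
  ring

theorem add_add_pow_le {x y z : ℝ} (hx : 0 ≤ x) (hy : 0 ≤ y) (hz : 0 ≤ z) (l : ℕ) :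
    (x + y + z) ^ l ≤ 3 ^ l * (x ^ l + y ^ l + z ^ l) := by
  have h1 : x + y + z ≤ 3 * max x (max y z) := by
    have h1 := le_max_left x (max y z)
    have h2 := (le_max_left y z).trans (le_max_right x (max y z))
    have h3 := (le_max_right y z).trans (le_max_right x (max y z))
    linarith
  refine (pow_le_pow_left₀ (by positivity) h1 l).trans ?_
  rw [mul_pow]
  refine mul_le_mul_of_nonneg_left ?_ (by positivity)
  have hx' := pow_nonneg hx l
  have hy' := pow_nonneg hy l
  have hz' := pow_nonneg hz l
  rcases max_choice x (max y z) with h | h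
  · rw [h]; linarith
  · rcases max_choice y z with h' | h' <;> rw [h, h'] <;> linarith

/-- The Sobolev norm controls the weighted sum of the squares of the Fourier coefficients with
weights `(T² + m² + n²)^l`, because powers of the rotations are combinations of monomials. -/
theorem exists_sum_uhat_le_sobQ (l : ℕ) : ∃ C : ℝ, 0 ≤ C ∧ ∀ (τ τ' : ℂ),
    IsUnitaryParam τ → IsUnitaryParam τ' → ∀ (T : ℝ), 1 ≤ T → ∀ (u : E τ τ')
      (F : Finset (ℤ × ℤ)),
      ∑ p ∈ F, (T ^ 2 + (p.1 : ℝ) ^ 2 + (p.2 : ℝ) ^ 2) ^ l * (weight2 τ τ' p * ‖uhat u p‖ ^ 2) ≤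
        C * sobQ b l T u := by
  let A : ℝ := ∑ j, (|b.repr (rotJ, 0) j| + |b.repr (0, rotJ) j|)
  have hA : ∀ j, |b.repr (rotJ, 0) j| ≤ A ∧ |b.repr (0, rotJ) j| ≤ A := by
    intro j
    have : |b.repr (rotJ, 0) j| + |b.repr (0, rotJ) j| ≤ A :=
      Finset.single_le_sum (f := fun j => |b.repr (rotJ, 0) j| + |b.repr (0, rotJ) j|)
        (fun j _ => by positivity) (Finset.mem_univ j)
    constructor <;> linarith [abs_nonneg (b.repr (rotJ, 0) j), abs_nonneg (b.repr (0, rotJ) j)]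
  obtain ⟨C, hC0, hC⟩ := exists_nsq_wordAct_le b l A
  refine ⟨3 ^ l * (1 + C + C), by positivity, fun τ τ' hτ hτ' T hT u F => ?_⟩
  have hw : ∀ p, 0 ≤ weight2 τ τ' p * ‖uhat u p‖ ^ 2 := fun p =>
    mul_nonneg (weight2_pos hτ hτ' p).le (by positivity)
  have h0 : ∑ p ∈ F, weight2 τ τ' p * ‖uhat u p‖ ^ 2 ≤ nsq u :=
    sum_le_hasSum F (fun p _ => hw p) (hasSum_nsq hτ hτ' u)
  have h1 := sum_le_hasSum F (fun p _ => mul_nonneg (by positivity) (hw p))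
    (nsq_replicate_rot_left hτ hτ' u l)
  have h2 := sum_le_hasSum F (fun p _ => mul_nonneg (by positivity) (hw p))
    (nsq_replicate_rot_right hτ hτ' u l)
  have hS := sum_nsq_mono_le_sobQ b hτ hτ' (le_refl l) hT u
  simp only [Nat.sub_self, mul_zero, pow_zero, one_mul] at hS
  have h3 := (hC τ τ' hτ hτ' (List.replicate l (rotJ, 0)) (by simp) (fun Z hZ j => by
    rw [List.eq_of_mem_replicate hZ]; exact (hA j).1) u).trans
    (mul_le_mul_of_nonneg_left hS hC0)
  have h4 := (hC τ τ' hτ hτ' (List.replicate l (0, rotJ)) (by simp) (fun Z hZ j => by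
    rw [List.eq_of_mem_replicate hZ]; exact (hA j).2) u).trans
    (mul_le_mul_of_nonneg_left hS hC0)
  have h5 : T ^ (2 * l) * nsq u ≤ sobQ b l T u := by
    have h := sum_nsq_mono_le_sobQ b hτ hτ' (Nat.zero_le l) hT u
    refine le_trans ?_ h
    rw [Nat.sub_zero]
    refine mul_le_mul_of_nonneg_left ?_ (by positivity)
    conv_lhs => rw [← mono_zero b u]
    exact Finset.single_le_sum (f := fun n => nsq (mono b n u))
      (fun n _ => nsq_nonneg hτ hτ' _) (by simp [mem_multiIndices])
  calc ∑ p ∈ F, (T ^ 2 + (p.1 : ℝ) ^ 2 + (p.2 : ℝ) ^ 2) ^ l * (weight2 τ τ' p * ‖uhat u p‖ ^ 2)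
      ≤ ∑ p ∈ F, 3 ^ l * (T ^ (2 * l) * (weight2 τ τ' p * ‖uhat u p‖ ^ 2) +
        (4 * (p.1 : ℝ) ^ 2) ^ l * (weight2 τ τ' p * ‖uhat u p‖ ^ 2) +
        (4 * (p.2 : ℝ) ^ 2) ^ l * (weight2 τ τ' p * ‖uhat u p‖ ^ 2)) := by
        refine Finset.sum_le_sum fun p _ => ?_
        have h6 : (T ^ 2 + (p.1 : ℝ) ^ 2 + (p.2 : ℝ) ^ 2) ^ l ≤
            3 ^ l * ((T ^ 2) ^ l + (4 * (p.1 : ℝ) ^ 2) ^ l + (4 * (p.2 : ℝ) ^ 2) ^ l) := by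
          refine le_trans (pow_le_pow_left₀ (by positivity) ?_ l)
            (add_add_pow_le (by positivity) (by positivity) (by positivity) l)
          nlinarith [sq_nonneg (p.1 : ℝ), sq_nonneg (p.2 : ℝ)]
        rw [pow_mul T]
        linarith [mul_le_mul_of_nonneg_right h6 (hw p)]
    _ ≤ 3 ^ l * (sobQ b l T u + C * sobQ b l T u + C * sobQ b l T u) := by
        rw [← Finset.mul_sum, Finset.sum_add_distrib, Finset.sum_add_distrib, ← Finset.mul_sum]
        have h6 := mul_le_mul_of_nonneg_left h0 (show 0 ≤ T ^ (2 * l) by positivity)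
        refine mul_le_mul_of_nonneg_left ?_ (by positivity)
        linarith
    _ = _ := by ring

theorem sobQ_pos {l : ℕ} {T : ℝ} (hT : 1 ≤ T) (hτ : IsUnitaryParam τ) (hτ' : IsUnitaryParam τ')
    {u : E τ τ'} (hu : u ≠ 0) : 0 < sobQ b l T u := by
  have h := sum_nsq_mono_le_sobQ b hτ hτ' (Nat.zero_le l) hT u
  refine lt_of_lt_of_le (mul_pos (by positivity) ?_) h
  refine lt_of_lt_of_le (nsq_pos hτ hτ' hu) ?_
  conv_lhs => rw [← mono_zero b u]
  exact Finset.single_le_sum (f := fun n => nsq (mono b n u))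
    (fun n _ => nsq_nonneg hτ hτ' _) (by simp [mem_multiIndices])

/-- Translating a vector by an element of `G × G` which preserves the invariant norm multiplies
the Sobolev norm by at most a constant depending on the adjoint action of the element only. -/
theorem exists_sobQ_repE_le (l : ℕ) (A : ℝ) : ∃ C : ℝ, 0 ≤ C ∧ ∀ (τ τ' : ℂ),
    IsUnitaryParam τ → IsUnitaryParam τ' → ∀ g g' : GL (Fin 2) ℝ,
      (∀ i j, |b.repr (adInv g (b i).1, adInv g' (b i).2) j| ≤ A) →
      (∀ u : E τ τ', nsq (repE g g' u) = nsq u) → ∀ (T : ℝ), 1 ≤ T → ∀ u : E τ τ',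
      sobQ b l T (repE g g' u) ≤ C * sobQ b l T u := by
  choose C hC0 hC using fun k => exists_nsq_wordAct_le b k A
  let N : ℝ := ∑ k ∈ Finset.range (l + 1),
    ∑ n ∈ Finset.piAntidiag (Finset.univ : Finset (Fin 6)) k, C k
  refine ⟨N, Finset.sum_nonneg fun k _ => Finset.sum_nonneg fun n _ => hC0 k,
    fun τ τ' hτ hτ' g g' hA hinv T hT u => ?_⟩
  have hcomm : ∀ L : List (lieG × lieG), wordAct L (repE g g' u) =
      repE g g' (wordAct (L.map fun Z => (adInv g Z.1, adInv g' Z.2)) u) := by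
    intro L
    induction L with
    | nil => simp [wordAct]
    | cons Z L ih => rw [wordAct_cons, ih, actE_repE, List.map_cons, wordAct_cons]
  rw [sobQ, Finset.sum_mul]
  refine Finset.sum_le_sum fun k hk => ?_
  rw [Finset.sum_mul]
  refine Finset.sum_le_sum fun n hn => ?_
  have hkl : k ≤ l := Nat.lt_succ_iff.mp (Finset.mem_range.mp hk)
  rw [Finset.mem_piAntidiag] at hn
  rw [mono, hcomm, hinv]
  have h := hC k τ τ' hτ hτ' (((sortedWord n).map b).map fun Z => (adInv g Z.1, adInv g' Z.2))
    (by simp [length_sortedWord, hn.1]) (by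
      intro Z hZ j
      rw [List.map_map, List.mem_map] at hZ
      obtain ⟨i, -, rfl⟩ := hZ
      exact hA i j) u
  calc _ ≤ T ^ (2 * (l - k)) * (C k * ∑ n ∈ multiIndices k, nsq (mono b n u)) :=
        mul_le_mul_of_nonneg_left h (by positivity)
    _ = C k * (T ^ (2 * (l - k)) * ∑ n ∈ multiIndices k, nsq (mono b n u)) := by ring
    _ ≤ _ := mul_le_mul_of_nonneg_left (sum_nsq_mono_le_sobQ b hτ hτ' hkl hT u) (hC0 k)

/-- A linear functional on the Lie algebra is bounded in terms of the matrix entries. -/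
theorem exists_functional_bound (f : lieG × lieG →ₗ[ℝ] ℝ) : ∃ K : ℝ, 0 ≤ K ∧
    ∀ (Z : lieG × lieG) (A : ℝ), 0 ≤ A →
      (∀ i j, |(Z.1 : Matrix (Fin 2) (Fin 2) ℝ) i j| ≤ A) →
      (∀ i j, |(Z.2 : Matrix (Fin 2) (Fin 2) ℝ) i j| ≤ A) → |f Z| ≤ K * A := by
  let L : lieG × lieG →ₗ[ℝ] (Fin 2 → Fin 2 → ℝ) × (Fin 2 → Fin 2 → ℝ) :=
    { toFun := fun Z => ((Z.1 : Matrix (Fin 2) (Fin 2) ℝ), (Z.2 : Matrix (Fin 2) (Fin 2) ℝ))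
      map_add' := fun _ _ => rfl
      map_smul' := fun _ _ => rfl }
  have hL : LinearMap.ker L = ⊥ := by
    rw [LinearMap.ker_eq_bot]
    intro Z W h
    exact Prod.ext (Subtype.ext (congrArg Prod.fst h)) (Subtype.ext (congrArg Prod.snd h))
  obtain ⟨g, hg⟩ := L.exists_leftInverse_of_injective hL
  let F : (Fin 2 → Fin 2 → ℝ) × (Fin 2 → Fin 2 → ℝ) →L[ℝ] ℝ :=
    LinearMap.toContinuousLinearMap (f.comp g)
  refine ⟨‖F‖, norm_nonneg _, fun Z A hA h1 h2 => ?_⟩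
  have hfZ : f Z = F (L Z) := by
    change f Z = f (g (L Z))
    rw [show g (L Z) = Z from LinearMap.congr_fun hg Z]
  rw [hfZ, ← Real.norm_eq_abs]
  refine (F.le_opNorm _).trans (mul_le_mul_of_nonneg_left ?_ (norm_nonneg _))
  rw [Prod.norm_def, max_le_iff]
  constructor
  · exact (pi_norm_le_iff_of_nonneg hA).mpr fun i => (pi_norm_le_iff_of_nonneg hA).mpr fun j =>
      h1 i j
  · exact (pi_norm_le_iff_of_nonneg hA).mpr fun i => (pi_norm_le_iff_of_nonneg hA).mpr fun j =>
      h2 i j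

/-- The elements of `GL(2, ℝ)` whose entries and whose inverse's entries are at most `R`. -/
def bddGL (R : ℝ) : Set (GL (Fin 2) ℝ) :=
  {g | (∀ i j, |(g : Matrix (Fin 2) (Fin 2) ℝ) i j| ≤ R) ∧
    ∀ i j, |((g⁻¹ : GL (Fin 2) ℝ) : Matrix (Fin 2) (Fin 2) ℝ) i j| ≤ R}

theorem abs_mul_apply_le {M N : Matrix (Fin 2) (Fin 2) ℝ} {A B : ℝ} (hM : ∀ i j, |M i j| ≤ A)
    (hN : ∀ i j, |N i j| ≤ B) (i j : Fin 2) : |(M * N) i j| ≤ 2 * (A * B) := by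
  rw [Matrix.mul_apply, Fin.sum_univ_two]
  have hA : 0 ≤ A := (abs_nonneg _).trans (hM i 0)
  have h1 := mul_le_mul (hM i 0) (hN 0 j) (abs_nonneg _) hA
  have h2 := mul_le_mul (hM i 1) (hN 1 j) (abs_nonneg _) hA
  rw [← abs_mul] at h1 h2
  exact (abs_add_le _ _).trans (by linarith)

theorem exists_adInv_bound (R : ℝ) : ∃ A : ℝ, ∀ g ∈ bddGL R, ∀ g' ∈ bddGL R, ∀ i j,
    |b.repr (adInv g (b i).1, adInv g' (b i).2) j| ≤ A := by
  choose K hK0 hK using fun j => exists_functional_bound (b.coord j)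
  let M : Fin 6 → ℝ := fun i => ∑ p : Fin 2 × Fin 2,
    (|((b i).1 : Matrix (Fin 2) (Fin 2) ℝ) p.1 p.2| +
      |((b i).2 : Matrix (Fin 2) (Fin 2) ℝ) p.1 p.2|)
  have hM0 : ∀ i, 0 ≤ M i := fun i => Finset.sum_nonneg fun p _ => by positivity
  have hM : ∀ i p q, |((b i).1 : Matrix (Fin 2) (Fin 2) ℝ) p q| ≤ M i ∧
      |((b i).2 : Matrix (Fin 2) (Fin 2) ℝ) p q| ≤ M i := by
    intro i p q
    have : |((b i).1 : Matrix (Fin 2) (Fin 2) ℝ) p q| +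
        |((b i).2 : Matrix (Fin 2) (Fin 2) ℝ) p q| ≤ M i :=
      Finset.single_le_sum (f := fun p : Fin 2 × Fin 2 =>
        |((b i).1 : Matrix (Fin 2) (Fin 2) ℝ) p.1 p.2| +
          |((b i).2 : Matrix (Fin 2) (Fin 2) ℝ) p.1 p.2|)
        (fun p _ => by positivity) (Finset.mem_univ (p, q))
    constructor <;> linarith [abs_nonneg (((b i).1 : Matrix (Fin 2) (Fin 2) ℝ) p q),
      abs_nonneg (((b i).2 : Matrix (Fin 2) (Fin 2) ℝ) p q)]
  let A : Fin 6 → Fin 6 → ℝ := fun i j => K j * (2 * (2 * (R * M i) * R))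
  refine ⟨∑ i, ∑ j, |A i j|, fun g hg g' hg' i j => ?_⟩
  have hR : 0 ≤ R := (abs_nonneg _).trans (hg.1 0 0)
  have h1 := hK j (adInv g (b i).1, adInv g' (b i).2) (2 * (2 * (R * M i) * R))
    (by have := hM0 i; positivity)
    (abs_mul_apply_le (abs_mul_apply_le hg.2 fun p q => (hM i p q).1) hg.1)
    (abs_mul_apply_le (abs_mul_apply_le hg'.2 fun p q => (hM i p q).2) hg'.1)
  rw [Module.Basis.coord_apply] at h1
  refine h1.trans ((le_abs_self (A i j)).trans ?_)
  refine (Finset.single_le_sum (f := fun j => |A i j|) (fun j _ => abs_nonneg _)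
    (Finset.mem_univ j)).trans ?_
  exact Finset.single_le_sum (f := fun i => ∑ j, |A i j|)
    (fun i _ => Finset.sum_nonneg fun j _ => abs_nonneg _) (Finset.mem_univ i)

/-! ### The automorphic space -/

section Automorphic

variable {Γ : Subgroup G}

theorem continuous_toG : Continuous toG := continuous_coinduced_rng

theorem X.continuous_mk : Continuous (X.mk Γ) := continuous_coinduced_rng

/-- The projection `GL(2, ℝ) → Γ \ G`. -/
def proj (Γ : Subgroup G) (g : GL (Fin 2) ℝ) : X Γ := X.mk Γ (toG g)

theorem continuous_proj : Continuous (proj Γ) := X.continuous_mk.comp continuous_toG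

theorem proj_surjective : Function.Surjective (proj Γ) :=
  (Quotient.mk_surjective (s := QuotientGroup.rightRel Γ)).comp
    Matrix.ProjGenLinGroup.mk_surjective

theorem isOpen_iff_proj {U : Set (X Γ)} : IsOpen U ↔ IsOpen (proj Γ ⁻¹' U) := by
  have h1 : IsOpen U ↔ IsOpen (X.mk Γ ⁻¹' U) := isOpen_coinduced
  have h2 : IsOpen (X.mk Γ ⁻¹' U) ↔ IsOpen (toG ⁻¹' (X.mk Γ ⁻¹' U)) := isOpen_coinduced
  rw [h1, h2]; rfl

theorem continuous_iff_proj {Y : Type*} [TopologicalSpace Y] {f : X Γ → Y} :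
    Continuous f ↔ Continuous (f ∘ proj Γ) := by
  simp_rw [continuous_def]
  refine forall₂_congr fun s _ => ?_
  rw [isOpen_iff_proj]; rfl

theorem proj_eq_proj {g h : GL (Fin 2) ℝ} : proj Γ g = proj Γ h ↔ toG (h * g⁻¹) ∈ Γ := by
  have h1 : proj Γ g = proj Γ h ↔ (QuotientGroup.rightRel Γ) (toG g) (toG h) := Quotient.eq
  rw [h1, QuotientGroup.rightRel_apply, map_mul, map_inv]

theorem mulRight_proj (g h : GL (Fin 2) ℝ) : X.mulRight (toG g) (proj Γ h) = proj Γ (h * g) := by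
  rw [proj, proj, map_mul]; rfl

theorem continuous_mulRight (g : GL (Fin 2) ℝ) : Continuous (X.mulRight (Γ := Γ) (toG g)) := by
  rw [continuous_iff_proj]
  have : X.mulRight (Γ := Γ) (toG g) ∘ proj Γ = fun h => proj Γ (h * g) :=
    funext fun h => mulRight_proj g h
  rw [this]
  exact continuous_proj.comp (continuous_id.mul continuous_const)

theorem mulRight_mulRight (g h : GL (Fin 2) ℝ) (x : X Γ) :
    X.mulRight (toG h) (X.mulRight (toG g) x) = X.mulRight (toG (g * h)) x := by
  obtain ⟨k, rfl⟩ := proj_surjective x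
  simp only [mulRight_proj, mul_assoc]

theorem mulRight_one (x : X Γ) : X.mulRight (toG 1) x = x := by
  obtain ⟨k, rfl⟩ := proj_surjective x
  rw [mulRight_proj, mul_one]

/-- Right translation by a group element as a homeomorphism of `X`. -/
def mulRightHomeo (g : GL (Fin 2) ℝ) : X Γ ≃ₜ X Γ where
  toFun := X.mulRight (toG g)
  invFun := X.mulRight (toG g⁻¹)
  left_inv x := by rw [mulRight_mulRight, mul_inv_cancel, mulRight_one]
  right_inv x := by rw [mulRight_mulRight, inv_mul_cancel, mulRight_one]
  continuous_toFun := continuous_mulRight g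
  continuous_invFun := continuous_mulRight g⁻¹

theorem integral_mulRight {μ : Measure (X Γ)} (hμ : IsInvariantProbability μ) (g : GL (Fin 2) ℝ)
    (F : X Γ → ℂ) : ∫ x, F (X.mulRight (toG g) x) ∂μ = ∫ x, F x ∂μ := by
  have h := (mulRightHomeo (Γ := Γ) g).measurableEmbedding.integral_map (μ := μ) F
  change ∫ y, F y ∂(μ.map (X.mulRight (toG g))) = _ at h
  rw [hμ.map_mulRight] at h
  exact h.symm

theorem IsSmooth.continuous {F : X Γ → ℂ} (hF : IsSmooth F) : Continuous F := by
  rw [continuous_iff_proj]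
  have hval : Continuous fun g : GL (Fin 2) ℝ => (g : Matrix (Fin 2) (Fin 2) ℝ) :=
    Units.continuous_val
  have h : Continuous fun g : GL (Fin 2) ℝ =>
      (if h : (Matrix.of fun i j => (g : Matrix (Fin 2) (Fin 2) ℝ) i j).det ≠ 0 then
        F (X.mk Γ (toG (Matrix.GeneralLinearGroup.mkOfDetNeZero
          (Matrix.of fun i j => (g : Matrix (Fin 2) (Fin 2) ℝ) i j) h))) else 0) := by
    refine hF.continuousOn.comp_continuous
      (f := fun g : GL (Fin 2) ℝ => fun i j => (g : Matrix (Fin 2) (Fin 2) ℝ) i j)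
      hval fun g => ?_
    exact ((Matrix.isUnit_iff_isUnit_det _).mp g.isUnit).ne_zero
  convert h using 1
  ext g
  have hdet : (Matrix.of fun i j => (g : Matrix (Fin 2) (Fin 2) ℝ) i j).det ≠ 0 :=
    ((Matrix.isUnit_iff_isUnit_det _).mp g.isUnit).ne_zero
  rw [dif_pos hdet]
  have : Matrix.GeneralLinearGroup.mkOfDetNeZero
      (Matrix.of fun i j => (g : Matrix (Fin 2) (Fin 2) ℝ) i j) hdet = g := Units.ext rfl
  rw [this]; rfl

theorem inv_mem_bddGL {R : ℝ} {g : GL (Fin 2) ℝ} (hg : g ∈ bddGL R) : g⁻¹ ∈ bddGL R :=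
  ⟨hg.2, by rw [inv_inv]; exact hg.1⟩

theorem mul_mem_bddGL {R : ℝ} {g h : GL (Fin 2) ℝ} (hg : g ∈ bddGL R) (hh : h ∈ bddGL R) :
    g * h ∈ bddGL (2 * (R * R)) :=
  ⟨abs_mul_apply_le hg.1 hh.1, by rw [mul_inv_rev]; exact abs_mul_apply_le hh.2 hg.2⟩

/-- By cocompactness a bounded set of group elements moves any point of `X` to any other one. -/
theorem exists_bddGL_transitive (hcomp : CompactSpace (X Γ)) :
    ∃ R : ℝ, ∀ x y : X Γ, ∃ g ∈ bddGL R, x = X.mulRight (toG g) y := by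
  let S : ℕ → Set (GL (Fin 2) ℝ) := fun n =>
    {g | (∀ i j, |(g : Matrix (Fin 2) (Fin 2) ℝ) i j| < n) ∧
      ∀ i j, |((g⁻¹ : GL (Fin 2) ℝ) : Matrix (Fin 2) (Fin 2) ℝ) i j| < n}
  have hSo : ∀ n, IsOpen (S n) := by
    intro n
    have h1 : Continuous fun g : GL (Fin 2) ℝ => (g : Matrix (Fin 2) (Fin 2) ℝ) :=
      Units.continuous_val
    have h2 : Continuous fun g : GL (Fin 2) ℝ =>
        ((g⁻¹ : GL (Fin 2) ℝ) : Matrix (Fin 2) (Fin 2) ℝ) := h1.comp continuous_inv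
    simp only [S, Set.ofPred_and, Set.ofPred_forall]
    refine IsOpen.inter ?_ ?_ <;> refine isOpen_iInter_of_finite fun i =>
      isOpen_iInter_of_finite fun j => isOpen_lt ?_ continuous_const
    · exact (h1.matrix_elem i j).abs
    · exact (h2.matrix_elem i j).abs
  have hUo : ∀ n, IsOpen (proj Γ '' S n) := by
    intro n
    rw [isOpen_iff_proj]
    have : proj Γ ⁻¹' (proj Γ '' S n) =
        ⋃ γ ∈ {γ : GL (Fin 2) ℝ | toG γ ∈ Γ}, (fun h => γ⁻¹ * h) ⁻¹' S n := by
      ext h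
      simp only [Set.mem_preimage, Set.mem_image, Set.mem_iUnion, Set.mem_ofPred_eq, exists_prop]
      constructor
      · rintro ⟨g, hg, hgh⟩
        refine ⟨h * g⁻¹, proj_eq_proj.mp hgh, ?_⟩
        simpa using hg
      · rintro ⟨γ, hγ, hg⟩
        refine ⟨γ⁻¹ * h, hg, proj_eq_proj.mpr ?_⟩
        simpa using hγ
    rw [this]
    exact isOpen_biUnion fun γ _ => (hSo n).preimage (continuous_const.mul continuous_id)
  -- the images of the bounded open sets `S n` form an increasing open cover of the compact space `X`
  have hmono : Monotone S := fun n m hnm g hg => by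
    have hc : (n : ℝ) ≤ m := by exact_mod_cast hnm
    exact ⟨fun i j => (hg.1 i j).trans_le hc, fun i j => (hg.2 i j).trans_le hc⟩
  obtain ⟨n, hn⟩ := isCompact_univ.elim_directed_cover (fun n => proj Γ '' S n) hUo
    (fun x _ => by
      obtain ⟨g, rfl⟩ := proj_surjective x
      obtain ⟨n, hn⟩ := exists_nat_gt (∑ i, ∑ j, (|(g : Matrix (Fin 2) (Fin 2) ℝ) i j| +
        |((g⁻¹ : GL (Fin 2) ℝ) : Matrix (Fin 2) (Fin 2) ℝ) i j|))
      refine Set.mem_iUnion.mpr ⟨n, g, ?_, rfl⟩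
      have hle : ∀ i j, |(g : Matrix (Fin 2) (Fin 2) ℝ) i j| +
          |((g⁻¹ : GL (Fin 2) ℝ) : Matrix (Fin 2) (Fin 2) ℝ) i j| < n := by
        intro i j
        refine lt_of_le_of_lt ?_ hn
        refine (Finset.single_le_sum (f := fun j => |(g : Matrix (Fin 2) (Fin 2) ℝ) i j| +
          |((g⁻¹ : GL (Fin 2) ℝ) : Matrix (Fin 2) (Fin 2) ℝ) i j|) (fun j _ => by positivity)
          (Finset.mem_univ j)).trans ?_
        exact Finset.single_le_sum (f := fun i => ∑ j, (|(g : Matrix (Fin 2) (Fin 2) ℝ) i j| +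
          |((g⁻¹ : GL (Fin 2) ℝ) : Matrix (Fin 2) (Fin 2) ℝ) i j|))
          (fun i _ => Finset.sum_nonneg fun j _ => by positivity) (Finset.mem_univ i)
      exact ⟨fun i j => lt_of_le_of_lt (le_add_of_nonneg_right (abs_nonneg _)) (hle i j),
        fun i j => lt_of_le_of_lt (le_add_of_nonneg_left (abs_nonneg _)) (hle i j)⟩)
    (directed_of_isDirected_le fun n m h => Set.image_mono (hmono h))
  have hb : ∀ g ∈ S n, g ∈ bddGL (n : ℝ) := fun g hg =>
    ⟨fun i j => (hg.1 i j).le, fun i j => (hg.2 i j).le⟩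
  refine ⟨2 * (n * n), fun x y => ?_⟩
  obtain ⟨g, hg, rfl⟩ := hn (Set.mem_univ x)
  obtain ⟨h, hh, rfl⟩ := hn (Set.mem_univ y)
  refine ⟨h⁻¹ * g, mul_mem_bddGL (inv_mem_bddGL (hb h hh)) (hb g hg), ?_⟩
  rw [mulRight_proj, mul_inv_cancel_left]

/-! ### Invariance of the scalar product -/

theorem formV_rep {μ : Measure (X Γ)} (hμ : IsInvariantProbability μ)
    {ν : V τ →ₗ[ℂ] (X Γ → ℂ)} (hν : IsEnhancement μ τ ν) (g : GL (Fin 2) ℝ) (f h : V τ) :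
    formV τ (rep τ g f) (rep τ g h) = formV τ f h := by
  rw [← hν.isometric, ← hν.isometric]
  simp_rw [hν.equivariant]
  exact integral_mulRight hμ g fun x => ν f x * conj (ν h x)

/-- For fixed first variable a vector of `E` is a vector of `V_τ'` in the second variable. -/
def slice₂ (u : E τ τ') (s : Plane) : V τ' :=
  ⟨fun s' => (u : Plane × Plane → ℂ) (s, s'), by
    by_cases hs : s = 0
    · have h : (fun s' => (u : Plane × Plane → ℂ) (s, s')) = 0 :=
        funext fun s' => E.eq_zero u fun h => h.1 hs
      rw [h]
      exact Submodule.zero_mem _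
    · refine ⟨?_, E.eq_zero u fun h => h.2 rfl, fun a s' ha hs' => ?_⟩
      · exact (E.contDiffOn u).comp (contDiff_const.prodMk contDiff_id).contDiffOn
          fun s' hs' => ⟨hs, hs'⟩
      · simpa using E.homogeneous u (a := 1) one_ne_zero ha hs hs'⟩

theorem slice_coe (u : E τ τ') (s s' : Plane) :
    (slice u s' : Plane → ℂ) s = (u : Plane × Plane → ℂ) (s, s') := rfl

theorem slice₂_coe (u : E τ τ') (s s' : Plane) :
    (slice₂ u s : Plane → ℂ) s' = (u : Plane × Plane → ℂ) (s, s') := rfl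

theorem integrable_formE (hτ : IsUnitaryParam τ) (hτ' : IsUnitaryParam τ') (u v : E τ τ') :
    Integrable (fun r : (ℝ × ℝ) × (ℝ × ℝ) => (u : Plane × Plane → ℂ) (circ r.1.1, circ r.2.1) *
      conj ((v : Plane × Plane → ℂ) (circ r.1.2, circ r.2.2)))
      ((pairMeasure τ).prod (pairMeasure τ')) := by
  obtain ⟨hP, -, -⟩ := pairMeasure_spec hτ
  obtain ⟨hP', -, -⟩ := pairMeasure_spec hτ'
  obtain ⟨B, hB⟩ := torus_bounded u
  obtain ⟨B', hB'⟩ := torus_bounded v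
  refine Integrable.of_bound (C := B * B') (Continuous.aestronglyMeasurable ?_)
    (Filter.Eventually.of_forall fun r => ?_)
  · refine Continuous.mul ?_ (Complex.continuous_conj.comp ?_)
    · exact (continuous_torus u).comp
        (f := fun r : (ℝ × ℝ) × (ℝ × ℝ) => (r.1.1, r.2.1)) (by fun_prop)
    · exact (continuous_torus v).comp
        (f := fun r : (ℝ × ℝ) × (ℝ × ℝ) => (r.1.2, r.2.2)) (by fun_prop)
  · rw [norm_mul, RCLike.norm_conj]
    exact mul_le_mul (hB _ _) (hB' _ _) (norm_nonneg _) ((norm_nonneg _).trans (hB 0 0))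

theorem formE_eq_integral_slice (hτ : IsUnitaryParam τ) (hτ' : IsUnitaryParam τ') (u v : E τ τ') :
    formE τ τ' u v = ∫ q, formV τ (slice u (circ q.1)) (slice v (circ q.2)) ∂(pairMeasure τ') := by
  obtain ⟨hP, -, -⟩ := pairMeasure_spec hτ
  obtain ⟨hP', -, -⟩ := pairMeasure_spec hτ'
  exact integral_prod_symm _ (integrable_formE hτ hτ' u v)

theorem formE_eq_integral_slice₂ (hτ : IsUnitaryParam τ) (hτ' : IsUnitaryParam τ')
    (u v : E τ τ') :
    formE τ τ' u v = ∫ q, formV τ' (slice₂ u (circ q.1)) (slice₂ v (circ q.2)) ∂(pairMeasure τ) := by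
  obtain ⟨hP, -, -⟩ := pairMeasure_spec hτ
  obtain ⟨hP', -, -⟩ := pairMeasure_spec hτ'
  exact integral_prod _ (integrable_formE hτ hτ' u v)

theorem detFactor_one (τ : ℂ) : detFactor τ 1 = 1 := by simp [detFactor]

theorem slice_repE_one (g : GL (Fin 2) ℝ) (u : E τ τ') (s' : Plane) :
    slice (repE g 1 u) s' = rep τ g (slice u s') := by
  ext s
  rw [slice_coe, repE_apply, detFactor_one, mul_one, invMap_apply]
  simp [rep, slice_coe, detFactor]

theorem slice₂_repE_one (g : GL (Fin 2) ℝ) (u : E τ τ') (s : Plane) :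
    slice₂ (repE 1 g u) s = rep τ' g (slice₂ u s) := by
  ext s'
  rw [slice₂_coe, repE_apply, detFactor_one, one_mul, invMap_apply]
  simp [rep, slice₂_coe, detFactor]

theorem repE_eq_comp (g g' : GL (Fin 2) ℝ) (u : E τ τ') :
    repE g g' u = repE g 1 (repE 1 g' u) := by
  ext p
  simp only [repE_apply, detFactor_one, invMap_apply]
  simp
  ring

/-- The norm of `E` is invariant under `G × G`; by Fubini this follows from the invariance of the
scalar products of the two factors, which holds because they embed isometrically into
`L²(X)`. -/
theorem nsq_repE {μ : Measure (X Γ)} (hμ : IsInvariantProbability μ) (hτ : IsUnitaryParam τ)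
    (hτ' : IsUnitaryParam τ') {ν : V τ →ₗ[ℂ] (X Γ → ℂ)} {ν' : V τ' →ₗ[ℂ] (X Γ → ℂ)}
    (hν : IsEnhancement μ τ ν) (hν' : IsEnhancement μ τ' ν') (g g' : GL (Fin 2) ℝ) (u : E τ τ') :
    nsq (repE g g' u) = nsq u := by
  have h1 : ∀ v : E τ τ', nsq (repE g 1 v) = nsq v := by
    intro v
    rw [nsq, nsq, formE_eq_integral_slice hτ hτ', formE_eq_integral_slice hτ hτ']
    simp_rw [slice_repE_one, formV_rep hμ hν]
  have h2 : nsq (repE 1 g' u) = nsq u := by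
    rw [nsq, nsq, formE_eq_integral_slice₂ hτ hτ', formE_eq_integral_slice₂ hτ hτ']
    simp_rw [slice₂_repE_one, formV_rep hμ hν']
  rw [repE_eq_comp, h1, h2]

end Automorphic

/-! ### Weight vectors and weight expansions in `V_τ` -/

/-- The complex coordinate of the plane. -/
def planeToC (s : Plane) : ℂ := s 0 + s 1 * Complex.I

theorem planeToC_ne_zero {s : Plane} (hs : s ≠ 0) : planeToC s ≠ 0 := by
  intro h
  apply hs
  have hre := congrArg Complex.re h
  have him := congrArg Complex.im h
  simp [planeToC] at hre him
  ext i; fin_cases i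
  · exact hre
  · exact him

theorem sq_add_sq_pos {s : Plane} (hs : s ≠ 0) : 0 < s 0 ^ 2 + s 1 ^ 2 := by
  by_contra h
  have h0 : s 0 ^ 2 = 0 := by linarith [sq_nonneg (s 0), sq_nonneg (s 1)]
  have h1 : s 1 ^ 2 = 0 := by linarith [sq_nonneg (s 0), sq_nonneg (s 1)]
  apply hs
  ext i; fin_cases i
  · exact pow_eq_zero_iff two_ne_zero |>.mp h0
  · exact pow_eq_zero_iff two_ne_zero |>.mp h1

theorem contDiff_coord (i : Fin 2) : ContDiff ℝ ∞ fun s : Plane => s i := contDiff_apply ℝ ℝ i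

theorem contDiff_planeToC : ContDiff ℝ ∞ planeToC :=
  (Complex.ofRealCLM.contDiff.comp (contDiff_coord 0)).add
    ((Complex.ofRealCLM.contDiff.comp (contDiff_coord 1)).mul contDiff_const)

theorem ofReal_abs_cpow {a : ℝ} (ha : a ≠ 0) (w : ℂ) :
    ((|a| : ℝ) : ℂ) ^ w = Complex.exp (Real.log |a| * w) := by
  rw [Complex.cpow_def_of_ne_zero (by simpa using ha), Complex.ofReal_log (abs_nonneg a)]

/-- The weight vector of `V_τ` which restricts to `wave m` on the unit circle:
`|s|^(τ-1) (z / \bar z)^m` in the complex coordinate `z` of `s`. -/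
def weightVec (τ : ℂ) (m : ℤ) : V τ :=
  ⟨fun s => if s = 0 then 0 else Complex.exp (Real.log (s 0 ^ 2 + s 1 ^ 2) * ((τ - 1) / 2)) *
    (planeToC s / conj (planeToC s)) ^ m, by
    refine ⟨?_, if_pos rfl, fun a s ha hs => ?_⟩
    · have h : ContDiffOn ℝ ∞ (fun s : Plane =>
          Complex.exp (Real.log (s 0 ^ 2 + s 1 ^ 2) * ((τ - 1) / 2)) *
            (planeToC s / conj (planeToC s)) ^ m) {s | s ≠ 0} := by
        intro s hs
        refine ContDiffAt.contDiffWithinAt ?_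
        refine ContDiffAt.mul ?_ ?_
        · refine ContDiffAt.cexp (ContDiffAt.mul ?_ contDiffAt_const)
          refine Complex.ofRealCLM.contDiff.contDiffAt.comp s (ContDiffAt.log ?_
            (sq_add_sq_pos hs).ne')
          exact (((contDiff_coord 0).pow 2).add ((contDiff_coord 1).pow 2)).contDiffAt
        · have hz := planeToC_ne_zero hs
          have hc : ContDiffAt ℝ ∞ (fun s => conj (planeToC s)) s :=
            (Complex.conjCLE.contDiff.comp contDiff_planeToC).contDiffAt
          have hq : ContDiffAt ℝ ∞ (fun s => planeToC s / conj (planeToC s)) s := by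
            simp only [div_eq_mul_inv]
            exact contDiff_planeToC.contDiffAt.mul (hc.inv (by simpa using hz))
          cases m with
          | ofNat k => simpa using hq.pow k
          | negSucc k =>
            simp only [zpow_negSucc]
            exact (hq.pow (k + 1)).inv (pow_ne_zero _ (div_ne_zero hz (by simpa using hz)))
      exact h.congr fun s hs => if_neg hs
    · have has : a • s ≠ 0 := smul_ne_zero ha hs
      simp only [if_neg has, if_neg hs]
      have h1 : planeToC (a • s) = a * planeToC s := by
        simp [planeToC]; ring
      have hac : (a : ℂ) ≠ 0 := by exact_mod_cast ha
      have h2 : planeToC (a • s) / conj (planeToC (a • s)) = planeToC s / conj (planeToC s) := by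
        rw [h1, map_mul, Complex.conj_ofReal, mul_div_mul_left _ _ hac]
      have h3 : Real.log ((a • s) 0 ^ 2 + (a • s) 1 ^ 2) =
          2 * Real.log |a| + Real.log (s 0 ^ 2 + s 1 ^ 2) := by
        have : (a • s) 0 ^ 2 + (a • s) 1 ^ 2 = |a| ^ 2 * (s 0 ^ 2 + s 1 ^ 2) := by
          simp only [Pi.smul_apply, smul_eq_mul, sq_abs]; ring
        rw [this, Real.log_mul (by positivity) (sq_add_sq_pos hs).ne', Real.log_pow]
        norm_num
      rw [h2, h3, ofReal_abs_cpow ha, ← mul_assoc, ← Complex.exp_add]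
      congr 2
      push_cast; ring⟩

theorem weightVec_circ (τ : ℂ) (m : ℤ) (θ : ℝ) :
    (weightVec τ m : Plane → ℂ) (circ θ) = wave m θ := by
  have h1 : planeToC (circ θ) = Complex.exp (θ * Complex.I) := by
    rw [Complex.exp_mul_I]; simp [planeToC, circ]
  have h2 : conj (Complex.exp (θ * Complex.I)) = Complex.exp (-(θ * Complex.I)) := by
    rw [← Complex.exp_conj]; simp
  have h3 : (circ θ) 0 ^ 2 + (circ θ) 1 ^ 2 = 1 := by simp [circ]
  change (if circ θ = 0 then 0 else _) = _
  rw [if_neg (circ_ne_zero θ), h3, h1, h2, ← Complex.exp_sub, ← Complex.exp_int_mul, wave]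
  simp only [Real.log_one, Complex.ofReal_zero, zero_mul, Complex.exp_zero, one_mul]
  congr 1; ring

theorem contDiff_V_circ (f : V τ) : ContDiff ℝ ∞ fun θ => (f : Plane → ℂ) (circ θ) :=
  f.2.1.comp_contDiff contDiff_circ circ_ne_zero

theorem V_circ_periodic (f : V τ) :
    Function.Periodic (fun θ => (f : Plane → ℂ) (circ θ)) Real.pi := by
  intro θ
  have := f.2.2.2 (-1) (circ θ) (by norm_num) (circ_ne_zero θ)
  rw [← circ_add_pi] at this
  simpa using this

theorem iteratedDeriv_wave (j : ℕ) (m : ℤ) :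
    iteratedDeriv j (wave m) = fun θ => (2 * m * Complex.I) ^ j * wave m θ := by
  induction j with
  | zero => simp
  | succ j ih =>
    rw [iteratedDeriv_succ, ih]
    ext θ
    rw [((hasDerivAt_wave m θ).const_mul _).deriv]
    ring

section Expansion

variable {Γ : Subgroup G} {μ : Measure (X Γ)} {ν : V τ →ₗ[ℂ] (X Γ → ℂ)}

/-- The image of a vector of `V_τ` is the sum of the images of its weight components: the partial
Fourier sums converge with all derivatives, and `ν` is continuous. -/
theorem hasSum_enhancement (hν : IsEnhancement μ τ ν) (f : V τ) (x : X Γ) :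
    HasSum (fun m => fcoef (fun θ => (f : Plane → ℂ) (circ θ)) m * ν (weightVec τ m) x)
      (ν f x) := by
  classical
  obtain ⟨k, C, hC⟩ := hν.continuous
  set F : ℝ → ℂ := fun θ => (f : Plane → ℂ) (circ θ) with hFdef
  have hF : ContDiff ℝ ∞ F := contDiff_V_circ f
  have hp : Function.Periodic F Real.pi := V_circ_periodic f
  have hle : ∀ j : ℕ, ((j : ℕ∞) : WithTop ℕ∞) ≤ ((⊤ : ℕ∞) : WithTop ℕ∞) := fun j =>
    WithTop.coe_le_coe.mpr le_top
  have hFj : ∀ j, ContDiff ℝ ∞ (iteratedDeriv j F) := fun j => by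
    rw [iteratedDeriv_eq_iterate]
    exact hF.iterate_deriv j
  have hs : ∀ j, Summable fun m => ‖fcoef (iteratedDeriv j F) m‖ := fun j =>
    (summable_fcoef_of_contDiff (hFj j) (periodic_iteratedDeriv hp j)).norm
  -- the tails of the Fourier series of the derivatives up to order `k` control `ν`
  let tail : ℕ → Finset ℤ → ℝ := fun j S => (∑' m, ‖fcoef (iteratedDeriv j F) m‖) -
    ∑ m ∈ S, ‖fcoef (iteratedDeriv j F) m‖
  have htail0 : ∀ j S, 0 ≤ tail j S := fun j S =>
    sub_nonneg.mpr ((hs j).sum_le_tsum S fun _ _ => norm_nonneg _)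
  have htail : ∀ j, Filter.Tendsto (tail j) Filter.atTop (nhds 0) := by
    intro j
    have := (hs j).hasSum.const_sub (∑' m, ‖fcoef (iteratedDeriv j F) m‖)
    rwa [sub_self] at this
  let B : Finset ℤ → ℝ := fun S => ∑ j ∈ Finset.range (k + 1), tail j S
  have hB : Filter.Tendsto B Filter.atTop (nhds 0) := by
    simpa using tendsto_finsetSum (Finset.range (k + 1)) fun j _ => htail j
  have hbound : ∀ S : Finset ℤ,
      ‖ν f x - ∑ m ∈ S, fcoef F m * ν (weightVec τ m) x‖ ≤ C * B S := by
    intro S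
    let g : V τ := f - ∑ m ∈ S, fcoef F m • weightVec τ m
    have hg : ν g x = ν f x - ∑ m ∈ S, fcoef F m * ν (weightVec τ m) x := by
      simp [g, map_sub, map_sum, Finset.sum_apply]
    rw [← hg]
    refine hC g (B S) (fun j hj θ => ?_) x
    have hgc : (fun t => (g : Plane → ℂ) (circ t)) = F - fun t => ∑ m ∈ S, fcoef F m * wave m t := by
      ext t
      simp [g, hFdef, weightVec_circ, Finset.sum_apply]
    have hcw : ∀ m ∈ S, ContDiffAt ℝ j (fun t => fcoef F m * wave m t) θ := fun m _ =>
      (contDiff_const.mul ((contDiff_wave m).of_le (hle j))).contDiffAt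
    rw [hgc, iteratedDeriv_sub (hF.of_le (hle j)).contDiffAt
      (ContDiffAt.sum hcw), iteratedDeriv_fun_sum hcw]
    have hterm : ∀ m ∈ S, iteratedDeriv j (fun t => fcoef F m * wave m t) θ =
        fcoef (iteratedDeriv j F) m * wave m θ := by
      intro m _
      rw [iteratedDeriv_const_mul_field, iteratedDeriv_wave, fcoef_iteratedDeriv hF hp]
      ring
    rw [Finset.sum_congr rfl hterm]
    have h1 := hasSum_fcoef (hFj j).continuous (periodic_iteratedDeriv hp j) (hs j).of_norm θ
    have h2 := (S.hasSum_compl_iff).mpr (by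
      rw [sub_add_cancel]; exact h1 : HasSum (fun m => fcoef (iteratedDeriv j F) m * wave m θ)
        ((iteratedDeriv j F θ - ∑ m ∈ S, fcoef (iteratedDeriv j F) m * wave m θ) +
          ∑ m ∈ S, fcoef (iteratedDeriv j F) m * wave m θ))
    have h3 : HasSum (fun m : {m // m ∉ S} => ‖fcoef (iteratedDeriv j F) m‖) (tail j S) := by
      refine (S.hasSum_compl_iff (f := fun m => ‖fcoef (iteratedDeriv j F) m‖)).mpr ?_
      simpa [tail] using (hs j).hasSum
    have h4 : ‖iteratedDeriv j F θ - ∑ m ∈ S, fcoef (iteratedDeriv j F) m * wave m θ‖ ≤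
        tail j S := by
      rw [← h2.tsum_eq]
      refine tsum_of_norm_bounded h3 fun m => ?_
      rw [norm_mul, norm_wave, mul_one]
    refine h4.trans ?_
    exact Finset.single_le_sum (f := fun j => tail j S) (fun j _ => htail0 j S)
      (Finset.mem_range.mpr (Nat.lt_succ_of_le hj))
  rw [HasSum]
  refine tendsto_iff_norm_sub_tendsto_zero.mpr ?_
  have hCB : Filter.Tendsto (fun S => C * B S) Filter.atTop (nhds 0) := by
    simpa using hB.const_mul C
  refine squeeze_zero (fun S => norm_nonneg _) (fun S => ?_) hCB
  rw [norm_sub_rev]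
  exact hbound S

theorem exists_growth_enhancement (hν : IsEnhancement μ τ ν) :
    ∃ (k : ℕ) (C : ℝ), 0 ≤ C ∧ ∀ m x, ‖ν (weightVec τ m) x‖ ≤ C * (1 + 4 * (m : ℝ) ^ 2) ^ k := by
  obtain ⟨k, C, hC⟩ := hν.continuous
  have h0 : ∀ m x, ‖ν (weightVec τ m) x‖ ≤ C * (1 + 4 * (m : ℝ) ^ 2) ^ k := by
    intro m x
    refine hC _ _ (fun j hj θ => ?_) x
    have : (fun t => (weightVec τ m : Plane → ℂ) (circ t)) = wave m :=
      funext fun t => weightVec_circ τ m t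
    rw [this, iteratedDeriv_wave, norm_mul, norm_wave, mul_one, norm_pow, norm_mul, norm_mul,
      Complex.norm_I, Complex.norm_ofNat, Complex.norm_intCast, mul_one]
    have h1 : 2 * |(m : ℝ)| ≤ 1 + 4 * (m : ℝ) ^ 2 := by
      rw [← sq_abs (m : ℝ)]
      nlinarith [sq_nonneg (2 * |(m : ℝ)| - 1), abs_nonneg (m : ℝ)]
    exact (pow_le_pow_left₀ (by positivity) h1 j).trans
      (pow_le_pow_right₀ (by nlinarith [sq_nonneg (m : ℝ)]) hj)
  refine ⟨k, |C|, abs_nonneg _, fun m x => (h0 m x).trans ?_⟩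
  exact mul_le_mul_of_nonneg_right (le_abs_self C) (by positivity)

/-- The Fourier coefficients in the first variable decay faster than any power, uniformly in the
second variable. -/
theorem exists_bound_fcoef_torus (u : E τ τ') (k : ℕ) : ∃ B : ℝ, ∀ (m : ℤ) (y : ℝ),
    ‖fcoef (fun x => torus u x y) m‖ * (1 + 4 * (m : ℝ) ^ 2) ^ k ≤ B := by
  -- `1 - ∂²/∂x²` multiplies the `m`-th coefficient by `1 + 4 m²`
  let D : E τ τ' → E τ τ' := fun v => v + (-1 : ℂ) • actE (rotJ, 0) (actE (rotJ, 0) v)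
  have hD : ∀ (k : ℕ) (m : ℤ) (y : ℝ), fcoef (fun x => torus (D^[k] u) x y) m =
      ((1 + 4 * (m : ℝ) ^ 2 : ℝ) : ℂ) ^ k * fcoef (fun x => torus u x y) m := by
    intro k m y
    induction k with
    | zero => simp
    | succ k ih =>
      rw [Function.iterate_succ_apply']
      have e : (fun x => torus (D (D^[k] u)) x y) = fun x => torus (D^[k] u) x y +
          (-1) * torus (actE (rotJ, 0) (actE (rotJ, 0) (D^[k] u))) x y := rfl
      have hc : Continuous fun x =>
          (-1 : ℂ) * torus (actE (rotJ, 0) (actE (rotJ, 0) (D^[k] u))) x y :=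
        continuous_const.mul (continuous_torus_left _ y)
      rw [e, fcoef_add (continuous_torus_left _ y) hc, fcoef_const_mul, fcoef_torus_rot,
        fcoef_torus_rot, ih]
      push_cast
      linear_combination (-(4 * (m : ℂ) ^ 2) * ((1 + 4 * (m : ℂ) ^ 2) ^ k *
        fcoef (fun x => torus u x y) m)) * Complex.I_sq
  obtain ⟨B, hB⟩ := torus_bounded (D^[k] u)
  refine ⟨B, fun m y => ?_⟩
  have h := norm_fcoef_le (fun x => hB x y) m
  rw [hD, norm_mul, norm_pow, Complex.norm_real, Real.norm_of_nonneg (by positivity)] at h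
  rwa [mul_comm]

/-- The Fourier coefficients of the function `s' ↦ ν(u(·, s'))(x)`: the weight expansion of `ν` is
integrated term by term against a character, the growth of `ν` on weight vectors being compensated
by the decay of the coefficients of `u`. -/
theorem hasSum_fcoef_enhancement_slice (hν : IsEnhancement μ τ ν) (u : E τ τ') (x : X Γ) (n : ℤ) :
    HasSum (fun m => uhat u (m, n) * ν (weightVec τ m) x)
      (fcoef (fun y => ν (slice u (circ y)) x) n) := by
  obtain ⟨k, C, hC0, hC⟩ := exists_growth_enhancement hν
  obtain ⟨B, hB⟩ := exists_bound_fcoef_torus u (k + 1)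
  have hB0 : 0 ≤ B := le_trans (by positivity) (hB 0 0)
  let f : ℤ → ℝ → ℂ := fun m y =>
    (fcoef (fun x => torus u x y) m * ν (weightVec τ m) x) * wave (-n) y
  have hf : ∀ m y, ‖f m y‖ ≤ (B * C) * (1 + (m : ℝ) ^ 2)⁻¹ := by
    intro m y
    have h1 := hB m y
    have h2 := hC m x
    rw [norm_mul, norm_wave, mul_one, norm_mul]
    have hpos : 0 < 1 + 4 * (m : ℝ) ^ 2 := by positivity
    have h3 : (1 + 4 * (m : ℝ) ^ 2)⁻¹ ≤ (1 + (m : ℝ) ^ 2)⁻¹ :=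
      inv_anti₀ (by positivity) (by nlinarith [sq_nonneg (m : ℝ)])
    refine le_trans ?_ (mul_le_mul_of_nonneg_left h3 (mul_nonneg hB0 hC0))
    rw [← div_eq_mul_inv, le_div_iff₀ hpos]
    calc _ ≤ ‖fcoef (fun x => torus u x y) m‖ * (C * (1 + 4 * (m : ℝ) ^ 2) ^ k) *
          (1 + 4 * (m : ℝ) ^ 2) := by gcongr
      _ = (‖fcoef (fun x => torus u x y) m‖ * (1 + 4 * (m : ℝ) ^ 2) ^ (k + 1)) * C := by ring
      _ ≤ B * C := mul_le_mul_of_nonneg_right h1 hC0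
  have hcont : ∀ m, Continuous (f m) := fun m =>
    ((continuous_fcoef_slice (continuous_torus u) m).mul continuous_const).mul (continuous_wave _)
  have hint : ∀ m, Integrable (f m) circleMeasure := fun m => integrable_circle (hcont m)
  have hmain := hasSum_integral_of_summable_integral_norm hint (by
    refine Summable.of_nonneg_of_le (fun m => integral_nonneg fun y => norm_nonneg _) (fun m => ?_)
      (summable_int_inv_one_add_sq.mul_left (B * C))
    have := norm_integral_le_of_norm_le_const (μ := circleMeasure) (f := fun y => ‖f m y‖)
      (Filter.Eventually.of_forall fun y => (norm_norm (f m y)).le.trans (hf m y))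
    rw [probReal_univ, mul_one] at this
    exact (Real.le_norm_self _).trans this)
  have hterm : ∀ m, ∫ y, f m y ∂circleMeasure = uhat u (m, n) * ν (weightVec τ m) x := by
    intro m
    simp only [f, uhat, fcoef2]
    rw [fcoef, ← integral_mul_const]
    congr 1; ext y; ring
  have hsum : ∀ y, ∑' m, f m y = ν (slice u (circ y)) x * wave (-n) y := fun y =>
    ((hasSum_enhancement hν (slice u (circ y)) x).mul_right (wave (-n) y)).tsum_eq
  simp_rw [hterm, hsum] at hmain
  exact hmain

end Expansion

/-! ### A lattice sum -/

theorem sum_range_inv_sq_add_sq_le {T : ℝ} (hT : 1 ≤ T) (N : ℕ) :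
    ∑ n ∈ Finset.range N, (T ^ 2 + (n : ℝ) ^ 2)⁻¹ ≤ 4 / T := by
  have h : ∑ n ∈ Finset.range N, (T ^ 2 + (n : ℝ) ^ 2)⁻¹ ≤
      2 * ((T - 1 / 2)⁻¹ - (T + N - 1 / 2)⁻¹) := by
    induction N with
    | zero => simp
    | succ N ih =>
      rw [Finset.sum_range_succ]
      have hN : (0 : ℝ) ≤ N := Nat.cast_nonneg N
      have h1 : 0 < T + N - 1 / 2 := by linarith
      have h2 : 0 < T + N + 1 / 2 := by linarith
      -- telescoping: `(T + N)⁻²` is at most the difference of the reciprocals of `T + N ± 1/2`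
      have h3 : (T ^ 2 + (N : ℝ) ^ 2)⁻¹ ≤ 2 * ((T + N - 1 / 2)⁻¹ - (T + N + 1 / 2)⁻¹) := by
        have e : 2 * ((T + N - 1 / 2)⁻¹ - (T + N + 1 / 2)⁻¹) =
            ((T + N - 1 / 2) * (T + N + 1 / 2) / 2)⁻¹ := by
          have e1 : (T + N - 1 / 2)⁻¹ - (T + N + 1 / 2)⁻¹ =
              ((T + N - 1 / 2) * (T + N + 1 / 2))⁻¹ := by
            rw [inv_sub_inv h1.ne' h2.ne', ← one_div]
            congr 1
            ring
          rw [e1, inv_div]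
          exact (div_eq_mul_inv _ _).symm
        rw [e]
        exact inv_anti₀ (by positivity) (by nlinarith [sq_nonneg (T - N)])
      push_cast
      rw [show T + ((N : ℝ) + 1) - 1 / 2 = T + N + 1 / 2 by ring]
      linarith
  refine h.trans ?_
  have hN : (0 : ℝ) ≤ N := Nat.cast_nonneg N
  have h1 : 0 < (T + N - 1 / 2)⁻¹ := inv_pos.mpr (by linarith)
  have h2 : 2 * (T - 1 / 2)⁻¹ ≤ 4 / T := by
    rw [← div_eq_mul_inv, div_le_div_iff₀ (by linarith) (by linarith)]
    linarith
  linarith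

theorem tsum_int_inv_sq_add_sq_le {T : ℝ} (hT : 1 ≤ T) :
    ∑' m : ℤ, ENNReal.ofReal (T ^ 2 + (m : ℝ) ^ 2)⁻¹ ≤ ENNReal.ofReal (8 / T) := by
  have h : ∀ N, ∑ n ∈ Finset.range N, ENNReal.ofReal (T ^ 2 + (n : ℝ) ^ 2)⁻¹ ≤
      ENNReal.ofReal (4 / T) := fun N => by
    rw [← ENNReal.ofReal_sum_of_nonneg fun n _ => by positivity]
    exact ENNReal.ofReal_le_ofReal (sum_range_inv_sq_add_sq_le hT N)
  have h1 : ∑' n : ℕ, ENNReal.ofReal (T ^ 2 + (n : ℝ) ^ 2)⁻¹ ≤ ENNReal.ofReal (4 / T) :=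
    ENNReal.tsum_le_of_sum_range_le h
  rw [tsum_of_nat_of_neg_add_one ENNReal.summable ENNReal.summable,
    show 8 / T = 4 / T + 4 / T by ring, ENNReal.ofReal_add (by positivity) (by positivity)]
  refine add_le_add (by simpa using h1) ((ENNReal.tsum_le_tsum fun n => ?_).trans h1)
  refine ENNReal.ofReal_le_ofReal (inv_anti₀ (by positivity) ?_)
  have hn : (0 : ℝ) ≤ n := Nat.cast_nonneg n
  push_cast
  nlinarith

theorem zpow_two_sub_eq {T : ℝ} (hT : 1 ≤ T) {l : ℕ} (hl : 2 ≤ l) :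
    T ^ (2 - 2 * (l : ℤ)) = (T ^ (2 * (l - 2)))⁻¹ * (T ^ 2)⁻¹ := by
  obtain ⟨j, rfl⟩ := Nat.exists_eq_add_of_le hl
  have hT0 : T ≠ 0 := by positivity
  rw [← mul_inv, ← pow_add, ← zpow_natCast, ← zpow_neg]
  congr 1
  have : 2 + j - 2 = j := by omega
  rw [this]
  push_cast; ring

/-- The lattice sum is of size `T^(2-2l)`: of the `l` factors two are used for the convergence of the
sums over `p.1` and `p.2`, and the others are bounded by `T²`. -/
theorem tsum_inv_weight_le {T : ℝ} (hT : 1 ≤ T) {l : ℕ} (hl : 2 ≤ l) :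
    ∑' p : ℤ × ℤ, ENNReal.ofReal ((T ^ 2 + (p.1 : ℝ) ^ 2 + (p.2 : ℝ) ^ 2) ^ l)⁻¹ ≤
      ENNReal.ofReal (64 * T ^ (2 - 2 * (l : ℤ))) := by
  have hle : ∀ p : ℤ × ℤ, ENNReal.ofReal ((T ^ 2 + (p.1 : ℝ) ^ 2 + (p.2 : ℝ) ^ 2) ^ l)⁻¹ ≤
      ENNReal.ofReal (T ^ (2 * (l - 2)))⁻¹ * (ENNReal.ofReal (T ^ 2 + (p.1 : ℝ) ^ 2)⁻¹ *
        ENNReal.ofReal (T ^ 2 + (p.2 : ℝ) ^ 2)⁻¹) := by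
    intro p
    rw [← ENNReal.ofReal_mul (by positivity), ← ENNReal.ofReal_mul (by positivity), ← mul_inv,
      ← mul_inv]
    refine ENNReal.ofReal_le_ofReal (inv_anti₀ (by positivity) ?_)
    set a : ℝ := (p.1 : ℝ) ^ 2
    set c : ℝ := (p.2 : ℝ) ^ 2
    have ha : 0 ≤ a := by positivity
    have hc : 0 ≤ c := by positivity
    obtain ⟨j, rfl⟩ := Nat.exists_eq_add_of_le hl
    have hj : 2 + j - 2 = j := by omega
    rw [hj, add_comm 2 j, pow_add, pow_mul]
    refine mul_le_mul (pow_le_pow_left₀ (by positivity) (by linarith) j) ?_ (by positivity)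
      (by positivity)
    nlinarith [mul_nonneg ha hc, mul_nonneg (sq_nonneg T) ha, mul_nonneg (sq_nonneg T) hc,
      mul_nonneg ha ha, mul_nonneg hc hc]
  refine (ENNReal.tsum_le_tsum hle).trans ?_
  rw [ENNReal.tsum_mul_left, ENNReal.tsum_prod']
  simp_rw [ENNReal.tsum_mul_left, ENNReal.tsum_mul_right]
  have h := tsum_int_inv_sq_add_sq_le hT
  refine (mul_le_mul' le_rfl (mul_le_mul' h h)).trans ?_
  rw [← ENNReal.ofReal_mul (by positivity), ← ENNReal.ofReal_mul (by positivity)]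
  refine ENNReal.ofReal_le_ofReal (le_of_eq ?_)
  rw [zpow_two_sub_eq hT hl]
  have hT0 : T ≠ 0 := by positivity
  field_simp
  norm_num

/-! ### The upper bound -/

section Upper

variable {Γ : Subgroup G} {μ : Measure (X Γ)} {ν : V τ →ₗ[ℂ] (X Γ → ℂ)}
  {ν' : V τ' →ₗ[ℂ] (X Γ → ℂ)}

theorem slice_add (u v : E τ τ') (s' : Plane) : slice (u + v) s' = slice u s' + slice v s' := rfl

theorem slice_smul (c : ℂ) (u : E τ τ') (s' : Plane) : slice (c • u) s' = c • slice u s' := rfl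

theorem slice_repE (g g' : GL (Fin 2) ℝ) (u : E τ τ') (s' : Plane) :
    slice (repE g g' u) s' = detFactor τ' g' • rep τ g
      (slice u (((g'⁻¹ : GL (Fin 2) ℝ) : Matrix (Fin 2) (Fin 2) ℝ).mulVec s')) := by
  ext s
  simp only [slice_coe, repE_apply, invMap_apply, Submodule.coe_smul, Pi.smul_apply, smul_eq_mul,
    rep, detFactor]
  ring

/-- The vectors of `E` on which the realization at the first point `x` is given by `ν'`. On the other
vectors the realization is zero by convention, so that the bounds below need not show that there are
no such vectors. -/
def realizable (ν : V τ →ₗ[ℂ] (X Γ → ℂ)) (x : X Γ) (u : E τ τ') : Prop :=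
  (fun s' => ν (slice u s') x) ∈ V τ'

theorem realization_of_not {u : E τ τ'} {x x' : X Γ} (h : ¬ realizable ν x u) :
    realization ν ν' u x x' = 0 := dif_neg h

theorem realization_of {u : E τ τ'} {x x' : X Γ} (h : realizable ν x u) :
    realization ν ν' u x x' = ν' ⟨fun s' => ν (slice u s') x, h⟩ x' := dif_pos h

theorem realizable_sum {ι : Type*} (s : Finset ι) (c : ι → ℂ) (e : ι → E τ τ') (x x' : X Γ)
    (h : ∀ i ∈ s, c i ≠ 0 → realizable ν x (e i)) :
    realizable ν x (∑ i ∈ s, c i • e i) ∧ realization ν ν' (∑ i ∈ s, c i • e i) x x' =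
      ∑ i ∈ s, c i * realization ν ν' (e i) x x' := by
  classical
  induction s using Finset.induction_on with
  | empty =>
    have h0 : (fun s' => ν (slice (0 : E τ τ') s') x) = 0 := by
      ext s'
      have : slice (0 : E τ τ') s' = 0 := rfl
      rw [this, map_zero]; rfl
    have h1 : realizable ν x (0 : E τ τ') := by
      unfold realizable; rw [h0]; exact Submodule.zero_mem _
    refine ⟨by simpa using h1, ?_⟩
    rw [Finset.sum_empty, Finset.sum_empty, realization_of h1]
    have h2 : (⟨fun s' => ν (slice (0 : E τ τ') s') x, h1⟩ : V τ') = 0 := Subtype.ext h0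
    rw [h2, map_zero]; rfl
  | insert i s hi ih =>
    obtain ⟨h1, h2⟩ := ih fun j hj => h j (Finset.mem_insert_of_mem hj)
    rw [Finset.sum_insert hi, Finset.sum_insert hi]
    by_cases hc : c i = 0
    · rw [hc, zero_smul, zero_add, zero_mul, zero_add]
      exact ⟨h1, h2⟩
    · have h3 := h i (Finset.mem_insert_self i s) hc
      set v := ∑ j ∈ s, c j • e j
      have hfun : (fun s' => ν (slice (c i • e i + v) s') x) =
          c i • (fun s' => ν (slice (e i) s') x) + fun s' => ν (slice v s') x := by
        ext s'
        simp only [slice_add, slice_smul, map_add, map_smul, Pi.add_apply, Pi.smul_apply]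
      have h4 : realizable ν x (c i • e i + v) := by
        unfold realizable
        rw [hfun]
        exact Submodule.add_mem _ (Submodule.smul_mem _ _ h3) h1
      refine ⟨h4, ?_⟩
      rw [← h2, realization_of h4, realization_of h3, realization_of h1]
      have h5 : (⟨fun s' => ν (slice (c i • e i + v) s') x, h4⟩ : V τ') =
          c i • ⟨fun s' => ν (slice (e i) s') x, h3⟩ + ⟨fun s' => ν (slice v s') x, h1⟩ :=
        Subtype.ext hfun
      rw [h5, map_add, map_smul]; rfl

/-- The realization intertwines the action of `G × G` with the right translations. -/
theorem realization_repE (hν : IsEnhancement μ τ ν) (hν' : IsEnhancement μ τ' ν')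
    (g g' : GL (Fin 2) ℝ) (u : E τ τ') (y y' : X Γ)
    (h : realizable ν (X.mulRight (toG g) y) u) :
    realizable ν y (repE g g' u) ∧ realization ν ν' (repE g g' u) y y' =
      realization ν ν' u (X.mulRight (toG g) y) (X.mulRight (toG g') y') := by
  have hfun : (fun s' => ν (slice (repE g g' u) s') y) =
      (rep τ' g' ⟨fun s' => ν (slice u s') (X.mulRight (toG g) y), h⟩ : Plane → ℂ) := by
    ext s'
    rw [slice_repE, map_smul, Pi.smul_apply, hν.equivariant]
    rfl
  have h1 : realizable ν y (repE g g' u) := by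
    unfold realizable
    rw [hfun]
    exact Subtype.prop _
  refine ⟨h1, ?_⟩
  rw [realization_of h1, realization_of h]
  have h2 : (⟨fun s' => ν (slice (repE g g' u) s') y, h1⟩ : V τ') =
      rep τ' g' ⟨fun s' => ν (slice u s') (X.mulRight (toG g) y), h⟩ := Subtype.ext hfun
  rw [h2, hν'.equivariant]

/-- The normalized squares of the automorphic functions of the weight vectors, in `[0, ∞]`. -/
def autDensity (ν : V τ →ₗ[ℂ] (X Γ → ℂ)) (m : ℤ) (x : X Γ) : ℝ≥0∞ :=
  ENNReal.ofReal (‖ν (weightVec τ m) x‖ ^ 2 / weight τ m)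

theorem measurable_autDensity (hν : IsEnhancement μ τ ν) (m : ℤ) :
    Measurable (autDensity ν m) := by
  have h : Continuous fun x => ‖ν (weightVec τ m) x‖ ^ 2 / weight τ m :=
    (((hν.smooth _).continuous.norm).pow 2).div_const _
  exact h.measurable.ennreal_ofReal

theorem lintegral_autDensity (hcomp : CompactSpace (X Γ)) (hμ : IsInvariantProbability μ)
    (hτ : IsUnitaryParam τ) (hν : IsEnhancement μ τ ν) (m : ℤ) :
    ∫⁻ x, autDensity ν m x ∂μ = 1 := by
  have := hμ.isProbabilityMeasure
  have hw := (pairMeasure_spec hτ).2.1 m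
  have hc : Continuous fun x => ‖ν (weightVec τ m) x‖ ^ 2 / weight τ m :=
    (((hν.smooth _).continuous.norm).pow 2).div_const _
  have hint : Integrable (fun x => ‖ν (weightVec τ m) x‖ ^ 2 / weight τ m) μ := by
    obtain ⟨B, hB⟩ := isCompact_univ.exists_bound_of_continuousOn hc.continuousOn
    exact Integrable.of_bound hc.measurable.aestronglyMeasurable B
      (Filter.Eventually.of_forall fun x => hB x (Set.mem_univ x))
  unfold autDensity
  rw [← ofReal_integral_eq_lintegral_ofReal hint (Filter.Eventually.of_forall fun x => by
    positivity), integral_div]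
  have h := hν.isometric (weightVec τ m) (weightVec τ m)
  have h1 : formV τ (weightVec τ m) (weightVec τ m) = (weight τ m : ℂ) := by
    rw [formV]
    simp_rw [weightVec_circ]
    rw [(pairMeasure_spec hτ).2.2, if_pos rfl]
  rw [h1] at h
  have h2 : ∫ x, ‖ν (weightVec τ m) x‖ ^ 2 ∂μ = weight τ m := by
    have h3 : ∀ x, ν (weightVec τ m) x * conj (ν (weightVec τ m) x) =
        ((‖ν (weightVec τ m) x‖ ^ 2 : ℝ) : ℂ) := fun x => by
      rw [Complex.mul_conj, Complex.normSq_eq_norm_sq]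
    simp_rw [h3] at h
    rw [integral_complex_ofReal] at h
    exact_mod_cast h
  rw [h2, div_self hw.ne', ENNReal.ofReal_one]

theorem exists_tsum_mul_mul_le {α : Type*} [MeasurableSpace α] {μ : Measure α}
    [IsProbabilityMeasure μ] {f f' : ℤ → α → ℝ≥0∞} (hm : ∀ m, Measurable (f m))
    (hm' : ∀ m, Measurable (f' m)) (h : ∀ m, ∫⁻ x, f m x ∂μ = 1) (h' : ∀ m, ∫⁻ x, f' m x ∂μ = 1)
    (W : ℤ × ℤ → ℝ≥0∞) :
    ∃ y y' : α, ∑' p : ℤ × ℤ, f p.1 y * f' p.2 y' * W p ≤ ∑' p, W p := by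
  have h1 : ∀ y, ∫⁻ y', ∑' p : ℤ × ℤ, f p.1 y * f' p.2 y' * W p ∂μ =
      ∑' p : ℤ × ℤ, f p.1 y * W p := by
    intro y
    rw [lintegral_tsum fun p : ℤ × ℤ => (((hm' p.2).const_mul _).mul_const _).aemeasurable]
    refine tsum_congr fun p => ?_
    rw [lintegral_mul_const _ ((hm' p.2).const_mul _), lintegral_const_mul _ (hm' p.2), h', mul_one]
  have h2 : ∫⁻ y, ∑' p : ℤ × ℤ, f p.1 y * W p ∂μ = ∑' p, W p := by
    rw [lintegral_tsum fun p : ℤ × ℤ => ((hm p.1).mul_const _).aemeasurable]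
    refine tsum_congr fun p => ?_
    rw [lintegral_mul_const _ (hm p.1), h, one_mul]
  obtain ⟨y, hy⟩ := exists_le_lintegral (μ := μ)
    (f := fun y => ∑' p : ℤ × ℤ, f p.1 y * W p)
    (Measurable.tsum fun p : ℤ × ℤ => (hm p.1).mul_const _).aemeasurable
  obtain ⟨y', hy'⟩ := exists_le_lintegral (μ := μ)
    (f := fun y' => ∑' p : ℤ × ℤ, f p.1 y * f' p.2 y' * W p)
    (Measurable.tsum fun p : ℤ × ℤ => ((hm' p.2).const_mul _).mul_const _).aemeasurable
  exact ⟨y, y', hy'.trans ((h1 y).trans_le (hy.trans_eq h2))⟩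

/-- There is a point of `X × X` at which the norm of the evaluation functional, relative to the
Sobolev norm, is at most its average. -/
theorem exists_good_point (hcomp : CompactSpace (X Γ)) (hμ : IsInvariantProbability μ)
    (hτ : IsUnitaryParam τ) (hτ' : IsUnitaryParam τ') (hν : IsEnhancement μ τ ν)
    (hν' : IsEnhancement μ τ' ν') {T : ℝ} (hT : 1 ≤ T) {l : ℕ} (hl : 2 ≤ l) :
    ∃ y y' : X Γ, ∑' p : ℤ × ℤ, autDensity ν p.1 y * autDensity ν' p.2 y' *
      ENNReal.ofReal ((T ^ 2 + (p.1 : ℝ) ^ 2 + (p.2 : ℝ) ^ 2) ^ l)⁻¹ ≤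
        ENNReal.ofReal (64 * T ^ (2 - 2 * (l : ℤ))) := by
  have := hμ.isProbabilityMeasure
  obtain ⟨y, y', h⟩ := exists_tsum_mul_mul_le (μ := μ) (fun m => measurable_autDensity hν m)
    (fun m => measurable_autDensity hν' m) (lintegral_autDensity hcomp hμ hτ hν)
    (lintegral_autDensity hcomp hμ hτ' hν')
    fun p => ENNReal.ofReal ((T ^ 2 + (p.1 : ℝ) ^ 2 + (p.2 : ℝ) ^ 2) ^ l)⁻¹
  exact ⟨y, y', h.trans (tsum_inv_weight_le hT hl)⟩

/-- The bound for the realization at a point in terms of weighted Fourier coefficients. -/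
theorem norm_realization_sq_le (hτ : IsUnitaryParam τ)
    (hτ' : IsUnitaryParam τ') (hν : IsEnhancement μ τ ν)
    (hν' : IsEnhancement μ τ' ν') {T : ℝ} (hT : 1 ≤ T) (l : ℕ) {y y' : X Γ} {B Q : ℝ} (hB : 0 ≤ B)
    (hS : ∑' p : ℤ × ℤ, autDensity ν p.1 y * autDensity ν' p.2 y' *
      ENNReal.ofReal ((T ^ 2 + (p.1 : ℝ) ^ 2 + (p.2 : ℝ) ^ 2) ^ l)⁻¹ ≤ ENNReal.ofReal B)
    {u : E τ τ'} (hQ : ∀ F : Finset (ℤ × ℤ), ∑ p ∈ F,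
      (T ^ 2 + (p.1 : ℝ) ^ 2 + (p.2 : ℝ) ^ 2) ^ l * (weight2 τ τ' p * ‖uhat u p‖ ^ 2) ≤ Q)
    (h : realizable ν y u) : ‖realization ν ν' u y y'‖ ^ 2 ≤ Q * B := by
  let w : ℤ × ℤ → ℝ := fun p => (T ^ 2 + (p.1 : ℝ) ^ 2 + (p.2 : ℝ) ^ 2) ^ l
  have hw : ∀ p, 0 < w p := fun p => by positivity
  let f : ℤ × ℤ → ℂ := fun p => ν (weightVec τ p.1) y * ν' (weightVec τ' p.2) y'
  have hQ0 : 0 ≤ Q := by simpa using hQ ∅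
  have hSF : ∀ F : Finset (ℤ × ℤ), ∑ p ∈ F, ‖f p‖ ^ 2 / (w p * weight2 τ τ' p) ≤ B := by
    intro F
    rw [← ENNReal.ofReal_le_ofReal_iff hB, ENNReal.ofReal_sum_of_nonneg fun p _ => by
      have := hw p
      have := weight2_pos hτ hτ' p
      positivity]
    refine le_trans (le_of_eq ?_) ((ENNReal.sum_le_tsum F).trans hS)
    refine Finset.sum_congr rfl fun p _ => ?_
    have h1 := (pairMeasure_spec hτ).2.1 p.1
    have h2 := (pairMeasure_spec hτ').2.1 p.2
    unfold autDensity
    rw [← ENNReal.ofReal_mul (by positivity), ← ENNReal.ofReal_mul (by positivity)]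
    congr 1
    simp only [f, w, weight2, norm_mul]
    field_simp
  have hfin : ∀ F : Finset (ℤ × ℤ), ‖∑ p ∈ F, uhat u p * f p‖ ^ 2 ≤ Q * B := by
    intro F
    have h1 : ‖∑ p ∈ F, uhat u p * f p‖ ≤ ∑ p ∈ F, ‖uhat u p‖ * ‖f p‖ :=
      (norm_sum_le _ _).trans_eq (Finset.sum_congr rfl fun p _ => norm_mul _ _)
    have h2 : (∑ p ∈ F, ‖uhat u p‖ * ‖f p‖) ^ 2 ≤
        (∑ p ∈ F, w p * (weight2 τ τ' p * ‖uhat u p‖ ^ 2)) *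
          ∑ p ∈ F, ‖f p‖ ^ 2 / (w p * weight2 τ τ' p) := by
      refine Finset.sum_sq_le_sum_mul_sum_of_sq_le_mul F (fun p _ => ?_) (fun p _ => ?_)
        (fun p _ => ?_)
      · have := hw p; have := weight2_pos hτ hτ' p; positivity
      · have := hw p; have := weight2_pos hτ hτ' p; positivity
      · have := (hw p).ne'; have := (weight2_pos hτ hτ' p).ne'; exact le_of_eq (by field_simp)
    refine (pow_le_pow_left₀ (norm_nonneg _) h1 2).trans (h2.trans ?_)
    refine mul_le_mul (hQ F) (hSF F) (Finset.sum_nonneg fun p _ => ?_) hQ0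
    have := hw p; have := weight2_pos hτ hτ' p; positivity
  rw [realization_of h]
  -- the expansion is an iterated sum, so the bound for finite sums is passed to the limit twice
  have hexp := hasSum_enhancement hν' ⟨fun s' => ν (slice u s') y, h⟩ y'
  refine le_of_tendsto (hexp.norm.pow 2) (Filter.Eventually.of_forall fun N => ?_)
  have hinner : HasSum (fun m => ∑ n ∈ N, uhat u (m, n) * f (m, n))
      (∑ n ∈ N, fcoef (fun θ => ν (slice u (circ θ)) y) n * ν' (weightVec τ' n) y') := by
    refine hasSum_sum fun n _ => ?_
    have := (hasSum_fcoef_enhancement_slice hν u y n).mul_right (ν' (weightVec τ' n) y')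
    simpa only [f, mul_assoc] using this
  refine le_of_tendsto (hinner.norm.pow 2) (Filter.Eventually.of_forall fun M => ?_)
  have := hfin (M ×ˢ N)
  rwa [Finset.sum_product] at this

/-- The evaluation functionals at all points of `X × X` are bounded by `T^(1-l)` relative to the
Sobolev norm: a good point exists by averaging, and a bounded element of `G × G` carries it to the
given point. -/
theorem exists_realization_bound (hcomp : CompactSpace (X Γ)) (hμ : IsInvariantProbability μ)
    {l : ℕ} (hl : 2 ≤ l) (b : Module.Basis (Fin 6) ℝ (lieG × lieG)) :
    ∃ C : ℝ, 0 ≤ C ∧ ∀ (τ τ' : ℂ), IsUnitaryParam τ → IsUnitaryParam τ' →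
      ∀ (ν : V τ →ₗ[ℂ] (X Γ → ℂ)) (ν' : V τ' →ₗ[ℂ] (X Γ → ℂ)),
        IsEnhancement μ τ ν → IsEnhancement μ τ' ν' → ∀ T : ℝ, 1 ≤ T →
        ∀ (u : E τ τ') (x x' : X Γ), realizable ν x u →
          ‖realization ν ν' u x x'‖ ^ 2 ≤ C * T ^ (2 - 2 * (l : ℤ)) * sobQ b l T u := by
  obtain ⟨R, hR⟩ := exists_bddGL_transitive hcomp
  obtain ⟨A, hA⟩ := exists_adInv_bound b R
  obtain ⟨C₁, hC₁0, hC₁⟩ := exists_sobQ_repE_le b l A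
  obtain ⟨C₂, hC₂0, hC₂⟩ := exists_sum_uhat_le_sobQ b l
  refine ⟨C₂ * C₁ * 64, by positivity, fun τ τ' hτ hτ' ν ν' hν hν' T hT u x x' h => ?_⟩
  obtain ⟨y, y', hy⟩ := exists_good_point hcomp hμ hτ hτ' hν hν' hT hl
  obtain ⟨g, hg, rfl⟩ := hR x y
  obtain ⟨g', hg', rfl⟩ := hR x' y'
  obtain ⟨h1, h2⟩ := realization_repE hν hν' g g' u y y' h
  have hT0 : 0 ≤ T ^ (2 - 2 * (l : ℤ)) := by positivity
  rw [← h2]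
  refine (norm_realization_sq_le hτ hτ' hν hν' hT l (by positivity) hy
    (hC₂ τ τ' hτ hτ' T hT (repE g g' u)) h1).trans ?_
  have h3 := hC₁ τ τ' hτ hτ' g g' (hA g hg g' hg') (nsq_repE hμ hτ hτ' hν hν' g g') T hT u
  calc _ ≤ C₂ * (C₁ * sobQ b l T u) * (64 * T ^ (2 - 2 * (l : ℤ))) := by gcongr
    _ = _ := by ring

/-- The bound for the relative trace of the diagonal form: the sum over an orthonormal family of the
squared values at a point of the diagonal is bounded by the squared norm of the evaluation there. -/
theorem exists_relTrace_diagForm_le (hcomp : CompactSpace (X Γ)) (hμ : IsInvariantProbability μ)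
    {l : ℕ} (hl : 2 ≤ l) (b : Module.Basis (Fin 6) ℝ (lieG × lieG)) :
    ∃ C : ℝ, 0 < C ∧ ∀ (τ τ' : ℂ), IsUnitaryParam τ → IsUnitaryParam τ' →
      ∀ (ν : V τ →ₗ[ℂ] (X Γ → ℂ)) (ν' : V τ' →ₗ[ℂ] (X Γ → ℂ)),
        IsEnhancement μ τ ν → IsEnhancement μ τ' ν' → ∀ T : ℝ, 1 ≤ T →
          relTrace (diagForm μ ν ν') (sobolevForm b l T) ≤
              ENNReal.ofReal (C * T ^ (2 - 2 * (l : ℤ))) := by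
  have := hμ.isProbabilityMeasure
  obtain ⟨C, hC0, hC⟩ := exists_realization_bound hcomp hμ hl b
  refine ⟨C + 1, by positivity, fun τ τ' hτ hτ' ν ν' hν hν' T hT => ?_⟩
  have hT0 : 0 < T ^ (2 - 2 * (l : ℤ)) := by positivity
  refine iSup_le fun m => iSup_le fun e => iSup_le fun he => ?_
  let r : Fin m → X Γ → ℂ := fun i x => realization ν ν' (e i) x x
  have hpt : ∀ x, ∑ i, ‖r i x‖ ^ 2 ≤ C * T ^ (2 - 2 * (l : ℤ)) := by
    intro x
    -- the combination with coefficients `conj (r i x)` realizes the norm of the functional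
    obtain ⟨h1, h2⟩ := realizable_sum (ν := ν) (ν' := ν') Finset.univ
      (fun i => conj (r i x)) e x x (fun i _ hi => by
        by_contra hn
        exact hi (by simp [r, realization_of_not hn]))
    have h3 := hC τ τ' hτ hτ' ν ν' hν hν' T hT _ x x h1
    rw [h2, sobQ_sum_of_orthonormal b l T hτ hτ' he] at h3
    have h4 : ∑ i, conj (r i x) * realization ν ν' (e i) x x = ((∑ i, ‖r i x‖ ^ 2 : ℝ) : ℂ) := by
      push_cast
      refine Finset.sum_congr rfl fun i _ => ?_
      rw [mul_comm, Complex.mul_conj, Complex.normSq_eq_norm_sq, Complex.ofReal_pow]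
    have h5 : 0 ≤ ∑ i, ‖r i x‖ ^ 2 := by positivity
    simp only [RCLike.norm_conj] at h3
    rw [h4, Complex.norm_real, Real.norm_of_nonneg h5] at h3
    rcases h5.eq_or_lt with h6 | h6
    · rw [← h6]; positivity
    · rw [sq] at h3
      exact le_of_mul_le_mul_right h3 h6
  have hterm : ∀ i, ENNReal.ofReal (diagForm μ ν ν' (e i) (e i)).re ≤
      ∫⁻ x, ENNReal.ofReal (‖r i x‖ ^ 2) ∂μ := by
    intro i
    have h1 : diagForm μ ν ν' (e i) (e i) = ((∫ x, ‖r i x‖ ^ 2 ∂μ : ℝ) : ℂ) := by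
      rw [diagForm, ← integral_complex_ofReal]
      congr 1; ext x
      rw [Complex.mul_conj, Complex.normSq_eq_norm_sq]
    rw [h1, Complex.ofReal_re]
    -- a function which is not integrable has integral zero by convention, and the bound is trivial
    by_cases hi : Integrable (fun x => ‖r i x‖ ^ 2) μ
    · rw [ofReal_integral_eq_lintegral_ofReal hi (Filter.Eventually.of_forall fun x => by
        positivity)]
    · rw [integral_undef hi, ENNReal.ofReal_zero]; exact zero_le
  have hsum : ∀ s : Finset (Fin m), ∑ i ∈ s, ∫⁻ x, ENNReal.ofReal (‖r i x‖ ^ 2) ∂μ ≤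
      ∫⁻ x, ∑ i ∈ s, ENNReal.ofReal (‖r i x‖ ^ 2) ∂μ := by
    intro s
    induction s using Finset.induction_on with
    | empty => simp
    | insert i s hi ih =>
      simp only [Finset.sum_insert hi]
      exact (add_le_add le_rfl ih).trans (le_lintegral_add _ _)
  refine (Finset.sum_le_sum fun i _ => hterm i).trans ((hsum Finset.univ).trans ?_)
  calc ∫⁻ x, ∑ i, ENNReal.ofReal (‖r i x‖ ^ 2) ∂μ
      ≤ ∫⁻ _, ENNReal.ofReal (C * T ^ (2 - 2 * (l : ℤ))) ∂μ := by
        refine lintegral_mono fun x => ?_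
        rw [← ENNReal.ofReal_sum_of_nonneg fun i _ => by positivity]
        exact ENNReal.ofReal_le_ofReal (hpt x)
    _ = ENNReal.ofReal (C * T ^ (2 - 2 * (l : ℤ))) := by simp
    _ ≤ _ := ENNReal.ofReal_le_ofReal (by nlinarith)

end Upper

/-! ### The model operator away from the diagonal -/

theorem abs_omega_circ (x y : ℝ) : |omega (circ x) (circ y)| = |Real.sin (x - y)| := by
  rw [← abs_neg, omega, Real.sin_sub]
  simp only [circ, Matrix.cons_val_zero, Matrix.cons_val_one]
  congr 1; ring

/-- The model kernel for the third point `circ 0`, in angles. -/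
def circKernel (τ τ' lam : ℂ) (x y : ℝ) : ℂ :=
  ((|Real.sin y| : ℝ) : ℂ) ^ ((τ - τ' - lam - 1) / 2) *
  ((|Real.sin x| : ℝ) : ℂ) ^ ((-τ + τ' - lam - 1) / 2) *
  ((|Real.sin (x - y)| : ℝ) : ℂ) ^ ((-τ - τ' + lam - 1) / 2)

theorem modelKernel_circ (τ τ' lam : ℂ) (x y z : ℝ) :
    modelKernel τ τ' lam (circ x) (circ y) (circ z) = circKernel τ τ' lam (x - z) (y - z) := by
  simp only [modelKernel, circKernel, abs_omega_circ, sub_sub_sub_cancel_right]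

theorem circKernel_two_pi_left (τ τ' lam : ℂ) (x y : ℝ) :
    circKernel τ τ' lam (x + 2 * Real.pi) y = circKernel τ τ' lam x y := by
  simp only [circKernel, Real.sin_add_two_pi, add_sub_right_comm]

theorem circKernel_two_pi_right (τ τ' lam : ℂ) (x y : ℝ) :
    circKernel τ τ' lam x (y + 2 * Real.pi) = circKernel τ τ' lam x y := by
  simp only [circKernel, Real.sin_add_two_pi, ← sub_sub, Real.sin_sub_two_pi]

theorem IsUnitaryParam.re_bounds (hτ : IsUnitaryParam τ) : -1 < τ.re ∧ τ.re ≤ 0 := by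
  rcases hτ with h | ⟨-, h1, h2⟩
  · rw [h]; norm_num
  · exact ⟨h1, h2.le⟩

/-- The vectors of `E` which vanish on the diagonal of the torus. The model kernel is integrable
against them, whatever the parameters. -/
def offDiag (τ τ' : ℂ) : Submodule ℂ (E τ τ') where
  carrier := {u | ∃ B : ℝ, ∀ x y, ‖torus u x y‖ ≤ B * |Real.sin (x - y)|}
  add_mem' := by
    rintro u v ⟨B, hB⟩ ⟨B', hB'⟩
    refine ⟨B + B', fun x y => ?_⟩
    rw [add_mul]
    exact (norm_add_le _ _).trans (add_le_add (hB x y) (hB' x y))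
  zero_mem' := ⟨0, fun x y => by simp [torus]⟩
  smul_mem' := by
    rintro c u ⟨B, hB⟩
    refine ⟨‖c‖ * B, fun x y => ?_⟩
    have : torus (c • u : E τ τ') x y = c * torus u x y := rfl
    rw [this, norm_mul, mul_assoc]
    exact mul_le_mul_of_nonneg_left (hB x y) (norm_nonneg c)

section Model

variable (hτ : IsUnitaryParam τ) (hτ' : IsUnitaryParam τ') {lam : ℂ} (hlam : lam.re = 0)
include hτ hτ' hlam

theorem norm_mul_circKernel_le {w : ℂ} {B x y : ℝ} (hB : 0 ≤ B)
    (hw : ‖w‖ ≤ B * |Real.sin (x - y)|) :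
    ‖w * circKernel τ τ' lam x y‖ ≤ B * (|Real.sin x| ^ ((-τ.re + τ'.re - 1) / 2) *
      |Real.sin y| ^ ((τ.re - τ'.re - 1) / 2)) := by
  obtain ⟨h1, h2⟩ := hτ.re_bounds
  obtain ⟨h1', h2'⟩ := hτ'.re_bounds
  have eA : ((τ - τ' - lam - 1) / 2).re = (τ.re - τ'.re - 1) / 2 := by
    simp [hlam]
  have eB : ((-τ + τ' - lam - 1) / 2).re = (-τ.re + τ'.re - 1) / 2 := by
    simp [hlam]
  have eC : ((-τ - τ' + lam - 1) / 2).re = (-τ.re - τ'.re - 1) / 2 := by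
    simp [hlam]
  have hC : ‖w‖ * ‖((|Real.sin (x - y)| : ℝ) : ℂ) ^ ((-τ - τ' + lam - 1) / 2)‖ ≤ B := by
    rcases (abs_nonneg (Real.sin (x - y))).eq_or_lt with h | h
    · rw [← h, mul_zero] at hw
      rw [le_antisymm hw (norm_nonneg w), zero_mul]
      exact hB
    · rw [Complex.norm_cpow_eq_rpow_re_of_pos h, eC]
      calc _ ≤ B * |Real.sin (x - y)| * |Real.sin (x - y)| ^ ((-τ.re - τ'.re - 1) / 2) := by
            gcongr
        _ = B * |Real.sin (x - y)| ^ (1 + (-τ.re - τ'.re - 1) / 2) := by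
            rw [Real.rpow_add h, Real.rpow_one, mul_assoc]
        _ ≤ B * 1 := by
            gcongr
            exact Real.rpow_le_one h.le (Real.abs_sin_le_one _) (by linarith)
        _ = B := mul_one B
  rw [circKernel, norm_mul, norm_mul, norm_mul,
    Complex.norm_cpow_eq_rpow_re_of_nonneg (abs_nonneg _) (by rw [eA]; linarith),
    Complex.norm_cpow_eq_rpow_re_of_nonneg (abs_nonneg _) (by rw [eB]; linarith), eA, eB]
  calc _ = (‖w‖ * ‖((|Real.sin (x - y)| : ℝ) : ℂ) ^ ((-τ - τ' + lam - 1) / 2)‖) *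
        (|Real.sin x| ^ ((-τ.re + τ'.re - 1) / 2) * |Real.sin y| ^ ((τ.re - τ'.re - 1) / 2)) := by
        ring
    _ ≤ _ := by gcongr

omit hlam in
theorem integrable_kernelBound (B z : ℝ) : Integrable (fun p : ℝ × ℝ =>
    B * (|Real.sin (p.1 - z)| ^ ((-τ.re + τ'.re - 1) / 2) *
      |Real.sin (p.2 - z)| ^ ((τ.re - τ'.re - 1) / 2))) (circleMeasure.prod circleMeasure) := by
  obtain ⟨h1, h2⟩ := hτ.re_bounds
  obtain ⟨h1', h2'⟩ := hτ'.re_bounds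
  exact ((integrable_abs_sin_rpow (by linarith) z).mul_prod
    (integrable_abs_sin_rpow (by linarith) z)).const_mul B

theorem integrable_torus_mul_circKernel {u : E τ τ'} (hu : u ∈ offDiag τ τ') (s z : ℝ) :
    Integrable (fun p : ℝ × ℝ => torus u (p.1 + s) (p.2 + s) *
      circKernel τ τ' lam (p.1 - z) (p.2 - z)) (circleMeasure.prod circleMeasure) := by
  obtain ⟨B, hB⟩ := hu
  refine (integrable_kernelBound hτ hτ' |B| z).mono' ?_
    (Filter.Eventually.of_forall fun p => ?_)
  · have h1 : Continuous fun p : ℝ × ℝ => torus u (p.1 + s) (p.2 + s) :=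
      Continuous.comp (g := Function.uncurry (torus u)) (f := fun p : ℝ × ℝ => (p.1 + s, p.2 + s))
        (continuous_torus u) (by fun_prop)
    have h2 : Measurable fun p : ℝ × ℝ => circKernel τ τ' lam (p.1 - z) (p.2 - z) := by
      unfold circKernel
      fun_prop
    exact h1.aestronglyMeasurable.mul h2.aestronglyMeasurable
  · refine norm_mul_circKernel_le hτ hτ' hlam (abs_nonneg B) ((hB _ _).trans ?_)
    rw [add_sub_add_right_eq_sub, sub_sub_sub_cancel_right]
    exact mul_le_mul_of_nonneg_right (le_abs_self B) (abs_nonneg _)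

/-- The model operator as an integral in which only the vector depends on the point. -/
theorem modelOp_eq {u : E τ τ'} (hu : u ∈ offDiag τ τ') (z : ℝ) :
    modelOp lam u z = ∫ p : ℝ × ℝ, torus u (p.1 + z) (p.2 + z) * circKernel τ τ' lam p.1 p.2
      ∂(circleMeasure.prod circleMeasure) := by
  have h1 := integrable_torus_mul_circKernel hτ hτ' hlam hu 0 z
  have h2 := integrable_torus_mul_circKernel hτ hτ' hlam hu z 0
  simp only [add_zero, sub_zero] at h1 h2
  have e : modelOp lam u z = ∫ p : ℝ × ℝ, torus u p.1 p.2 *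
      circKernel τ τ' lam (p.1 - z) (p.2 - z) ∂(circleMeasure.prod circleMeasure) := by
    simp only [modelOp, modelKernel_circ, torus]
  rw [e, integral_prod _ h1, integral_prod _ h2]
  rw [← integral_circle_add (f := fun x => ∫ y, torus u x y *
    circKernel τ τ' lam (x - z) (y - z) ∂circleMeasure) _ z]
  · congr 1; ext x
    rw [← integral_circle_add (f := fun y => torus u (x + z) y *
      circKernel τ τ' lam (x + z - z) (y - z)) _ z]
    · simp only [add_sub_cancel_right]
    · intro y
      simp only [add_sub_right_comm, circKernel_two_pi_right,
        periodic_two_pi (torus_periodic_right u _) y]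
  · intro x
    refine integral_congr_ae (Filter.Eventually.of_forall fun y => ?_)
    beta_reduce
    rw [add_sub_right_comm, circKernel_two_pi_left]
    exact congrArg (· * _) (periodic_two_pi (torus_periodic_left u y) x)

theorem continuous_modelOp {u : E τ τ'} (hu : u ∈ offDiag τ τ') : Continuous (modelOp lam u) := by
  have h : modelOp lam u = fun z => ∫ p : ℝ × ℝ, torus u (p.1 + z) (p.2 + z) *
      circKernel τ τ' lam p.1 p.2 ∂(circleMeasure.prod circleMeasure) :=
    funext fun z => modelOp_eq hτ hτ' hlam hu z
  rw [h]
  have hu' := hu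
  obtain ⟨B, hB⟩ := hu'
  refine continuous_of_dominated (fun z => ?_) (fun z => ?_)
    (integrable_kernelBound hτ hτ' |B| 0) (Filter.Eventually.of_forall fun p => ?_)
  · have := integrable_torus_mul_circKernel hτ hτ' hlam hu z 0
    simp only [sub_zero] at this
    exact this.aestronglyMeasurable
  · refine Filter.Eventually.of_forall fun p => ?_
    rw [sub_zero, sub_zero]
    refine norm_mul_circKernel_le hτ hτ' hlam (abs_nonneg B) ((hB _ _).trans ?_)
    rw [add_sub_add_right_eq_sub]
    exact mul_le_mul_of_nonneg_right (le_abs_self B) (abs_nonneg _)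
  · exact ((continuous_torus u).comp
      (by fun_prop : Continuous fun z : ℝ => (p.1 + z, p.2 + z))).mul continuous_const

theorem modelOp_sum {ι : Type*} (s : Finset ι) (c : ι → ℂ) {f : ι → E τ τ'}
    (hf : ∀ i, f i ∈ offDiag τ τ') (z : ℝ) :
    modelOp lam (∑ i ∈ s, c i • f i) z = ∑ i ∈ s, c i * modelOp lam (f i) z := by
  rw [modelOp_eq hτ hτ' hlam (Submodule.sum_mem _ fun i _ => Submodule.smul_mem _ _ (hf i))]
  have h : ∀ p : ℝ × ℝ, torus (∑ i ∈ s, c i • f i : E τ τ') (p.1 + z) (p.2 + z) *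
      circKernel τ τ' lam p.1 p.2 = ∑ i ∈ s, c i * (torus (f i) (p.1 + z) (p.2 + z) *
        circKernel τ τ' lam p.1 p.2) := fun p => by
    have : torus (∑ i ∈ s, c i • f i : E τ τ') (p.1 + z) (p.2 + z) =
        ∑ i ∈ s, c i * torus (f i) (p.1 + z) (p.2 + z) := by
      simp [torus, Finset.sum_apply]
    rw [this, Finset.sum_mul]
    simp only [mul_assoc]
  simp_rw [h]
  rw [integral_finsetSum _ fun i _ => ?_]
  · refine Finset.sum_congr rfl fun i _ => ?_
    rw [integral_const_mul, modelOp_eq hτ hτ' hlam (hf i)]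
  · have := integrable_torus_mul_circKernel hτ hτ' hlam (hf i) z 0
    simp only [sub_zero] at this
    exact this.const_mul _

end Model

/-! ### Oscillating test vectors supported in a cone -/

/-- A closed cone in `ℝ² × ℝ²`, invariant under dilations of both factors, on which neither vector
is horizontal and the two vectors are not proportional. -/
def cone : Set (Plane × Plane) :=
  {p | p.1 0 ^ 2 ≤ p.1 1 ^ 2 ∧ 4 * p.2 1 ^ 2 ≤ p.2 0 ^ 2 ∧ p.2 0 ^ 2 ≤ 9 * p.2 1 ^ 2}

/-- The three forms whose absolute values enter the model kernel when the third point is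
horizontal. -/
def coneForm (i : Fin 3) (p : Plane × Plane) : ℝ := ![p.1 1, p.2 1, omega p.1 p.2] i

/-- The open set on which the three forms do not vanish. -/
def reg : Set (Plane × Plane) := {p | ∀ i, coneForm i p ≠ 0}

theorem contDiff_coneForm (i : Fin 3) : ContDiff ℝ ∞ (coneForm i) := by
  have h1 : ∀ j : Fin 2, ContDiff ℝ ∞ fun p : Plane × Plane => p.1 j := fun j =>
    (contDiff_coord j).comp contDiff_fst
  have h2 : ∀ j : Fin 2, ContDiff ℝ ∞ fun p : Plane × Plane => p.2 j := fun j =>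
    (contDiff_coord j).comp contDiff_snd
  fin_cases i
  · exact h1 1
  · exact h2 1
  · exact ((h1 0).mul (h2 1)).sub ((h1 1).mul (h2 0))

theorem isOpen_reg : IsOpen reg := by
  have : reg = ⋂ i, coneForm i ⁻¹' {0}ᶜ := by ext p; simp [reg]
  rw [this]
  exact isOpen_iInter_of_finite fun i =>
    isOpen_compl_singleton.preimage (contDiff_coneForm i).continuous

theorem isClosed_cone : IsClosed cone := by
  have h1 : ∀ j : Fin 2, Continuous fun p : Plane × Plane => p.1 j := fun j => by fun_prop
  have h2 : ∀ j : Fin 2, Continuous fun p : Plane × Plane => p.2 j := fun j => by fun_prop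
  exact (isClosed_le ((h1 0).pow 2) ((h1 1).pow 2)).inter
    ((isClosed_le (((h2 1).pow 2).const_mul 4) ((h2 0).pow 2)).inter
      (isClosed_le ((h2 0).pow 2) (((h2 1).pow 2).const_mul 9)))

theorem coneForm_smul (i : Fin 3) (a b : ℝ) (p : Plane × Plane) :
    coneForm i (a • p.1, b • p.2) = ![a, b, a * b] i * coneForm i p := by
  fin_cases i <;> simp [coneForm, omega]
  ring

theorem abs_mul_le_abs_omega {p : Plane × Plane} (hp : p ∈ cone) :
    |p.1 1| * |p.2 1| ≤ |omega p.1 p.2| := by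
  obtain ⟨h1, h2, -⟩ := hp
  have h1' : |p.1 0| ≤ |p.1 1| := sq_le_sq.mp h1
  have h2' : 2 * |p.2 1| ≤ |p.2 0| := by
    have := sq_le_sq.mp (show (2 * p.2 1) ^ 2 ≤ p.2 0 ^ 2 by linarith)
    rwa [abs_mul, abs_two] at this
  have h3 : |p.1 1 * p.2 0| - |p.1 0 * p.2 1| ≤ |omega p.1 p.2| := by
    rw [omega, abs_sub_comm]
    exact abs_sub_abs_le_abs_sub _ _
  rw [abs_mul, abs_mul] at h3
  nlinarith [abs_nonneg (p.1 1), abs_nonneg (p.2 1),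
    mul_le_mul_of_nonneg_right h1' (abs_nonneg (p.2 1)),
    mul_le_mul_of_nonneg_left h2' (abs_nonneg (p.1 1))]

theorem mem_reg_of_mem_cone {p : Plane × Plane} (hp : p ∈ cone) (hd : p ∈ dom) : p ∈ reg := by
  have h3 := abs_mul_le_abs_omega hp
  obtain ⟨h1, -, h2⟩ := hp
  have e1 : p.1 1 ≠ 0 := by
    intro h
    refine hd.1 (funext fun i => ?_)
    rw [h] at h1
    fin_cases i
    · exact pow_eq_zero_iff (two_ne_zero) |>.mp (le_antisymm (by simpa using h1) (sq_nonneg _))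
    · exact h
  have e2 : p.2 1 ≠ 0 := by
    intro h
    refine hd.2 (funext fun i => ?_)
    rw [h] at h2
    fin_cases i
    · exact pow_eq_zero_iff (two_ne_zero) |>.mp (le_antisymm (by simpa using h2) (sq_nonneg _))
    · exact h
  intro i
  fin_cases i
  · exact e1
  · exact e2
  · exact abs_pos.mp (lt_of_lt_of_le (by positivity) h3)

/-- The smooth functions which are homogeneous of degree zero in both variables and vanish off
the cone: the amplitudes of the test vectors. -/
structure Amplitude where
  /-- The function as a vector of `E 1 1`. -/
  vec : E 1 1
  eq_zero_of_notMem : ∀ p ∉ cone, (vec : Plane × Plane → ℂ) p = 0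

namespace Amplitude

/-- The underlying function on `ℝ² × ℝ²`. -/
def fn (G : Amplitude) : Plane × Plane → ℂ := (G.vec : Plane × Plane → ℂ)

theorem fn_smul (G : Amplitude) {a b : ℝ} (ha : a ≠ 0) (hb : b ≠ 0) {p : Plane × Plane}
    (hp : p ∈ dom) : G.fn (a • p.1, b • p.2) = G.fn p := by
  have := E.homogeneous G.1 ha hb hp.1 hp.2
  simpa [fn] using this

theorem fn_eventuallyEq (G : Amplitude) {p : Plane × Plane} (hp : p ∉ cone) :
    G.fn =ᶠ[nhds p] 0 := by
  filter_upwards [isClosed_cone.isOpen_compl.mem_nhds hp] with q hq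
  exact G.2 q hq

end Amplitude

/-- Multiplying an amplitude by a function which is smooth on `reg` and homogeneous there gives
a vector of `E`. -/
theorem mul_amplitude_mem {h : Plane × Plane → ℂ} (hh : ContDiffOn ℝ ∞ h reg)
    (hom : ∀ (a b : ℝ), a ≠ 0 → b ≠ 0 → ∀ p ∈ reg, h (a • p.1, b • p.2) =
      ((|a| : ℝ) : ℂ) ^ (τ - 1) * ((|b| : ℝ) : ℂ) ^ (τ' - 1) * h p) (G : Amplitude) :
    (fun p => h p * G.fn p) ∈ E τ τ' := by
  refine ⟨fun p hp => ?_, fun s s' hs => ?_, fun a b s s' ha hb hs hs' => ?_⟩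
  · refine ContDiffAt.contDiffWithinAt ?_
    by_cases hc : p ∈ cone
    · exact (hh.contDiffAt (isOpen_reg.mem_nhds (mem_reg_of_mem_cone hc hp))).mul
        (E.contDiffAt G.1 hp)
    · refine (contDiffAt_const (c := (0 : ℂ))).congr_of_eventuallyEq ?_
      filter_upwards [G.fn_eventuallyEq hc] with q hq
      rw [hq]; simp
  · refine mul_eq_zero_of_right _ (E.eq_zero G.1 ?_)
    rcases hs with rfl | rfl
    · exact fun h => h.1 rfl
    · exact fun h => h.2 rfl
  · have hd : (s, s') ∈ dom := ⟨hs, hs'⟩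
    have e : G.fn (a • s, b • s') = G.fn (s, s') := G.fn_smul ha hb hd
    beta_reduce
    rw [e]
    by_cases hc : (s, s') ∈ cone
    · have e' := hom a b ha hb _ (mem_reg_of_mem_cone hc hd)
      rw [e']
      ring
    · rw [show G.fn (s, s') = 0 from G.2 _ hc]
      simp

/-- The derivative of an amplitude along the Lie algebra. -/
def Amplitude.act (Z : lieG × lieG) (G : Amplitude) : Amplitude :=
  ⟨actE Z G.1, fun p hp => by
    have h := (G.fn_eventuallyEq hp).fderiv_eq (𝕜 := ℝ)
    rw [Amplitude.fn] at h
    rw [actE_apply, h]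
    simp⟩

/-- The logarithmic derivatives of the three forms along the Lie algebra. -/
def logDer (Z : lieG × lieG) (i : Fin 3) (p : Plane × Plane) : ℝ :=
  -(fderiv ℝ (coneForm i) p (mv Z p)) / coneForm i p

theorem contDiffOn_logDer (Z : lieG × lieG) (i : Fin 3) : ContDiffOn ℝ ∞ (logDer Z i) reg := by
  have h1 : ContDiff ℝ ∞ fun p => fderiv ℝ (coneForm i) p (mv Z p) :=
    ((contDiff_coneForm i).fderiv_right (by simp)).clm_apply (mv Z).contDiff
  exact h1.neg.contDiffOn.div (contDiff_coneForm i).contDiffOn fun p hp => hp i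

theorem logDer_smul (Z : lieG × lieG) (i : Fin 3) {a b : ℝ} (ha : a ≠ 0) (hb : b ≠ 0)
    (p : Plane × Plane) : logDer Z i (a • p.1, b • p.2) = logDer Z i p := by
  let S : Plane × Plane →L[ℝ] Plane × Plane :=
    (a • ContinuousLinearMap.fst ℝ Plane Plane).prod (b • ContinuousLinearMap.snd ℝ Plane Plane)
  have hS : ∀ q, S q = (a • q.1, b • q.2) := fun q => rfl
  have hc : ![a, b, a * b] i ≠ 0 := by
    fin_cases i
    · exact ha
    · exact hb
    · exact mul_ne_zero ha hb
  have hd : ∀ q, DifferentiableAt ℝ (coneForm i) q := fun q =>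
    (contDiff_coneForm i).differentiable (by simp) q
  have h1 : (fun q => coneForm i (S q)) = fun q => ![a, b, a * b] i * coneForm i q :=
    funext fun q => coneForm_smul i a b q
  have h2 : fderiv ℝ (fun q => coneForm i (S q)) p = (fderiv ℝ (coneForm i) (S p)).comp S :=
    ((hd (S p)).hasFDerivAt.comp p S.hasFDerivAt).fderiv
  have h3 : fderiv ℝ (fun q => coneForm i (S q)) p = ![a, b, a * b] i • fderiv ℝ (coneForm i) p := by
    rw [h1]
    exact ((hd p).hasFDerivAt.const_mul _).fderiv
  have h4 : mv Z (S p) = S (mv Z p) := by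
    rw [hS, hS, mv_apply, mv_apply]
    simp only [Matrix.mulVec_smul]
  have h5 : fderiv ℝ (coneForm i) (S p) (mv Z (S p)) =
      ![a, b, a * b] i * fderiv ℝ (coneForm i) p (mv Z p) := by
    rw [h4, ← ContinuousLinearMap.comp_apply, ← h2, h3]
    rfl
  rw [logDer, logDer, ← hS, h5, hS, coneForm_smul, ← mul_neg, mul_div_mul_left _ _ hc]

/-- The product of an amplitude and a logarithmic derivative. -/
def Amplitude.mulLogDer (Z : lieG × lieG) (i : Fin 3) (G : Amplitude) : Amplitude :=
  ⟨⟨fun p => (logDer Z i p : ℂ) * G.fn p, mul_amplitude_mem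
    (Complex.ofRealCLM.contDiff.comp_contDiffOn (contDiffOn_logDer Z i))
    (fun a b ha hb p _ => by simp [logDer_smul Z i ha hb]) G⟩,
    fun p hp => mul_eq_zero_of_right _ (G.2 p hp)⟩

/-- A product of complex powers of the three forms; the logarithm is that of the absolute value. -/
def phase (A : Fin 3 → ℂ) (p : Plane × Plane) : ℂ :=
  Complex.exp (∑ i, A i * (Real.log (coneForm i p) : ℂ))

theorem hasFDerivAt_phase (A : Fin 3 → ℂ) {p : Plane × Plane} (hp : p ∈ reg) :
    HasFDerivAt (phase A) (phase A p • ∑ i, A i • (Complex.ofRealCLM.comp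
      ((coneForm i p)⁻¹ • fderiv ℝ (coneForm i) p))) p := by
  refine HasFDerivAt.cexp (HasFDerivAt.fun_sum fun i _ => ?_)
  have h1 : HasFDerivAt (coneForm i) (fderiv ℝ (coneForm i) p) p :=
    ((contDiff_coneForm i).differentiable (by simp) p).hasFDerivAt
  exact (Complex.ofRealCLM.hasFDerivAt.comp p (h1.log (hp i))).const_mul (A i)

theorem contDiffOn_phase (A : Fin 3 → ℂ) : ContDiffOn ℝ ∞ (phase A) reg := by
  intro p hp
  refine (ContDiffAt.cexp (ContDiffAt.sum fun i _ => contDiffAt_const.mul ?_)).contDiffWithinAt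
  exact Complex.ofRealCLM.contDiff.contDiffAt.comp p
    ((contDiff_coneForm i).contDiffAt.log (hp i))

theorem norm_phase (A : Fin 3 → ℂ) (p : Plane × Plane) :
    ‖phase A p‖ = Real.exp (∑ i, (A i).re * Real.log (coneForm i p)) := by
  rw [phase, Complex.norm_exp, Complex.re_sum]
  simp

/-- The exponents of a test vector: the degrees of homogeneity in the two variables are `τ - 1` and
`τ' - 1`, and the oscillation is that of `|ω|^(iσ)`. -/
def expo (τ τ' : ℂ) (σ : ℝ) : Fin 3 → ℂ :=
  ![τ - 1 - σ * Complex.I, τ' - 1 - σ * Complex.I, σ * Complex.I]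

theorem phase_smul (τ τ' : ℂ) (σ : ℝ) {a b : ℝ} (ha : a ≠ 0) (hb : b ≠ 0) {p : Plane × Plane}
    (hp : p ∈ reg) : phase (expo τ τ' σ) (a • p.1, b • p.2) =
      ((|a| : ℝ) : ℂ) ^ (τ - 1) * ((|b| : ℝ) : ℂ) ^ (τ' - 1) * phase (expo τ τ' σ) p := by
  rw [ofReal_abs_cpow ha, ofReal_abs_cpow hb, phase, phase, ← Complex.exp_add, ← Complex.exp_add]
  congr 1
  have h0 := hp 0
  have h1 := hp 1
  have h2 := hp 2
  simp only [Fin.sum_univ_three, coneForm_smul, expo, Matrix.cons_val_zero, Matrix.cons_val_one,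
    Matrix.cons_val]
  rw [Real.log_mul ha h0, Real.log_mul hb h1, Real.log_mul (mul_ne_zero ha hb) h2,
    Real.log_mul ha hb, Real.log_abs, Real.log_abs]
  push_cast
  ring

/-- The test vector with a given amplitude. -/
def testVec (τ τ' : ℂ) (σ : ℝ) (G : Amplitude) : E τ τ' :=
  ⟨fun p => phase (expo τ τ' σ) p * G.fn p, mul_amplitude_mem (contDiffOn_phase _)
    (fun _ _ ha hb _ hp => phase_smul τ τ' σ ha hb hp) G⟩

theorem actE_testVec (Z : lieG × lieG) (σ : ℝ) (G : Amplitude) :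
    actE Z (testVec τ τ' σ G) = testVec τ τ' σ (G.act Z) +
      ∑ i, expo τ τ' σ i • testVec τ τ' σ (G.mulLogDer Z i) := by
  refine E.ext_dom fun p hp => ?_
  have hR : ((testVec τ τ' σ (G.act Z) + ∑ i, expo τ τ' σ i • testVec τ τ' σ (G.mulLogDer Z i) :
      E τ τ') : Plane × Plane → ℂ) p = phase (expo τ τ' σ) p * (G.act Z).fn p +
        ∑ i, expo τ τ' σ i * (phase (expo τ τ' σ) p * ((logDer Z i p : ℂ) * G.fn p)) := by
    simp only [Submodule.coe_add, Submodule.coe_sum, Pi.add_apply, Finset.sum_apply,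
      Submodule.coe_smul, Pi.smul_apply, smul_eq_mul]
    rfl
  rw [hR, actE_apply]
  have hact : (G.act Z).fn p = -(fderiv ℝ G.fn p (mv Z p)) := rfl
  have hL : ((testVec τ τ' σ G : E τ τ') : Plane × Plane → ℂ) =
      fun p => phase (expo τ τ' σ) p * G.fn p := rfl
  rw [hact, hL]
  by_cases hc : p ∈ cone
  · have h1 := hasFDerivAt_phase (expo τ τ' σ) (mem_reg_of_mem_cone hc hp)
    have h2 : HasFDerivAt G.fn (fderiv ℝ G.fn p) p := (E.differentiableAt G.1 hp).hasFDerivAt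
    have h3 : HasFDerivAt (fun p => phase (expo τ τ' σ) p * G.fn p) _ p := h1.mul h2
    rw [h3.fderiv]
    simp only [Fin.sum_univ_three, logDer, _root_.add_apply, _root_.smul_apply,
      ContinuousLinearMap.comp_apply, Complex.ofRealCLM_apply, smul_eq_mul]
    push_cast
    ring
  · have h1 := G.fn_eventuallyEq hc
    have h2 : (fun p => phase (expo τ τ' σ) p * G.fn p) =ᶠ[nhds p] 0 := by
      filter_upwards [h1] with q hq
      rw [hq]; simp
    rw [h1.fderiv_eq, h2.fderiv_eq, h1.eq_of_nhds]
    simp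

/-! ### Sobolev norms of the test vectors -/

theorem coneForm_circ_bounds {x y : ℝ} (h : (circ x, circ y) ∈ cone) (i : Fin 3) :
    1 / 100 ≤ coneForm i (circ x, circ y) ^ 2 ∧ coneForm i (circ x, circ y) ^ 2 ≤ 1 := by
  have h3 := abs_mul_le_abs_omega h
  obtain ⟨h1, -, h2⟩ := h
  simp only [circ, Matrix.cons_val_zero, Matrix.cons_val_one] at h1 h2
  have hx := Real.sin_sq_add_cos_sq x
  have hy := Real.sin_sq_add_cos_sq y
  fin_cases i
  · change 1 / 100 ≤ Real.sin x ^ 2 ∧ Real.sin x ^ 2 ≤ 1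
    constructor <;> nlinarith [sq_nonneg (Real.cos x)]
  · change 1 / 100 ≤ Real.sin y ^ 2 ∧ Real.sin y ^ 2 ≤ 1
    constructor <;> nlinarith [sq_nonneg (Real.cos y)]
  · have e : coneForm 2 (circ x, circ y) ^ 2 = |omega (circ x) (circ y)| ^ 2 := (sq_abs _).symm
    change 1 / 100 ≤ coneForm 2 (circ x, circ y) ^ 2 ∧ coneForm 2 (circ x, circ y) ^ 2 ≤ 1
    rw [e]
    constructor
    · have h4 := pow_le_pow_left₀ (by positivity) h3 2
      refine le_trans ?_ h4
      rw [mul_pow, sq_abs, sq_abs]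
      change _ ≤ Real.sin x ^ 2 * Real.sin y ^ 2
      have hsx : 1 / 2 ≤ Real.sin x ^ 2 := by linarith
      have hsy : 1 / 10 ≤ Real.sin y ^ 2 := by linarith
      calc (1 / 100 : ℝ) ≤ 1 / 2 * (1 / 10) := by norm_num
        _ ≤ _ := by gcongr
    · rw [abs_omega_circ, sq_abs]
      exact Real.sin_sq_le_one _

theorem log_coneForm_bounds {x y : ℝ} (h : (circ x, circ y) ∈ cone) (i : Fin 3) :
    -Real.log 10 ≤ Real.log (coneForm i (circ x, circ y)) ∧
      Real.log (coneForm i (circ x, circ y)) ≤ 0 := by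
  obtain ⟨h1, h2⟩ := coneForm_circ_bounds h i
  have h3 := Real.log_le_log (by norm_num) h1
  have h4 := Real.log_le_log (by linarith) h2
  rw [Real.log_pow, Real.log_one] at h4
  have e : Real.log (1 / 100) = -(2 * Real.log 10) := by
    rw [one_div, Real.log_inv, show (100 : ℝ) = 10 ^ 2 by norm_num, Real.log_pow]
    norm_num
  rw [Real.log_pow, e] at h3
  push_cast at h3 h4
  constructor <;> linarith

theorem torus_testVec (σ : ℝ) (G : Amplitude) (x y : ℝ) : torus (testVec τ τ' σ G) x y =
    phase (expo τ τ' σ) (circ x, circ y) * torus G.vec x y := rfl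

theorem torus_amplitude_eq_zero (G : Amplitude) {x y : ℝ} (h : (circ x, circ y) ∉ cone) :
    torus G.vec x y = 0 := G.2 _ h

theorem norm_torus_testVec_le (hτ : IsUnitaryParam τ) (hτ' : IsUnitaryParam τ') (σ : ℝ)
    {G : Amplitude} {B : ℝ} (hB : ∀ x y, ‖torus G.vec x y‖ ≤ B) (x y : ℝ) :
    ‖torus (testVec τ τ' σ G) x y‖ ≤ 10000 * B := by
  have hB0 : 0 ≤ B := (norm_nonneg _).trans (hB x y)
  by_cases h : (circ x, circ y) ∈ cone
  · rw [torus_testVec, norm_mul]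
    refine mul_le_mul ?_ (hB x y) (norm_nonneg _) (by norm_num)
    obtain ⟨h1, h2⟩ := hτ.re_bounds
    obtain ⟨h1', h2'⟩ := hτ'.re_bounds
    have h10 : 0 ≤ Real.log 10 := Real.log_nonneg (by norm_num)
    obtain ⟨a1, a2⟩ := log_coneForm_bounds h 0
    obtain ⟨b1, b2⟩ := log_coneForm_bounds h 1
    have e : (10000 : ℝ) = Real.exp (4 * Real.log 10) := by
      rw [show (4 : ℝ) * Real.log 10 = (4 : ℕ) * Real.log 10 by norm_num, ← Real.log_pow,
        Real.exp_log (by norm_num)]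
      norm_num
    rw [norm_phase, e, Real.exp_le_exp]
    simp only [Fin.sum_univ_three, expo, Matrix.cons_val_zero, Matrix.cons_val_one,
      Matrix.cons_val]
    simp
    nlinarith
  · rw [torus_testVec, torus_amplitude_eq_zero G h, mul_zero, norm_zero]
    positivity

/-- Every letter of a word costs at most a factor `T`: differentiating a test vector gives test
vectors with other amplitudes, multiplied by the exponents. -/
theorem exists_torus_wordAct_le (w : List (lieG × lieG)) : ∀ G : Amplitude, ∃ C : ℝ, 0 ≤ C ∧
    ∀ (τ τ' : ℂ) (σ T : ℝ), IsUnitaryParam τ → IsUnitaryParam τ' → 0 ≤ T →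
      (∀ i, ‖expo τ τ' σ i‖ ≤ 3 * T) → 1 ≤ T → ∀ x y,
      ‖torus (wordAct w (testVec τ τ' σ G)) x y‖ ≤ C * T ^ w.length := by
  induction w using List.reverseRecOn with
  | nil =>
    intro G
    obtain ⟨B, hB⟩ := torus_bounded G.vec
    refine ⟨10000 * B, mul_nonneg (by norm_num) ((norm_nonneg _).trans (hB 0 0)),
      fun τ τ' σ T hτ hτ' _ _ _ x y => ?_⟩
    simpa [wordAct] using norm_torus_testVec_le hτ hτ' σ hB x y
  | append_singleton w Z ih =>
    intro G
    obtain ⟨C, hC0, hC⟩ := ih (G.act Z)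
    choose D hD0 hD using fun i => ih (G.mulLogDer Z i)
    refine ⟨C + ∑ i, 3 * D i, add_nonneg hC0 (Finset.sum_nonneg fun i _ => by
      have := hD0 i; positivity), fun τ τ' σ T hτ hτ' hT he hT1 x y => ?_⟩
    have h1 : wordAct (w ++ [Z]) (testVec τ τ' σ G) = wordAct w (testVec τ τ' σ (G.act Z)) +
        ∑ i, expo τ τ' σ i • wordAct w (testVec τ τ' σ (G.mulLogDer Z i)) := by
      rw [wordAct_append]
      have : wordAct [Z] = actE Z (τ := τ) (τ' := τ') := by simp [wordAct]
      rw [this, actE_testVec, map_add, map_sum]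
      simp only [map_smul]
    have h2 : torus (wordAct (w ++ [Z]) (testVec τ τ' σ G)) x y =
        torus (wordAct w (testVec τ τ' σ (G.act Z))) x y +
          ∑ i, expo τ τ' σ i * torus (wordAct w (testVec τ τ' σ (G.mulLogDer Z i))) x y := by
      rw [h1]
      simp [torus, Finset.sum_apply]
    rw [h2, List.length_append, List.length_singleton, add_mul, Finset.sum_mul]
    refine (norm_add_le _ _).trans (add_le_add ?_ ((norm_sum_le _ _).trans
      (Finset.sum_le_sum fun i _ => ?_)))
    · refine (hC τ τ' σ T hτ hτ' hT he hT1 x y).trans ?_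
      gcongr
      simp
    · rw [norm_mul]
      calc _ ≤ 3 * T * (D i * T ^ w.length) :=
            mul_le_mul (he i) (hD i τ τ' σ T hτ hτ' hT he hT1 x y) (norm_nonneg _) (by positivity)
        _ = _ := by ring

theorem norm_expo_le {σ T : ℝ} (hT : 1 + ‖τ‖ + ‖τ'‖ ≤ T) (hσ : |σ| ≤ 2 * T) (i : Fin 3) :
    ‖expo τ τ' σ i‖ ≤ 3 * T := by
  have h0 : ‖(σ : ℂ) * Complex.I‖ ≤ 2 * T := by simpa using hσ
  have h1 := norm_nonneg τ
  have h2 := norm_nonneg τ'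
  fin_cases i
  · refine (norm_sub_le _ _).trans ?_
    have := norm_sub_le τ 1
    rw [norm_one] at this
    linarith
  · refine (norm_sub_le _ _).trans ?_
    have := norm_sub_le τ' 1
    rw [norm_one] at this
    linarith
  · exact h0.trans (by linarith)

theorem exists_sobQ_testVec_le (b : Module.Basis (Fin 6) ℝ (lieG × lieG)) (l : ℕ) (G : Amplitude) :
    ∃ C : ℝ, 0 ≤ C ∧ ∀ (τ τ' : ℂ), IsUnitaryParam τ → IsUnitaryParam τ' → ∀ σ T : ℝ,
      1 + ‖τ‖ + ‖τ'‖ ≤ T → |σ| ≤ 2 * T → sobQ b l T (testVec τ τ' σ G) ≤ C * T ^ (2 * l) := by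
  choose C hC0 hC using fun n : Fin 6 → ℕ => exists_torus_wordAct_le ((sortedWord n).map b) G
  refine ⟨∑ k ∈ Finset.range (l + 1), ∑ n ∈ Finset.piAntidiag (Finset.univ : Finset (Fin 6)) k,
    C n ^ 2, by positivity, fun τ τ' hτ hτ' σ T hT hσ => ?_⟩
  have hT1 : 1 ≤ T := by linarith [norm_nonneg τ, norm_nonneg τ']
  rw [sobQ, Finset.sum_mul]
  refine Finset.sum_le_sum fun k hk => ?_
  rw [Finset.sum_mul]
  refine Finset.sum_le_sum fun n hn => ?_
  have hkl : k ≤ l := Nat.lt_succ_iff.mp (Finset.mem_range.mp hk)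
  rw [Finset.mem_piAntidiag] at hn
  have h1 : nsq (mono b n (testVec τ τ' σ G)) ≤ (C n * T ^ k) ^ 2 := by
    refine nsq_le_of_bound hτ hτ' fun x y => ?_
    have := hC n τ τ' σ T hτ hτ' (by linarith) (norm_expo_le hT hσ) hT1 x y
    rwa [List.length_map, length_sortedWord, hn.1] at this
  calc _ ≤ T ^ (2 * (l - k)) * (C n * T ^ k) ^ 2 := by gcongr
    _ = C n ^ 2 * T ^ (2 * (l - k) + 2 * k) := by rw [pow_add]; ring
    _ = _ := by congr 2; omega

theorem testVec_mem_offDiag (hτ : IsUnitaryParam τ) (hτ' : IsUnitaryParam τ') (σ : ℝ)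
    (G : Amplitude) : testVec τ τ' σ G ∈ offDiag τ τ' := by
  obtain ⟨B, hB⟩ := torus_bounded G.vec
  have hB0 : 0 ≤ B := (norm_nonneg _).trans (hB 0 0)
  refine ⟨10000 * B * 10, fun x y => ?_⟩
  by_cases h : (circ x, circ y) ∈ cone
  · have h1 := norm_torus_testVec_le hτ hτ' σ hB x y
    have h2 : 1 / 10 ≤ |Real.sin (x - y)| := by
      rw [← abs_omega_circ]
      refine abs_le_of_sq_le_sq' ?_ (abs_nonneg _) |>.2
      have := (coneForm_circ_bounds h 2).1
      change 1 / 100 ≤ omega (circ x) (circ y) ^ 2 at this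
      rw [sq_abs]
      linarith
    refine h1.trans ?_
    calc 10000 * B = 10000 * B * 10 * (1 / 10) := by ring
      _ ≤ _ := by gcongr
  · rw [torus_testVec, torus_amplitude_eq_zero G h, mul_zero, norm_zero]
    positivity

/-! ### Rotations -/

/-- The rotation by the angle `t`. -/
def rotGL (t : ℝ) : GL (Fin 2) ℝ where
  val := !![Real.cos t, -Real.sin t; Real.sin t, Real.cos t]
  inv := !![Real.cos t, Real.sin t; -Real.sin t, Real.cos t]
  val_inv := by
    have := Real.sin_sq_add_cos_sq t
    ext i j
    fin_cases i <;> fin_cases j <;> simp [Matrix.mul_apply] <;> linarith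
  inv_val := by
    have := Real.sin_sq_add_cos_sq t
    ext i j
    fin_cases i <;> fin_cases j <;> simp [Matrix.mul_apply] <;> linarith

theorem rotGL_mem_bddGL (t : ℝ) : rotGL t ∈ bddGL 1 := by
  have hs := Real.abs_sin_le_one t
  have hc := Real.abs_cos_le_one t
  constructor
  · intro i j
    change |(!![Real.cos t, -Real.sin t; Real.sin t, Real.cos t] : Matrix _ _ ℝ) i j| ≤ 1
    fin_cases i <;> fin_cases j <;> simpa
  · intro i j
    change |(!![Real.cos t, Real.sin t; -Real.sin t, Real.cos t] : Matrix _ _ ℝ) i j| ≤ 1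
    fin_cases i <;> fin_cases j <;> simpa

theorem torus_repE_rotGL (t : ℝ) (u : E τ τ') (x y : ℝ) :
    torus (repE (rotGL t) (rotGL t) u) x y = torus u (x - t) (y - t) := by
  have hd : ∀ ρ, detFactor ρ (rotGL t) = 1 := fun ρ => by
    have : ((rotGL t : GL (Fin 2) ℝ) : Matrix (Fin 2) (Fin 2) ℝ).det = 1 := by
      change Matrix.det !![Real.cos t, -Real.sin t; Real.sin t, Real.cos t] = 1
      rw [Matrix.det_fin_two_of]
      linarith [Real.sin_sq_add_cos_sq t]
    simp [detFactor, this]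
  have hr : ∀ θ, (((rotGL t)⁻¹ : GL (Fin 2) ℝ) : Matrix (Fin 2) (Fin 2) ℝ).mulVec (circ θ) =
      circ (θ - t) := fun θ => by
    change (!![Real.cos t, Real.sin t; -Real.sin t, Real.cos t] : Matrix _ _ ℝ).mulVec _ = _
    ext i
    fin_cases i
    · simp [circ, Matrix.mulVec, dotProduct, Fin.sum_univ_two, Real.cos_sub]; ring
    · simp [circ, Matrix.mulVec, dotProduct, Fin.sum_univ_two, Real.sin_sub]; ring
  rw [torus, repE_apply, hd, hd, invMap_apply]
  simp only [hr, one_mul]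
  rfl

theorem repE_rotGL_mem_offDiag (t : ℝ) {u : E τ τ'} (hu : u ∈ offDiag τ τ') :
    repE (rotGL t) (rotGL t) u ∈ offDiag τ τ' := by
  obtain ⟨B, hB⟩ := hu
  refine ⟨B, fun x y => ?_⟩
  rw [torus_repE_rotGL]
  simpa using hB (x - t) (y - t)

theorem modelOp_repE_rotGL (hτ : IsUnitaryParam τ) (hτ' : IsUnitaryParam τ') {lam : ℂ}
    (hlam : lam.re = 0) (t : ℝ) {u : E τ τ'} (hu : u ∈ offDiag τ τ') (z : ℝ) :
    modelOp lam (repE (rotGL t) (rotGL t) u) z = modelOp lam u (z - t) := by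
  rw [modelOp_eq hτ hτ' hlam (repE_rotGL_mem_offDiag t hu), modelOp_eq hτ hτ' hlam hu]
  simp only [torus_repE_rotGL, add_sub_assoc]

/-! ### Nonvanishing of the model operator on a test vector -/

/-- A nonnegative amplitude which is not identically zero. -/
def bump : Amplitude where
  vec := ⟨fun p => ((Real.smoothTransition ((p.1 1 ^ 2 - p.1 0 ^ 2) / (p.1 0 ^ 2 + p.1 1 ^ 2)) *
      (Real.smoothTransition ((p.2 0 ^ 2 - 4 * p.2 1 ^ 2) / (p.2 0 ^ 2 + p.2 1 ^ 2)) *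
        Real.smoothTransition ((9 * p.2 1 ^ 2 - p.2 0 ^ 2) / (p.2 0 ^ 2 + p.2 1 ^ 2))) : ℝ) : ℂ), by
    refine ⟨?_, fun s s' h => ?_, fun a b s s' ha hb _ _ => ?_⟩
    · have h1 : ∀ j : Fin 2, ContDiff ℝ ∞ fun p : Plane × Plane => p.1 j := fun j =>
        (contDiff_coord j).comp contDiff_fst
      have h2 : ∀ j : Fin 2, ContDiff ℝ ∞ fun p : Plane × Plane => p.2 j := fun j =>
        (contDiff_coord j).comp contDiff_snd
      have hsT : ContDiff ℝ ∞ Real.smoothTransition := Real.smoothTransition.contDiff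
      have hn : ContDiff ℝ ∞ fun p : Plane × Plane => p.1 0 ^ 2 + p.1 1 ^ 2 :=
        ((h1 0).pow 2).add ((h1 1).pow 2)
      have hn' : ContDiff ℝ ∞ fun p : Plane × Plane => p.2 0 ^ 2 + p.2 1 ^ 2 :=
        ((h2 0).pow 2).add ((h2 1).pow 2)
      refine Complex.ofRealCLM.contDiff.comp_contDiffOn (ContDiffOn.mul
        (hsT.comp_contDiffOn ?_) ((hsT.comp_contDiffOn ?_).mul (hsT.comp_contDiffOn ?_)))
      · exact (((h1 1).pow 2).sub ((h1 0).pow 2)).contDiffOn.div hn.contDiffOn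
          fun p hp => (sq_add_sq_pos hp.1).ne'
      · exact (((h2 0).pow 2).sub (contDiff_const.mul ((h2 1).pow 2))).contDiffOn.div hn'.contDiffOn
          fun p hp => (sq_add_sq_pos hp.2).ne'
      · exact ((contDiff_const.mul ((h2 1).pow 2)).sub ((h2 0).pow 2)).contDiffOn.div hn'.contDiffOn
          fun p hp => (sq_add_sq_pos hp.2).ne'
    · rcases h with rfl | rfl <;> simp [Real.smoothTransition.zero]
    · have ha2 : a ^ 2 ≠ 0 := by positivity
      have hb2 : b ^ 2 ≠ 0 := by positivity
      simp only [Pi.smul_apply, smul_eq_mul, mul_pow, sub_self, Complex.cpow_zero, one_mul,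
        ← mul_add, ← mul_sub, mul_left_comm _ (b ^ 2), mul_div_mul_left _ _ ha2,
        mul_div_mul_left _ _ hb2]⟩
  eq_zero_of_notMem p hp := by
    have hz : ∀ {c d : ℝ}, c ≤ 0 → 0 ≤ d → Real.smoothTransition (c / d) = 0 := fun hc hd =>
      Real.smoothTransition.zero_of_nonpos (div_nonpos_of_nonpos_of_nonneg hc hd)
    have n1 : 0 ≤ p.1 0 ^ 2 + p.1 1 ^ 2 := by positivity
    have n2 : 0 ≤ p.2 0 ^ 2 + p.2 1 ^ 2 := by positivity
    change ((_ * (_ * _) : ℝ) : ℂ) = 0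
    by_cases h1 : p.1 0 ^ 2 ≤ p.1 1 ^ 2
    · by_cases h2 : 4 * p.2 1 ^ 2 ≤ p.2 0 ^ 2
      · have h3 : ¬ p.2 0 ^ 2 ≤ 9 * p.2 1 ^ 2 := fun h3 => hp ⟨h1, h2, h3⟩
        rw [hz (c := 9 * p.2 1 ^ 2 - p.2 0 ^ 2) (by linarith) n2]
        simp
      · rw [hz (c := p.2 0 ^ 2 - 4 * p.2 1 ^ 2) (by linarith) n2]
        simp
    · rw [hz (c := p.1 1 ^ 2 - p.1 0 ^ 2) (by linarith) n1]
      simp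

/-- On the cone the model kernel cancels the oscillation of the test vector: for the frequency `σ`
given here their product is a positive real number, bounded below. -/
theorem exists_phase_mul_circKernel (hτ : IsUnitaryParam τ) (hτ' : IsUnitaryParam τ') {lam : ℂ}
    (hlam : lam.re = 0) {x y : ℝ} (h : (circ x, circ y) ∈ cone) :
    ∃ r : ℝ, 1 / 10 ≤ r ∧ phase (expo τ τ' ((τ.im + τ'.im - lam.im) / 2)) (circ x, circ y) *
      circKernel τ τ' lam x y = r := by
  obtain ⟨h1, h2⟩ := hτ.re_bounds
  obtain ⟨h1', h2'⟩ := hτ'.re_bounds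
  have hne := mem_reg_of_mem_cone h (circ_mem_dom x y)
  obtain ⟨-, a2⟩ := log_coneForm_bounds h 0
  obtain ⟨-, b2⟩ := log_coneForm_bounds h 1
  obtain ⟨c1, c2⟩ := log_coneForm_bounds h 2
  have n0 : Real.sin x ≠ 0 := hne 0
  have n1 : Real.sin y ≠ 0 := hne 1
  have n2 : Real.sin (x - y) ≠ 0 := by
    rw [← abs_pos, ← abs_omega_circ, abs_pos]
    exact hne 2
  have e0 : Real.log |Real.sin x| = Real.log (coneForm 0 (circ x, circ y)) := Real.log_abs _
  have e1 : Real.log |Real.sin y| = Real.log (coneForm 1 (circ x, circ y)) := Real.log_abs _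
  have e2 : Real.log |Real.sin (x - y)| = Real.log (coneForm 2 (circ x, circ y)) := by
    rw [← abs_omega_circ]
    exact Real.log_abs _
  rw [circKernel, ofReal_abs_cpow n0, ofReal_abs_cpow n1, ofReal_abs_cpow n2, e0, e1, e2, phase,
    Fin.sum_univ_three, ← Complex.exp_add, ← Complex.exp_add, ← Complex.exp_add]
  generalize Real.log (coneForm 0 (circ x, circ y)) = L0 at *
  generalize Real.log (coneForm 1 (circ x, circ y)) = L1 at *
  generalize Real.log (coneForm 2 (circ x, circ y)) = L2 at *
  simp only [expo, Matrix.cons_val_zero, Matrix.cons_val_one, Matrix.cons_val]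
  -- the imaginary parts of the exponents cancel, and the real parts of the first two are negative
  -- while the logarithms are at most zero
  refine ⟨Real.exp ((τ.re + τ'.re - 3) / 2 * (L0 + L1) + (-τ.re - τ'.re - 1) / 2 * L2), ?_, ?_⟩
  · have e : (1 / 10 : ℝ) = Real.exp (-Real.log 10) := by
      rw [Real.exp_neg, Real.exp_log (by norm_num), one_div]
    rw [e, Real.exp_le_exp]
    nlinarith
  · rw [Complex.ofReal_exp]
    congr 1
    apply Complex.ext
    · simp [hlam]; ring
    · simp; ring

/-- The value of the bump amplitude at a point of the torus. -/
theorem torus_bump (x y : ℝ) : torus bump.vec x y =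
    ((Real.smoothTransition (Real.sin x ^ 2 - Real.cos x ^ 2) *
      (Real.smoothTransition (Real.cos y ^ 2 - 4 * Real.sin y ^ 2) *
        Real.smoothTransition (9 * Real.sin y ^ 2 - Real.cos y ^ 2)) : ℝ) : ℂ) := by
  have h : ∀ θ, circ θ 0 ^ 2 + circ θ 1 ^ 2 = 1 := fun θ => by simp [circ]
  change ((Real.smoothTransition ((circ x 1 ^ 2 - circ x 0 ^ 2) / (circ x 0 ^ 2 + circ x 1 ^ 2)) *
      (Real.smoothTransition ((circ y 0 ^ 2 - 4 * circ y 1 ^ 2) / (circ y 0 ^ 2 + circ y 1 ^ 2)) *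
        Real.smoothTransition ((9 * circ y 1 ^ 2 - circ y 0 ^ 2) / (circ y 0 ^ 2 + circ y 1 ^ 2))) :
          ℝ) : ℂ) = _
  rw [h, h, div_one, div_one, div_one]
  rfl

theorem integral_circle_pos {f : ℝ → ℝ} (hf : Continuous f) (h0 : ∀ x, 0 ≤ f x)
    {c : ℝ} (hc : c ∈ Set.Icc 0 (2 * Real.pi)) (hfc : 0 < f c) : 0 < ∫ x, f x ∂circleMeasure := by
  rw [integral_circle]
  have h := intervalIntegral.integral_pos (a := 0) (b := 2 * Real.pi) (by positivity)
    hf.continuousOn (fun x _ => h0 x) ⟨c, hc, hfc⟩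
  rw [smul_eq_mul]
  positivity

/-- The model operator does not vanish on the test vector with the matching frequency, uniformly in
the parameters. -/
theorem exists_le_norm_modelOp_bump : ∃ c : ℝ, 0 < c ∧ ∀ (τ τ' : ℂ), IsUnitaryParam τ →
    IsUnitaryParam τ' → ∀ lam : ℂ, lam.re = 0 →
      c ≤ ‖modelOp lam (testVec τ τ' ((τ.im + τ'.im - lam.im) / 2) bump) 0‖ := by
  let f : ℝ → ℝ := fun x => Real.smoothTransition (Real.sin x ^ 2 - Real.cos x ^ 2)
  let g : ℝ → ℝ := fun y => Real.smoothTransition (Real.cos y ^ 2 - 4 * Real.sin y ^ 2) *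
    Real.smoothTransition (9 * Real.sin y ^ 2 - Real.cos y ^ 2)
  have hf : Continuous f := Real.smoothTransition.continuous.comp (by fun_prop)
  have hg : Continuous g := (Real.smoothTransition.continuous.comp (by fun_prop)).mul
    (Real.smoothTransition.continuous.comp (by fun_prop))
  have hf0 : ∀ x, 0 ≤ f x := fun x => Real.smoothTransition.nonneg _
  have hg0 : ∀ x, 0 ≤ g x := fun x =>
    mul_nonneg (Real.smoothTransition.nonneg _) (Real.smoothTransition.nonneg _)
  have hpi := Real.pi_pos
  have hF : 0 < ∫ x, f x ∂circleMeasure := by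
    refine integral_circle_pos hf hf0 (c := Real.pi / 2) ⟨by linarith, by linarith⟩ ?_
    exact Real.smoothTransition.pos_of_pos (by simp)
  have hG : 0 < ∫ y, g y ∂circleMeasure := by
    -- the slope `2/5` of the horizontal coordinate lies between `1/3` and `1/2`
    refine integral_circle_pos hg hg0 (c := Real.arctan (2 / 5))
      ⟨Real.arctan_nonneg.mpr (by norm_num), by linarith [Real.arctan_lt_pi_div_two (2 / 5)]⟩ ?_
    have h1 := Real.cos_sq_arctan (2 / 5)
    have h2 := Real.sin_sq_add_cos_sq (Real.arctan (2 / 5))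
    norm_num at h1
    exact mul_pos (Real.smoothTransition.pos_of_pos (by linarith))
      (Real.smoothTransition.pos_of_pos (by linarith))
  refine ⟨1 / 10 * ((∫ x, f x ∂circleMeasure) * ∫ y, g y ∂circleMeasure), by positivity,
    fun τ τ' hτ hτ' lam hlam => ?_⟩
  have hu := testVec_mem_offDiag hτ hτ' ((τ.im + τ'.im - lam.im) / 2) bump
  have hint := integrable_torus_mul_circKernel hτ hτ' hlam hu 0 0
  have heq := modelOp_eq hτ hτ' hlam hu 0
  simp only [add_zero, sub_zero] at hint heq
  refine le_trans ?_ (Complex.re_le_norm _)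
  rw [heq, ← integral_prod_mul, ← integral_const_mul, ← Complex.reCLM_apply,
    ← Complex.reCLM.integral_comp_comm hint]
  refine integral_mono (((integrable_circle hf).mul_prod (integrable_circle hg)).const_mul _)
    (Complex.reCLM.integrable_comp hint) fun p => ?_
  have hb : torus bump.vec p.1 p.2 = ((f p.1 * g p.2 : ℝ) : ℂ) := torus_bump p.1 p.2
  beta_reduce
  by_cases h : (circ p.1, circ p.2) ∈ cone
  · obtain ⟨r, hr, hre⟩ := exists_phase_mul_circKernel hτ hτ' hlam h
    have e : torus (testVec τ τ' ((τ.im + τ'.im - lam.im) / 2) bump) p.1 p.2 *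
        circKernel τ τ' lam p.1 p.2 = ((r * (f p.1 * g p.2) : ℝ) : ℂ) := by
      rw [torus_testVec, mul_right_comm, hre, hb, ← Complex.ofReal_mul]
    rw [e, Complex.reCLM_apply, Complex.ofReal_re]
    exact mul_le_mul_of_nonneg_right hr (mul_nonneg (hf0 _) (hg0 _))
  · have h1 := torus_amplitude_eq_zero bump h
    rw [torus_testVec, h1, mul_zero, zero_mul, map_zero]
    rw [hb] at h1
    rw [Complex.ofReal_eq_zero.mp h1, mul_zero]

/-! ### Orthonormal bases and the relative trace of the model form -/

/-- A positive definite Hermitian form on a finite dimensional space has an orthonormal basis. -/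
theorem exists_basis_orthonormal {W : Type*} [AddCommGroup W] [Module ℂ W]
    [FiniteDimensional ℂ W] (Q : W → W → ℂ) (hconj : ∀ u v, conj (Q u v) = Q v u)
    (hadd : ∀ u v w, Q (u + v) w = Q u w + Q v w) (hsmul : ∀ (c : ℂ) u w, Q (c • u) w = c * Q u w)
    (hpos : ∀ u, u ≠ 0 → 0 < (Q u u).re) :
    ∃ e : Module.Basis (Fin (Module.finrank ℂ W)) ℂ W,
      ∀ i j, Q (e i) (e j) = if i = j then 1 else 0 := by
  have h0 : Q 0 0 = 0 := by simpa using hsmul 0 0 0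
  let core : InnerProductSpace.Core ℂ W :=
    { inner := fun u v => Q v u
      conj_inner_symm := fun u v => hconj u v
      re_inner_nonneg := fun u => by
        by_cases hu : u = 0
        · simp [hu, h0]
        · exact (hpos u hu).le
      add_left := fun u v w => by
        change Q w (u + v) = Q w u + Q w v
        rw [← hconj, hadd, map_add, hconj, hconj]
      smul_left := fun u v c => by
        change Q v (c • u) = conj c * Q v u
        rw [← hconj, hsmul, map_mul, hconj]
      definite := fun u hu => by
        by_contra hne
        have := hpos u hne
        change Q u u = 0 at hu
        rw [hu] at this
        exact lt_irrefl _ this }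
  let _ : NormedAddCommGroup W := core.toNormedAddCommGroup
  let _ : InnerProductSpace ℂ W := InnerProductSpace.ofCore core.toCore
  let o := stdOrthonormalBasis ℂ W
  refine ⟨o.toBasis, fun i j => ?_⟩
  have h := (orthonormal_iff_ite.mp o.orthonormal) j i
  rw [o.coe_toBasis]
  simp only [eq_comm (a := j)] at h
  exact h

theorem exists_orthonormal_span (b : Module.Basis (Fin 6) ℝ (lieG × lieG)) (l : ℕ) {T : ℝ}
    (hT : 1 ≤ T) (hτ : IsUnitaryParam τ) (hτ' : IsUnitaryParam τ') {ι : Type*} [Finite ι]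
    (u : ι → E τ τ') : ∃ (m : ℕ) (f : Fin m → E τ τ'),
      (∀ i j, sobolevForm b l T (f i) (f j) = if i = j then 1 else 0) ∧
      (∀ i, f i ∈ Submodule.span ℂ (Set.range u)) ∧ ∀ j, ∃ c : Fin m → ℂ, u j = ∑ i, c i • f i := by
  have := FiniteDimensional.span_of_finite ℂ (Set.finite_range u)
  obtain ⟨e, he⟩ := exists_basis_orthonormal (W := Submodule.span ℂ (Set.range u))
    (fun v w => sobolevForm b l T (v : E τ τ') (w : E τ τ'))
    (fun v w => by rw [sobolevForm_conj b l T hτ hτ'])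
    (fun v w x => by rw [Submodule.coe_add, sobolevForm_add_left b l T hτ hτ'])
    (fun c v x => by rw [Submodule.coe_smul, sobolevForm_smul_left b l T hτ hτ']) (fun v hv => by
      rw [sobolevForm_self b l T hτ hτ', Complex.ofReal_re]
      exact sobQ_pos b hT hτ hτ' fun h => hv (Subtype.ext h))
  refine ⟨_, fun i => e i, he, fun i => (e i).2, fun j => ?_⟩
  refine ⟨e.repr ⟨u j, Submodule.subset_span ⟨j, rfl⟩⟩, ?_⟩
  have h := congrArg (Submodule.subtype (Submodule.span ℂ (Set.range u)))
    (e.sum_repr ⟨u j, Submodule.subset_span ⟨j, rfl⟩⟩)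
  rw [map_sum] at h
  exact h.symm

/-- If at every point of the circle one of finitely many vectors of bounded Sobolev norm has
a large value of the model operator, then the relative trace is large: at each point the sum over
an orthonormal basis of the squared values is at least the quotient of the squared value and the
squared norm for any single vector. -/
theorem le_relTrace_modelForm (b : Module.Basis (Fin 6) ℝ (lieG × lieG)) (l : ℕ) {T : ℝ}
    (hT : 1 ≤ T) (hτ : IsUnitaryParam τ) (hτ' : IsUnitaryParam τ') {lam : ℂ} (hlam : lam.re = 0)
    {ι : Type*} [Finite ι] {u : ι → E τ τ'} (hu : ∀ j, u j ∈ offDiag τ τ') {B c : ℝ} (hB0 : 0 < B)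
    (hB : ∀ j, sobQ b l T (u j) ≤ B)
    (hc : ∀ z ∈ Set.Ioc 0 (2 * Real.pi), ∃ j, c ≤ ‖modelOp lam (u j) z‖ ^ 2) :
    ENNReal.ofReal (c / B) ≤ relTrace (modelForm (τ := τ) (τ' := τ') lam) (sobolevForm b l T) := by
  obtain ⟨m, f, he, hfW, hrep⟩ := exists_orthonormal_span b l hT hτ hτ' u
  have hf : ∀ i, f i ∈ offDiag τ τ' := fun i =>
    Submodule.span_le.mpr (Set.range_subset_iff.mpr hu) (hfW i)
  let S : ℝ → ℝ := fun z => ∑ i, ‖modelOp lam (f i) z‖ ^ 2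
  have hcont : ∀ i, Continuous fun z => ‖modelOp lam (f i) z‖ ^ 2 := fun i =>
    ((continuous_modelOp hτ hτ' hlam (hf i)).norm).pow 2
  have hS : ∀ z ∈ Set.Ioc 0 (2 * Real.pi), c / B ≤ S z := by
    intro z hz
    obtain ⟨j, hj⟩ := hc z hz
    obtain ⟨d, hd⟩ := hrep j
    have h1 : ∑ i, ‖d i‖ ^ 2 ≤ B := by
      rw [← sobQ_sum_of_orthonormal b l T hτ hτ' he, ← hd]
      exact hB j
    rw [div_le_iff₀ hB0]
    refine hj.trans ?_
    rw [hd, modelOp_sum hτ hτ' hlam _ _ hf]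
    calc _ ≤ (∑ i, ‖d i‖ * ‖modelOp lam (f i) z‖) ^ 2 := by
          gcongr
          exact (norm_sum_le _ _).trans_eq (Finset.sum_congr rfl fun i _ => norm_mul _ _)
      _ ≤ (∑ i, ‖d i‖ ^ 2) * S z := Finset.sum_mul_sq_le_sq_mul_sq _ _ _
      _ ≤ B * S z := mul_le_mul_of_nonneg_right h1 (Finset.sum_nonneg fun i _ => sq_nonneg _)
      _ = S z * B := mul_comm _ _
  have hform : ∀ i, (modelForm lam (f i) (f i)).re = ∫ z, ‖modelOp lam (f i) z‖ ^ 2 ∂circleMeasure := by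
    intro i
    have : modelForm lam (f i) (f i) =
        ((∫ z, ‖modelOp lam (f i) z‖ ^ 2 ∂circleMeasure : ℝ) : ℂ) := by
      rw [modelForm, ← integral_complex_ofReal]
      congr 1; ext z
      rw [Complex.mul_conj, Complex.normSq_eq_norm_sq]
    rw [this, Complex.ofReal_re]
  refine le_trans ?_ (le_iSup_of_le m (le_iSup_of_le f (le_iSup_of_le he le_rfl)))
  simp_rw [hform]
  rw [← ENNReal.ofReal_sum_of_nonneg fun i _ => integral_nonneg fun z => sq_nonneg _,
    ← integral_finsetSum _ fun i _ => integrable_circle (hcont i)]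
  refine ENNReal.ofReal_le_ofReal ?_
  have hae : ∀ᵐ z ∂circleMeasure, z ∈ Set.Ioc 0 (2 * Real.pi) :=
    Measure.ae_smul_measure (ae_restrict_mem measurableSet_Ioc) _
  have h1 : ∫ _, c / B ∂circleMeasure ≤ ∫ z, S z ∂circleMeasure :=
    integral_mono_ae (integrable_const _)
      (integrable_circle (continuous_finsetSum _ fun i _ => hcont i)) (hae.mono hS)
  simpa using h1

/-! ### The lower bound -/

/-- The lower bound for the relative trace of the model form, obtained from the rotations of one test
vector. -/
theorem exists_le_relTrace_modelForm {Γ : Subgroup G} {μ : Measure (X Γ)}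
    (hμ : IsInvariantProbability μ) (l : ℕ) (b : Module.Basis (Fin 6) ℝ (lieG × lieG)) :
    ∃ c : ℝ, 0 < c ∧ ∀ (τ τ' : ℂ), IsUnitaryParam τ → IsUnitaryParam τ' →
      ∀ (ν : V τ →ₗ[ℂ] (X Γ → ℂ)) (ν' : V τ' →ₗ[ℂ] (X Γ → ℂ)),
        IsEnhancement μ τ ν → IsEnhancement μ τ' ν' → ∀ T : ℝ, 1 + ‖τ‖ + ‖τ'‖ ≤ T →
          ∀ lam : ℂ, lam.re = 0 → ‖lam‖ ≤ 2 * T → ENNReal.ofReal (c * T ^ (-2 * (l : ℤ))) ≤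
            relTrace (modelForm (τ := τ) (τ' := τ') lam) (sobolevForm b l T) := by
  obtain ⟨c, hc0, hc⟩ := exists_le_norm_modelOp_bump
  obtain ⟨C, hC0, hC⟩ := exists_sobQ_testVec_le b l bump
  obtain ⟨A, hA⟩ := exists_adInv_bound b 1
  obtain ⟨D, hD0, hD⟩ := exists_sobQ_repE_le b l A
  refine ⟨(c / 2) ^ 2 / (D * C + 1), by positivity,
    fun τ τ' hτ hτ' ν ν' hν hν' T hT lam hlam hlT => ?_⟩
  have hn := norm_nonneg τ
  have hn' := norm_nonneg τ'
  have hT1 : 1 ≤ T := by linarith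
  let u := testVec τ τ' ((τ.im + τ'.im - lam.im) / 2) bump
  have hu : u ∈ offDiag τ τ' := testVec_mem_offDiag hτ hτ' _ bump
  have hσ : |(τ.im + τ'.im - lam.im) / 2| ≤ 2 * T := by
    have h1 := Complex.abs_im_le_norm τ
    have h2 := Complex.abs_im_le_norm τ'
    have h3 := Complex.abs_im_le_norm lam
    rw [abs_le] at h1 h2 h3 ⊢
    constructor <;> linarith [h1.1, h1.2, h2.1, h2.2, h3.1, h3.2]
  have hcont := (continuous_modelOp hτ hτ' hlam hu).norm
  -- the radius depends on all parameters, which is harmless: the number of rotated vectors does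
  -- not enter the bound
  obtain ⟨ε, hε, hεu⟩ := Metric.continuousAt_iff.mp (hcont.continuousAt (x := 0)) (c / 2)
    (by positivity)
  obtain ⟨S, -, hS, hcov⟩ := (isCompact_Icc (a := (0 : ℝ)) (b := 2 * Real.pi)).finite_cover_balls hε
  have : Finite S := hS
  have hrot : ∀ t : S, sobQ b l T (repE (rotGL t) (rotGL t) u) ≤ (D * C + 1) * T ^ (2 * l) := by
    intro t
    have h1 := hD τ τ' hτ hτ' (rotGL t) (rotGL t)
      (hA _ (rotGL_mem_bddGL t) _ (rotGL_mem_bddGL t)) (nsq_repE hμ hτ hτ' hν hν' _ _) T hT1 u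
    have h2 := mul_le_mul_of_nonneg_left (hC τ τ' hτ hτ' _ T hT hσ) hD0
    have h3 : 0 ≤ T ^ (2 * l) := by positivity
    refine h1.trans (h2.trans ?_)
    nlinarith
  refine le_trans (le_of_eq ?_) (le_relTrace_modelForm b l hT1 hτ hτ' hlam
    (u := fun t : S => repE (rotGL t) (rotGL t) u) (fun t => repE_rotGL_mem_offDiag _ hu)
    (B := (D * C + 1) * T ^ (2 * l)) (c := (c / 2) ^ 2) (by positivity) hrot fun z hz => ?_)
  · rw [neg_mul, zpow_neg, show (2 : ℤ) * l = ((2 * l : ℕ) : ℤ) by push_cast; rfl, zpow_natCast,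
      ← div_eq_mul_inv, div_div]
  · obtain ⟨t, ht, hzt⟩ := Set.mem_iUnion₂.mp (hcov (Set.Ioc_subset_Icc_self hz))
    refine ⟨⟨t, ht⟩, pow_le_pow_left₀ (by positivity) ?_ 2⟩
    rw [modelOp_repE_rotGL hτ hτ' hlam t hu]
    have h1 := hεu (x := z - t) (by rwa [dist_zero_right, ← dist_eq_norm])
    have h2 := hc τ τ' hτ hτ' lam hlam
    rw [Real.dist_eq, abs_lt] at h1
    have h3 := h1.1
    change c ≤ ‖modelOp lam u 0‖ at h2
    linarith

end TripleProduct

end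

open TripleProduct MeasureTheory in
theorem mainTheorem5 (Γ : Subgroup G) (hdisc : DiscreteTopology Γ) (hcomp : CompactSpace (X Γ))
    (μ : Measure (X Γ)) (hμ : IsInvariantProbability μ)
    (l : ℕ) (hl : 2 ≤ l) (b : Module.Basis (Fin 6) ℝ (lieG × lieG)) :
    ∃ C c : ℝ, 0 < C ∧ 0 < c ∧
      ∀ (τ τ' : ℂ), IsUnitaryParam τ → IsUnitaryParam τ' →
      ∀ (ν : V τ →ₗ[ℂ] (X Γ → ℂ)) (ν' : V τ' →ₗ[ℂ] (X Γ → ℂ)),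
        IsEnhancement μ τ ν → IsEnhancement μ τ' ν' →
        ∃ T₀ : ℝ, 0 < T₀ ∧ ∀ T : ℝ, T₀ ≤ T →
          relTrace (diagForm μ ν ν') (sobolevForm b l T) ≤
              ENNReal.ofReal (C * T ^ (2 - 2 * (l : ℤ))) ∧
          ∀ lam : ℂ, lam.re = 0 → ‖lam‖ ≤ 2 * T →
            ENNReal.ofReal (c * T ^ (-2 * (l : ℤ))) ≤
              relTrace (modelForm (τ := τ) (τ' := τ') lam) (sobolevForm b l T) := by
  obtain ⟨C, hC0, hC⟩ := exists_relTrace_diagForm_le hcomp hμ hl b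
  obtain ⟨c, hc0, hc⟩ := exists_le_relTrace_modelForm hμ l b
  refine ⟨C, c, hC0, hc0, fun τ τ' hτ hτ' ν ν' hν hν' =>
    ⟨1 + ‖τ‖ + ‖τ'‖, by positivity, fun T hT => ?_⟩⟩
  have hT1 : 1 ≤ T := by linarith [norm_nonneg τ, norm_nonneg τ']
  exact ⟨hC τ τ' hτ hτ' ν ν' hν hν' T hT1, hc τ τ' hτ hτ' ν ν' hν hν' T hT⟩
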